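/- **Setting.** An $m$-player finite-horizon general-sum Markov game has states $\mathcal S=\{1,\dots,S\}$, action sets $\mathcal A_i=\{1,\dots,A_i\}$, $\mathcal A=\prod_{i=1}^m\mathcal A_i$, horizon $H$, a nominal kernel $P^0=\{P^0_h\}_{h=1}^H$ with $P^0_h:\mathcal S\times\mathcal A\to\Delta(\mathcal S)$, and rewards $r_{i,h}:\mathcal S\times\mathcal A\to[0,1]$ (with $S,A_i\ge 1$). For $R\in[0,1)$ let $\mathcal U^R(P^0)$ be the set of all kernels $P$ such that for all $h,s,\boldsymbol a$ there is $P'\in\Delta(\mathcal S)$ with $P_h(\cdot|s,\boldsymbol a)=(1-R)P^0_h(\cdot|s,\boldsymbol a)+RP'$. For a (possibly correlated) Markov policy $\pi:\mathcal S\times[H]\to\Delta(\mathcal A)$ put $V_{i,1}^{\pi,R}(s)=\inf_{P\in\mathcal U^R(P^0)}\mathbb E_{\pi,P}\big[\sum_{t=1}^H r_{i,t}(s_t,\boldsymbol a_t)\mid s_1=s\big]$ and $V_{i,1}^{\star,\pi_{-i},R}(s)=\max_{\pi_i':\mathcal S\times[H]\to\Delta(\mathcal A_i)}V_{i,1}^{\pi_i'\times\pi_{-i},R}(s)$,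 where $\pi_{-i}$ is the marginal of $\pi$ on the other players. The policy $\pi$ is an $\varepsilon$-robust coarse correlated equilibrium (CCE) if $$\mathsf{gap}_{\mathsf{CCE}}(\pi)=\max_{s\in\mathcal S}\max_{1\le i\le m}\big\{V_{i,1}^{\star,\pi_{-i},R}(s)-V_{i,1}^{\pi,R}(s)\big\}\le\varepsilon .$$ Write $M=\min\{H,1/R\}$ (so $M=H$ if $R=0$). **Algorithm (robust Q-FTRL).** Inputs: the number of rounds $K\ge2$, constants $c_\alpha,c_{\mathsf b}>0$, and $\delta\in(0,1)$. The step sizes are $$\alpha_k=\frac{c_\alpha\log K}{k-1+c_\alpha\log K},\qquad \eta_k=\sqrt{\frac{\log K}{\alpha_kM}},\qquad \alpha_k^K=\alpha_k\prod_{j=k+1}^K(1-\alpha_j).$$ Start from $\widehat V_{i,H+1}=0$. For $h=H,\dots,1$ put $Q^0_{i,h}=0$ and $\pi^1_{i,h}(a_i|s)=1/A_i$; for $k=1,\dots,K$, independently for all $i$, $s$, $a_i$ given the past, draw $a_j\sim\pi^k_{j,h}(\cdot|s)$ independently for $j\ne i$, form $\boldsymbol a$ from these and $a_i$, draw $s'\sim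 P^0_h(\cdot|s,\boldsymbol a)$, and set $$q^k_{i,h}(s,a_i)=r_{i,h}(s,\boldsymbol a)+(1-R)\widehat V_{i,h+1}(s')+R\min_{\mathcal S}\widehat V_{i,h+1},$$ $$Q^k_{i,h}=(1-\alpha_k)Q^{k-1}_{i,h}+\alpha_kq^k_{i,h},\qquad \pi^{k+1}_{i,h}(a_i|s)=\frac{\exp(\eta_{k+1}Q^k_{i,h}(s,a_i))}{\sum_{a\in\mathcal A_i}\exp(\eta_{k+1}Q^k_{i,h}(s,a))}.$$ After round $K$ set $$\widehat\pi_h(\boldsymbol a|s)=\sum_{k=1}^K\alpha_k^K\prod_{i=1}^m\pi^k_{i,h}(a_i|s),$$ $$\beta_{i,h}(s)=c_{\mathsf b}\sqrt{\frac{\log^3\frac{KS\sum_jA_j}{\delta}}{KM}}\ \sum_{k=1}^K\alpha_k^K\Big\{\mathsf{Var}_{\pi^k_{i,h}(\cdot|s)}\big(q^k_{i,h}(s,\cdot)\big)+M\Big\},$$ $$\widehat V_{i,h}(s)=\min\Big\{\sum_{k=1}^K\alpha_k^K\,\mathbb E_{a_i\sim\pi^k_{i,h}(\cdot|s)}\,q^k_{i,h}(s,a_i)+\beta_{i,h}(s),\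 H-h+1\Big\}.$$ The output is the correlated policy $\widehat\pi=\{\widehat\pi_h\}_{h=1}^H$; the total number of samples is $KHS\sum_{i=1}^mA_i$. **Theorem.** For all constants $c_\alpha,c_{\mathsf b}>0$ there is a constant $C>0$, depending on $c_\alpha,c_{\mathsf b}$ only, such that for every game as above and all $R\in[0,1)$, $\varepsilon\in(0,H]$, $\delta\in(0,1)$ and integers $K\ge2$ with $$KHS\sum_{i=1}^mA_i\ \ge\ \frac{C\,H^3S\sum_{i=1}^mA_i}{\varepsilon^2}\,\min\Big\{H,\frac1R\Big\}\,\log^3\Big(\frac{KS\sum_{i=1}^mA_i}{\delta}\Big),$$ with probability at least $1-\delta$ the policy $\widehat\pi$ returned by robust Q-FTRL is an $\varepsilon$-robust CCE, i.e. $\mathsf{gap}_{\mathsf{CCE}}(\widehat\pi)\le\varepsilon$. -/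

import Mathlib

open scoped BigOperators

noncomputable section

namespace RobustMG

/-! ### Finite probability -/

/-- The probability mass function of a point of the probability simplex. -/
def simplexPMF {α : Type} [Fintype α] (p : stdSimplex ℝ α) : PMF α :=
  PMF.ofFintype (fun a => ENNReal.ofReal (p a)) (by
    have h0 : ∀ a ∈ Finset.univ, 0 ≤ p a := fun a _ => p.2.1 a
    have h1 : ∑ a, p a = 1 := p.2.2
    rw [← ENNReal.ofReal_sum_of_nonneg h0, h1, ENNReal.ofReal_one])

/-- The joint law of independent draws `x i ∼ p i`. -/
def indepPMF {ι : Type} [Fintype ι] [DecidableEq ι] {α : ι → Type} [∀ i, Fintype (α i)]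
    (p : ∀ i, PMF (α i)) : PMF (∀ i, α i) :=
  PMF.ofFintype (fun x => ∏ i, p i (x i)) (by
    have h := Finset.prod_univ_sum (fun i => (Finset.univ : Finset (α i)))
      (fun i a => p i a)
    rw [Fintype.piFinset_univ] at h
    rw [← h]
    refine Finset.prod_eq_one fun i _ => ?_
    rw [← tsum_fintype (L := .unconditional _)]
    exact (p i).tsum_coe)

/-- The mean of `f` under the weights `p`. -/
def wMean {α : Type} [Fintype α] (p : α → ℝ) (f : α → ℝ) : ℝ := ∑ a, p a * f a

/-- The variance of `f` under the weights `p`. -/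
def wVar {α : Type} [Fintype α] (p : α → ℝ) (f : α → ℝ) : ℝ :=
  wMean p (fun a => f a ^ 2) - wMean p f ^ 2

/-- The distribution on `α` proportional to `exp (η * Q a)`. -/
def softmax {α : Type} [Fintype α] [Nonempty α] (η : ℝ) (Q : α → ℝ) : stdSimplex ℝ α :=
  ⟨fun a => Real.exp (η * Q a) / ∑ b, Real.exp (η * Q b), by
    have hpos : 0 < ∑ b, Real.exp (η * Q b) :=
      Finset.sum_pos (fun b _ => Real.exp_pos _) Finset.univ_nonempty
    refine ⟨fun a => div_nonneg (Real.exp_pos _).le hpos.le, ?_⟩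
    rw [← Finset.sum_div]
    exact div_self hpos.ne'⟩

/-! ### Markov games

States are `Fin S`, the actions of player `i` are `Fin (A i)`, and the steps `1, …, H` are
indexed by `Fin H` (so that `h : Fin H` stands for step `h + 1`). -/

/-- Joint actions. -/
abbrev JointAction {m : ℕ} (A : Fin m → ℕ) : Type := ∀ i, Fin (A i)

/-- Transition kernels of horizon `H`. -/
abbrev TransKernel {m : ℕ} (S H : ℕ) (A : Fin m → ℕ) : Type :=
  Fin H → Fin S → JointAction A → stdSimplex ℝ (Fin S)

/-- Real weights on joint actions, for every step and state. Such a family is a joint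
(possibly correlated) Markov policy if it satisfies `IsJointPolicy`. -/
abbrev JointWeights {m : ℕ} (S H : ℕ) (A : Fin m → ℕ) : Type :=
  Fin H → Fin S → JointAction A → ℝ

/-- The weights form a probability distribution on joint actions at every step and state. -/
def IsJointPolicy {m S H : ℕ} {A : Fin m → ℕ} (π : JointWeights S H A) : Prop :=
  ∀ h s, π h s ∈ stdSimplex ℝ (JointAction A)

/-- Markov policies of player `i`. -/
abbrev PlayerPolicy {m : ℕ} (S H : ℕ) (A : Fin m → ℕ) (i : Fin m) : Type :=
  Fin H → Fin S → stdSimplex ℝ (Fin (A i))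

/-- A finite-horizon general-sum Markov game with `m` players: nominal transition kernel and
rewards in `[0, 1]`. -/
structure Game (m S H : ℕ) (A : Fin m → ℕ) where
  P0 : TransKernel S H A
  r : Fin m → Fin H → Fin S → JointAction A → ℝ
  r_nonneg : ∀ i h s a, 0 ≤ r i h s a
  r_le_one : ∀ i h s a, r i h s a ≤ 1

section Values

variable {m S H : ℕ} {A : Fin m → ℕ}

/-- Probability of the trajectory with states `x 0, …, x H` and joint actions
`a 0, …, a (H - 1)`, given the initial state `x 0`. -/
def trajProb (π : JointWeights S H A) (P : TransKernel S H A)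
    (x : Fin (H + 1) → Fin S) (a : Fin H → JointAction A) : ℝ :=
  ∏ t : Fin H, π t (x t.castSucc) (a t) * P t (x t.castSucc) (a t) (x t.succ)

/-- Expected total reward from the first step on, for the reward functions `r`, the policy `π`
and the kernel `P`, when the initial state is `s`. -/
def value (r : Fin H → Fin S → JointAction A → ℝ) (π : JointWeights S H A)
    (P : TransKernel S H A) (s : Fin S) : ℝ :=
  ∑ x : Fin (H + 1) → Fin S, ∑ a : Fin H → JointAction A,
    if x 0 = s then trajProb π P x a * ∑ t : Fin H, r t (x t.castSucc) (a t) else 0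

/-- The `R`-contamination uncertainty set of a kernel, rectangular in step, state and joint
action. -/
def uncertaintySet (R : ℝ) (P0 : TransKernel S H A) : Set (TransKernel S H A) :=
  {P | ∀ h s a, ∃ P' : stdSimplex ℝ (Fin S), ∀ s',
    P h s a s' = (1 - R) * P0 h s a s' + R * P' s'}

/-- Robust value function of player `i` at the first step. -/
def robustValue (G : Game m S H A) (R : ℝ) (i : Fin m) (π : JointWeights S H A)
    (s : Fin S) : ℝ :=
  ⨅ P : uncertaintySet R G.P0, value (G.r i) π P s

/-- The policy `π'ᵢ × π₋ᵢ`: player `i` plays `π'ᵢ`, independently of the others, who play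
according to the marginal of `π`. -/
def deviate (i : Fin m) (π' : PlayerPolicy S H A i) (π : JointWeights S H A) :
    JointWeights S H A :=
  fun h s a => π' h s (a i) * ∑ b : Fin (A i), π h s (Function.update a i b)

/-- Optimal robust value of player `i` at the first step against `π₋ᵢ`. -/
def bestResponseValue (G : Game m S H A) (R : ℝ) (i : Fin m) (π : JointWeights S H A)
    (s : Fin S) : ℝ :=
  ⨆ π' : PlayerPolicy S H A i, robustValue G R i (deviate i π' π) s

/-- The gap of a joint policy. -/
def gapCCE (G : Game m S H A) (R : ℝ) (π : JointWeights S H A) : ℝ :=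
  ⨆ s : Fin S, ⨆ i : Fin m, (bestResponseValue G R i π s - robustValue G R i π s)

/-- `π` is a joint policy and an `ε`-robust coarse correlated equilibrium. -/
def IsRobustCCE (G : Game m S H A) (R ε : ℝ) (π : JointWeights S H A) : Prop :=
  IsJointPolicy π ∧ gapCCE G R π ≤ ε

end Values

/-! ### Robust Q-FTRL -/

/-- `min {H, 1 / R}`, with `1 / 0 = ∞`. -/
def effHorizon (H : ℕ) (R : ℝ) : ℝ := if R = 0 then (H : ℝ) else min (H : ℝ) (1 / R)

/-- `log (K S ∑ᵢ Aᵢ / δ)`. -/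
def logTerm {m : ℕ} (S : ℕ) (A : Fin m → ℕ) (K : ℕ) (δ : ℝ) : ℝ :=
  Real.log (K * S * (∑ i, (A i : ℝ)) / δ)

/-- The step sizes `α_k = c_α log K / (k - 1 + c_α log K)`, for `k ≥ 1`. -/
def stepα (cα : ℝ) (K k : ℕ) : ℝ :=
  cα * Real.log K / ((k : ℝ) - 1 + cα * Real.log K)

/-- The step sizes `η_k = sqrt (log K / (α_k min {H, 1 / R}))`, for `k ≥ 1`. -/
def stepη (cα : ℝ) (H : ℕ) (R : ℝ) (K k : ℕ) : ℝ :=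
  Real.sqrt (Real.log K / (stepα cα K k * effHorizon H R))

/-- The weights `α_k^K = α_k ∏_{j = k + 1}^K (1 - α_j)`. -/
def mixWeight (α : ℕ → ℝ) (K k : ℕ) : ℝ := α k * ∏ j ∈ Finset.Icc (k + 1) K, (1 - α j)

/-- The samples of one round at one step: for every player `i`, state `s` and own action `aᵢ`,
a joint action and a next state. -/
abbrev Draw {m : ℕ} (S : ℕ) (A : Fin m → ℕ) : Type :=
  ∀ i : Fin m, Fin S → Fin (A i) → JointAction A × Fin S

section Algorithm

variable {m S H : ℕ} {A : Fin m → ℕ}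

/-- Law of the sample of player `i` at `(s, aᵢ)`: the actions of the players `j ≠ i` are
independent with laws `p j s`, player `i` plays `aᵢ`, and the next state is drawn from the
nominal kernel. -/
def sampleLaw (G : Game m S H A) (h : Fin H) (p : ∀ j, Fin S → stdSimplex ℝ (Fin (A j)))
    (i : Fin m) (s : Fin S) (ai : Fin (A i)) : PMF (JointAction A × Fin S) :=
  (indepPMF (Function.update (fun j => simplexPMF (p j s)) i (PMF.pure ai))).bind fun a =>
    (simplexPMF (G.P0 h s a)).map fun s' => (a, s')

/-- Law of the samples of one round: independent over players, states and own actions. -/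
def drawLaw (G : Game m S H A) (h : Fin H) (p : ∀ j, Fin S → stdSimplex ℝ (Fin (A j))) :
    PMF (Draw S A) :=
  indepPMF fun i => indepPMF fun s => indepPMF fun ai => sampleLaw G h p i s ai

/-- The estimate `q_{i,h}^k = r_{i,h}^k + (1 - R) P_{i,h}^k V_i + R min V_i` computed from the
samples `d` of the round; `P_{i,h}^k(· | s, aᵢ)` is the point mass at the sampled state. -/
def qEst (G : Game m S H A) (R : ℝ) (h : Fin H) (V : Fin m → Fin S → ℝ) (d : Draw S A)
    (i : Fin m) (s : Fin S) (ai : Fin (A i)) : ℝ :=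
  G.r i h s (d i s ai).1 + (1 - R) * V i (d i s ai).2 + R * ⨅ s', V i s'

/-- The table `Q_{i,h}^k`, given the samples `D 0, …, D (k - 1)` of the rounds `1, …, k`. -/
def qTable (G : Game m S H A) (R : ℝ) (α : ℕ → ℝ) (h : Fin H) (V : Fin m → Fin S → ℝ) :
    (k : ℕ) → (Fin k → Draw S A) → ∀ i : Fin m, Fin S → Fin (A i) → ℝ
  | 0, _ => fun _ _ _ => 0
  | k + 1, D => fun i s ai =>
      (1 - α (k + 1)) * qTable G R α h V k (Fin.init D) i s ai
        + α (k + 1) * qEst G R h V (D (Fin.last k)) i s ai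

variable [∀ i, NeZero (A i)]

/-- The policies `π_{i,h}^{k+1}`, given the samples of the rounds `1, …, k`. For `k = 0` the
table vanishes and the policies are uniform. -/
def ftrlPolicy (G : Game m S H A) (R : ℝ) (α η : ℕ → ℝ) (h : Fin H)
    (V : Fin m → Fin S → ℝ) (k : ℕ) (D : Fin k → Draw S A) (i : Fin m) (s : Fin S) :
    stdSimplex ℝ (Fin (A i)) :=
  softmax (η (k + 1)) (qTable G R α h V k D i s)

/-- Law of the samples of the first `k` rounds at step `h`, given the value estimates `V` for
the next step. -/
def roundsLaw (G : Game m S H A) (R : ℝ) (α η : ℕ → ℝ) (h : Fin H)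
    (V : Fin m → Fin S → ℝ) : (k : ℕ) → PMF (Fin k → Draw S A)
  | 0 => PMF.pure Fin.elim0
  | k + 1 => (roundsLaw G R α η h V k).bind fun D =>
      (drawLaw G h (ftrlPolicy G R α η h V k D)).map fun d => Fin.snoc D d

/-- The policies used in round `k + 1`, given the samples of all `K` rounds. -/
def usedPolicy (G : Game m S H A) (R : ℝ) (α η : ℕ → ℝ) (h : Fin H)
    (V : Fin m → Fin S → ℝ) {K : ℕ} (D : Fin K → Draw S A) (k : Fin K) (i : Fin m)
    (s : Fin S) : stdSimplex ℝ (Fin (A i)) :=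
  ftrlPolicy G R α η h V k (Fin.take k k.isLt.le D) i s

/-- The correlated policy `∑ₖ α_k^K (π_{1,h}^k × ⋯ × π_{m,h}^k)` of step `h`. -/
def mixedPolicy (G : Game m S H A) (R : ℝ) (α η : ℕ → ℝ) (h : Fin H)
    (V : Fin m → Fin S → ℝ) {K : ℕ} (D : Fin K → Draw S A) (s : Fin S)
    (a : JointAction A) : ℝ :=
  ∑ k : Fin K, mixWeight α K (k + 1) * ∏ i, usedPolicy G R α η h V D k i s (a i)

/-- The bonus `β_{i,h}(s)`. -/
def bonus (G : Game m S H A) (R cb δ : ℝ) (α η : ℕ → ℝ) (h : Fin H)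
    (V : Fin m → Fin S → ℝ) {K : ℕ} (D : Fin K → Draw S A) (i : Fin m) (s : Fin S) : ℝ :=
  cb * Real.sqrt (logTerm S A K δ ^ 3 / (K * effHorizon H R)) *
    ∑ k : Fin K, mixWeight α K (k + 1) *
      (wVar (usedPolicy G R α η h V D k i s) (qEst G R h V (D k) i s) + effHorizon H R)

/-- The optimistic value estimate of step `h`, truncated at the number of remaining steps
(which is `H - h` for the zero-based index `h`). -/
def nextValue (G : Game m S H A) (R cb δ : ℝ) (α η : ℕ → ℝ) (h : Fin H)
    (V : Fin m → Fin S → ℝ) {K : ℕ} (D : Fin K → Draw S A) (i : Fin m) (s : Fin S) : ℝ :=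
  min ((∑ k : Fin K, mixWeight α K (k + 1) *
      wMean (usedPolicy G R α η h V D k i s) (qEst G R h V (D k) i s))
    + bonus G R cb δ α η h V D i s) ((H : ℝ) - (h : ℕ))

/-- Law of the value estimates and the policy after the last `n` steps have been processed,
from the final step backwards. -/
def backwardLaw (G : Game m S H A) (R cb δ : ℝ) (K : ℕ) (α η : ℕ → ℝ) :
    (n : ℕ) → n ≤ H → PMF ((Fin m → Fin S → ℝ) × JointWeights S H A)
  | 0, _ => PMF.pure (fun _ _ => 0, fun _ _ _ => 0)
  | n + 1, hn =>
      (backwardLaw G R cb δ K α η n (Nat.le_of_succ_le hn)).bind fun Vπ =>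
        let h : Fin H := ⟨H - (n + 1), Nat.sub_lt (Nat.lt_of_lt_of_le n.succ_pos hn) n.succ_pos⟩
        (roundsLaw G R α η h Vπ.1 K).map fun D =>
          (nextValue G R cb δ α η h Vπ.1 D,
            Function.update Vπ.2 h (mixedPolicy G R α η h Vπ.1 D))

/-- Law of the correlated policy returned by robust Q-FTRL with `K` rounds per step, step sizes
`α`, `η`, bonus constant `cb` and confidence parameter `δ`. -/
def robustQFTRL (G : Game m S H A) (R cb δ : ℝ) (K : ℕ) (α η : ℕ → ℝ) :
    PMF (JointWeights S H A) :=
  (backwardLaw G R cb δ K α η H le_rfl).map Prod.snd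

end Algorithm

end RobustMG

end

/-!
The worst kernel in the uncertainty set moves mass `R` to a minimizer of the next value function,
so robust values obey a Bellman recursion and oscillate by at most `M = min {H, 1 / R}`. Given the
value estimates of the later steps, one step of the algorithm is a regret problem for each player:
the variance-dependent regret of the exponential weights is covered by the bonus, and exponential
supermartingales with weights `α_k^K` control the sampling error. Hence the new estimate exceeds
the value of the mixed policy, and falls short of the value of a unilateral deviation, by at most
`l` times a variance plus `O(l M)`, with `l ≈ sqrt (L ^ 3 / (K M))` and `L` the logarithmic factor.

Bounding each variance by `M ^ 2` would lose a factor `M`. The backward induction therefore carries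
the potential `3 l (f - min f) ^ 2` of the true robust value `f`: by the law of total variance, the
drop of this potential from the next state to the current one pays for the variance of the step up
to `O(l M)`. The accumulated error is `O(H l M)`, which is at most `ε` for `K` as large as assumed.
-/
noncomputable section

namespace RobustMG

/-! ### Weighted means and variances -/

section Weights

variable {α : Type} [Fintype α] {p f g : α → ℝ}

theorem coe_mem_stdSimplex (p : stdSimplex ℝ α) : (⇑p : α → ℝ) ∈ stdSimplex ℝ α := p.2

theorem nonempty_of_mem_stdSimplex (hp : p ∈ stdSimplex ℝ α) : Nonempty α := by
  rw [← Finset.univ_nonempty_iff]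
  exact Finset.nonempty_of_sum_ne_zero (hp.2.trans_ne one_ne_zero)

theorem wMean_add (p f g : α → ℝ) :
    wMean p (fun a => f a + g a) = wMean p f + wMean p g :=
  dotProduct_add p f g

theorem wMean_sub (p f g : α → ℝ) :
    wMean p (fun a => f a - g a) = wMean p f - wMean p g :=
  dotProduct_sub p f g

theorem wMean_mul_left (p f : α → ℝ) (c : ℝ) :
    wMean p (fun a => c * f a) = c * wMean p f :=
  dotProduct_smul c p f

theorem wMean_const (hp : p ∈ stdSimplex ℝ α) (c : ℝ) : wMean p (fun _ => c) = c := by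
  simp only [wMean, ← Finset.sum_mul, hp.2, one_mul]

theorem wMean_mono (hp : p ∈ stdSimplex ℝ α) (h : ∀ a, f a ≤ g a) : wMean p f ≤ wMean p g :=
  Finset.sum_le_sum fun a _ => mul_le_mul_of_nonneg_left (h a) (hp.1 a)

theorem wMean_le (hp : p ∈ stdSimplex ℝ α) {c : ℝ} (h : ∀ a, f a ≤ c) : wMean p f ≤ c := by
  simpa only [wMean_const hp] using wMean_mono (g := fun _ => c) hp h

theorem le_wMean (hp : p ∈ stdSimplex ℝ α) {c : ℝ} (h : ∀ a, c ≤ f a) : c ≤ wMean p f := by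
  simpa only [wMean_const hp] using wMean_mono (f := fun _ => c) hp h

theorem abs_sub_wMean_le (hp : p ∈ stdSimplex ℝ α) {B : ℝ} (h : ∀ a b, f a - f b ≤ B) (a : α) :
    |f a - wMean p f| ≤ B := by
  have hle : wMean p f ≤ f a + B := wMean_le hp fun b => by linarith [h b a]
  have hge : f a - B ≤ wMean p f := le_wMean hp fun b => by linarith [h a b]
  exact abs_le.2 ⟨by linarith, by linarith⟩

theorem wMean_sub_sq (hp : p ∈ stdSimplex ℝ α) (f : α → ℝ) (c : ℝ) :
    wMean p (fun a => (f a - c) ^ 2) = wVar p f + (wMean p f - c) ^ 2 := by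
  have expand : (fun a => (f a - c) ^ 2) = fun a => (f a ^ 2 - 2 * c * f a) + c ^ 2 := by
    funext a; ring
  rw [expand, wMean_add, wMean_sub, wMean_mul_left, wMean_const hp, wVar]
  ring

theorem wVar_eq_wMean_sub_sq (hp : p ∈ stdSimplex ℝ α) (f : α → ℝ) :
    wVar p f = wMean p (fun a => (f a - wMean p f) ^ 2) := by
  rw [wMean_sub_sq hp]; ring

theorem wVar_nonneg (hp : p ∈ stdSimplex ℝ α) (f : α → ℝ) : 0 ≤ wVar p f := by
  rw [wVar_eq_wMean_sub_sq hp]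
  exact le_wMean hp fun a => sq_nonneg _

theorem sq_wMean_le (hp : p ∈ stdSimplex ℝ α) (f : α → ℝ) :
    wMean p f ^ 2 ≤ wMean p (fun a => f a ^ 2) :=
  sub_nonneg.1 (wVar_nonneg hp f)

theorem wVar_le_wMean_sub_sq (hp : p ∈ stdSimplex ℝ α) (f : α → ℝ) (c : ℝ) :
    wVar p f ≤ wMean p (fun a => (f a - c) ^ 2) := by
  rw [wMean_sub_sq hp]
  exact le_add_of_nonneg_right (sq_nonneg _)

theorem wVar_add_const (hp : p ∈ stdSimplex ℝ α) (f : α → ℝ) (c : ℝ) :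
    wVar p (fun a => f a + c) = wVar p f := by
  rw [wVar_eq_wMean_sub_sq hp, wVar_eq_wMean_sub_sq hp, wMean_add, wMean_const hp]
  simp only [add_sub_add_right_eq_sub]

theorem wVar_mul_left (p f : α → ℝ) (c : ℝ) : wVar p (fun a => c * f a) = c ^ 2 * wVar p f := by
  simp only [wVar, mul_pow, wMean_mul_left]
  ring

theorem wVar_add_le (hp : p ∈ stdSimplex ℝ α) (f g : α → ℝ) :
    wVar p (fun a => f a + g a) ≤ 2 * wVar p f + 2 * wVar p g := by
  rw [wVar_eq_wMean_sub_sq hp, wVar_eq_wMean_sub_sq hp f, wVar_eq_wMean_sub_sq hp g,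
    ← wMean_mul_left, ← wMean_mul_left, ← wMean_add, wMean_add]
  refine wMean_mono hp fun a => ?_
  nlinarith [sq_nonneg ((f a - wMean p f) - (g a - wMean p g))]

theorem wVar_le_sub_wMean_mul_wMean_sub (hp : p ∈ stdSimplex ℝ α) {lo hi : ℝ}
    (hlo : ∀ a, lo ≤ f a) (hhi : ∀ a, f a ≤ hi) :
    wVar p f ≤ (hi - wMean p f) * (wMean p f - lo) := by
  have hnonneg : 0 ≤ wMean p (fun a => (hi - f a) * (f a - lo)) :=
    le_wMean hp fun a => mul_nonneg (sub_nonneg.2 (hhi a)) (sub_nonneg.2 (hlo a))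
  have expand : (fun a => (hi - f a) * (f a - lo)) =
      fun a => ((hi + lo) * f a - f a ^ 2) - hi * lo := by
    funext a; ring
  rw [expand, wMean_sub, wMean_sub, wMean_mul_left, wMean_const hp] at hnonneg
  rw [wVar]
  linarith

theorem wVar_le_sq (hp : p ∈ stdSimplex ℝ α) {lo hi : ℝ} (hlo : ∀ a, lo ≤ f a)
    (hhi : ∀ a, f a ≤ hi) : wVar p f ≤ (hi - lo) ^ 2 := by
  have hmean_lo := le_wMean hp hlo
  have hmean_hi := wMean_le hp hhi
  calc wVar p f ≤ (hi - wMean p f) * (wMean p f - lo) :=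
        wVar_le_sub_wMean_mul_wMean_sub hp hlo hhi
    _ ≤ (hi - lo) * (hi - lo) := by gcongr; linarith
    _ = (hi - lo) ^ 2 := (sq _).symm

theorem wMean_add_mul_wVar_le (hp : p ∈ stdSimplex ℝ α) {lo hi c : ℝ} (hlo : ∀ a, lo ≤ f a)
    (hhi : ∀ a, f a ≤ hi) (hc : 0 ≤ c) (hc1 : c * (hi - lo) ≤ 1) :
    wMean p f + c * wVar p f ≤ hi := by
  have hmean_hi := wMean_le hp hhi
  have hslope : c * (wMean p f - lo) ≤ 1 := le_trans (by gcongr) hc1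
  calc wMean p f + c * wVar p f
      ≤ wMean p f + c * ((hi - wMean p f) * (wMean p f - lo)) := by
        gcongr; exact wVar_le_sub_wMean_mul_wMean_sub hp hlo hhi
    _ = wMean p f + (hi - wMean p f) * (c * (wMean p f - lo)) := by ring
    _ ≤ wMean p f + (hi - wMean p f) * 1 := by gcongr
    _ = hi := by ring

theorem wVar_sub_wVar (p f g : α → ℝ) :
    wVar p g - wVar p f = wMean p (fun a =>
      (g a - f a) * ((g a - wMean p g) + (f a - wMean p f))) := by
  have expand : (fun a => (g a - f a) * ((g a - wMean p g) + (f a - wMean p f))) =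
      fun a => (g a ^ 2 - f a ^ 2) - (wMean p g + wMean p f) * (g a - f a) := by
    funext a; ring
  rw [expand, wMean_sub, wMean_sub, wMean_mul_left, wMean_sub, wVar, wVar]
  ring

theorem abs_wVar_sub_le (hp : p ∈ stdSimplex ℝ α) {B : ℝ} (hfg : ∀ a, f a ≤ g a)
    (hf : ∀ a b, f a - f b ≤ B) (hg : ∀ a b, g a - g b ≤ B) :
    |wVar p g - wVar p f| ≤ 2 * B * (wMean p g - wMean p f) := by
  have hdev : ∀ a, |(g a - wMean p g) + (f a - wMean p f)| ≤ 2 * B := fun a => by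
    linarith [abs_add_le (g a - wMean p g) (f a - wMean p f), abs_sub_wMean_le hp hf a,
      abs_sub_wMean_le hp hg a]
  rw [wVar_sub_wVar, ← wMean_sub, ← wMean_mul_left, abs_le, neg_le_iff_add_nonneg', ← wMean_add]
  refine ⟨le_wMean hp fun a => ?_, wMean_mono hp fun a => ?_⟩
  · nlinarith [hfg a, (abs_le.1 (hdev a)).1]
  · nlinarith [hfg a, (abs_le.1 (hdev a)).2]

theorem wMean_add_mul_wVar_mono (hp : p ∈ stdSimplex ℝ α) {B : ℝ} (hfg : ∀ a, f a ≤ g a)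
    (hf : ∀ a b, f a - f b ≤ B) (hg : ∀ a b, g a - g b ≤ B) {l : ℝ} (hl : |l| * (2 * B) ≤ 1) :
    wMean p f + l * wVar p f ≤ wMean p g + l * wVar p g := by
  have hmean : 0 ≤ wMean p g - wMean p f := sub_nonneg.2 (wMean_mono hp hfg)
  have hvar : |l * (wVar p g - wVar p f)| ≤ wMean p g - wMean p f :=
    calc |l * (wVar p g - wVar p f)| ≤ |l| * (2 * B * (wMean p g - wMean p f)) := by
          rw [abs_mul]
          gcongr
          exact abs_wVar_sub_le hp hfg hf hg
      _ = |l| * (2 * B) * (wMean p g - wMean p f) := by ring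
      _ ≤ wMean p g - wMean p f := mul_le_of_le_one_left hmean hl
  linarith [(abs_le.1 hvar).1]

theorem wVar_sq_le (hp : p ∈ stdSimplex ℝ α) {B : ℝ} (h0 : ∀ a, 0 ≤ f a) (hB : ∀ a, f a ≤ B) :
    wVar p (fun a => f a ^ 2) ≤ 4 * B ^ 2 * wVar p f := by
  have hmean_nonneg := le_wMean hp h0
  have hmean_le := wMean_le hp hB
  refine (wVar_le_wMean_sub_sq hp _ (wMean p f ^ 2)).trans ?_
  rw [wVar_eq_wMean_sub_sq hp f, ← wMean_mul_left]
  refine wMean_mono hp fun a => ?_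
  have hsum : (f a + wMean p f) ^ 2 ≤ (2 * B) ^ 2 :=
    pow_le_pow_left₀ (by linarith [h0 a]) (by linarith [hB a]) 2
  calc (f a ^ 2 - wMean p f ^ 2) ^ 2 = (f a + wMean p f) ^ 2 * (f a - wMean p f) ^ 2 := by ring
    _ ≤ (2 * B) ^ 2 * (f a - wMean p f) ^ 2 := by gcongr
    _ = 4 * B ^ 2 * (f a - wMean p f) ^ 2 := by ring

section Mixture

variable {ι : Type} [Fintype ι] {w : ι → ℝ} {q : ι → α → ℝ}

theorem wMean_mixture (w : ι → ℝ) (q : ι → α → ℝ) (f : α → ℝ) :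
    wMean (fun a => ∑ k, w k * q k a) f = wMean w (fun k => wMean (q k) f) := by
  simp only [wMean, Finset.sum_mul, Finset.mul_sum, mul_assoc]
  exact Finset.sum_comm

theorem mixture_mem_stdSimplex (hw : w ∈ stdSimplex ℝ ι) (hq : ∀ k, q k ∈ stdSimplex ℝ α) :
    (fun a => ∑ k, w k * q k a) ∈ stdSimplex ℝ α := by
  convert (convex_stdSimplex ℝ α).sum_mem (fun k _ => hw.1 k) hw.2 fun k _ => hq k
  simp only [Finset.sum_apply, Pi.smul_apply, smul_eq_mul]

theorem wMean_wVar_le_wVar_mixture (hw : w ∈ stdSimplex ℝ ι) (q : ι → α → ℝ) (f : α → ℝ) :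
    wMean w (fun k => wVar (q k) f) ≤ wVar (fun a => ∑ k, w k * q k a) f := by
  have hsq := sq_wMean_le hw (fun k => wMean (q k) f)
  simp only [wVar, wMean_mixture, wMean_sub] at hsq ⊢
  linarith

end Mixture

theorem exp_le_one_add_add_sq {x : ℝ} (hx : x ≤ 1) : Real.exp x ≤ 1 + x + x ^ 2 := by
  rcases le_or_gt (-1) x with h | h
  · linarith [(abs_le.1 (Real.abs_exp_sub_one_sub_id_le (abs_le.2 ⟨h, hx⟩))).2]
  · nlinarith [Real.exp_le_one_iff.2 (show x ≤ 0 by linarith)]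

theorem wMean_exp_le (hp : p ∈ stdSimplex ℝ α) (hf : ∀ a, f a ≤ 1) :
    wMean p (fun a => Real.exp (f a)) ≤
      Real.exp (wMean p f + wMean p (fun a => f a ^ 2)) := by
  calc wMean p (fun a => Real.exp (f a)) ≤ wMean p (fun a => 1 + f a + f a ^ 2) :=
        wMean_mono hp fun a => exp_le_one_add_add_sq (hf a)
    _ = (wMean p f + wMean p (fun a => f a ^ 2)) + 1 := by
        rw [wMean_add, wMean_add, wMean_const hp]; ring
    _ ≤ Real.exp (wMean p f + wMean p (fun a => f a ^ 2)) := Real.add_one_le_exp _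

theorem wMean_exp_pos (hp : p ∈ stdSimplex ℝ α) (f : α → ℝ) :
    0 < wMean p (fun a => Real.exp (f a)) := by
  obtain ⟨a, -, ha⟩ : ∃ a ∈ Finset.univ, 0 < p a :=
    Finset.exists_lt_of_sum_lt (by simp [hp.2])
  exact Finset.sum_pos' (fun b _ => mul_nonneg (hp.1 b) (Real.exp_pos _).le)
    ⟨a, Finset.mem_univ a, mul_pos ha (Real.exp_pos _)⟩

theorem log_wMean_exp_le (hp : p ∈ stdSimplex ℝ α) {t lo hi : ℝ} (ht : 0 ≤ t)
    (hlo : ∀ a, lo ≤ f a) (hhi : ∀ a, f a ≤ hi) (hsmall : t * (hi - lo) ≤ 1) :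
    Real.log (wMean p (fun a => Real.exp (t * f a))) ≤ t * wMean p f + t ^ 2 * wVar p f := by
  have hcentered : wMean p (fun a => Real.exp (t * (f a - wMean p f))) ≤
      Real.exp (t ^ 2 * wVar p f) := by
    refine (wMean_exp_le hp fun a => le_trans ?_ hsmall).trans_eq ?_
    · have := le_wMean hp hlo
      gcongr
      exact hhi a
    · simp only [mul_pow, wMean_mul_left, wMean_sub, wMean_const hp, sub_self, mul_zero, zero_add,
        wVar_eq_wMean_sub_sq hp f]
  have hfactor : (fun a => Real.exp (t * f a)) =
      fun a => Real.exp (t * wMean p f) * Real.exp (t * (f a - wMean p f)) := by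
    funext a
    rw [← Real.exp_add]
    ring_nf
  rw [Real.log_le_iff_le_exp (wMean_exp_pos hp _), hfactor, wMean_mul_left, Real.exp_add]
  gcongr

end Weights

/-! ### Trajectories and the Bellman equation -/

section Trajectories

variable {m S H : ℕ} {A : Fin m → ℕ}

theorem IsJointPolicy.tail {π : JointWeights S (H + 1) A} (hπ : IsJointPolicy π) :
    IsJointPolicy fun t : Fin H => π t.succ :=
  fun t s => hπ t.succ s

/-- Expectation of a functional of the trajectory started at `s`; `value` is the special case of
the total reward, but the Bellman equation needs functionals that remember the first step. -/
def trajMean (π : JointWeights S H A) (P : TransKernel S H A) (s : Fin S)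
    (F : (Fin (H + 1) → Fin S) → (Fin H → JointAction A) → ℝ) : ℝ :=
  ∑ x : Fin (H + 1) → Fin S, ∑ a : Fin H → JointAction A,
    if x 0 = s then trajProb π P x a * F x a else 0

theorem value_eq_trajMean (r : Fin H → Fin S → JointAction A → ℝ) (π : JointWeights S H A)
    (P : TransKernel S H A) (s : Fin S) :
    value r π P s = trajMean π P s fun x a => ∑ t : Fin H, r t (x t.castSucc) (a t) := rfl

theorem trajProb_cons (π : JointWeights S (H + 1) A) (P : TransKernel S (H + 1) A) (s : Fin S)
    (b : JointAction A) (x : Fin (H + 1) → Fin S) (a : Fin H → JointAction A) :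
    trajProb π P (Fin.cons s x) (Fin.cons b a) =
      π 0 s b * P 0 s b (x 0) * trajProb (fun t => π t.succ) (fun t => P t.succ) x a := by
  simp [trajProb, Fin.prod_univ_succ]

theorem trajMean_eq_sum_cons (π : JointWeights S (H + 1) A) (P : TransKernel S (H + 1) A)
    (s : Fin S) (F : (Fin (H + 2) → Fin S) → (Fin (H + 1) → JointAction A) → ℝ) :
    trajMean π P s F = ∑ x : Fin (H + 1) → Fin S, ∑ b, ∑ a : Fin H → JointAction A,
      trajProb π P (Fin.cons s x) (Fin.cons b a) * F (Fin.cons s x) (Fin.cons b a) := by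
  unfold trajMean
  rw [← (Fin.consEquiv fun _ : Fin (H + 2) => Fin S).sum_comp, Fintype.sum_prod_type_right]
  refine Finset.sum_congr rfl fun x _ => ?_
  rw [Finset.sum_eq_single s]
  · rw [← (Fin.consEquiv fun _ : Fin (H + 1) => JointAction A).sum_comp, Fintype.sum_prod_type]
    simp [Fin.consEquiv]
  · intro x₀ _ hx₀
    simp [Fin.consEquiv, hx₀]
  · simp

theorem trajMean_succ (π : JointWeights S (H + 1) A) (P : TransKernel S (H + 1) A) (s : Fin S)
    (F : (Fin (H + 2) → Fin S) → (Fin (H + 1) → JointAction A) → ℝ) :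
    trajMean π P s F = wMean (π 0 s) fun b => wMean (P 0 s b) fun s' =>
      trajMean (fun t => π t.succ) (fun t => P t.succ) s'
        (fun x a => F (Fin.cons s x) (Fin.cons b a)) := by
  have sum_start : ∀ b, (wMean (P 0 s b) fun s' =>
      trajMean (fun t => π t.succ) (fun t => P t.succ) s'
        (fun x a => F (Fin.cons s x) (Fin.cons b a))) =
      ∑ x : Fin (H + 1) → Fin S, ∑ a : Fin H → JointAction A, P 0 s b (x 0) *
        (trajProb (fun t => π t.succ) (fun t => P t.succ) x a *
        F (Fin.cons s x) (Fin.cons b a)) := by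
    intro b
    simp only [wMean, trajMean, Finset.mul_sum, mul_ite, mul_zero]
    rw [Finset.sum_comm]
    refine Finset.sum_congr rfl fun x _ => ?_
    rw [Finset.sum_comm]
    simp only [Finset.sum_ite_eq, Finset.mem_univ, if_true]
  simp only [sum_start]
  rw [trajMean_eq_sum_cons, Finset.sum_comm]
  simp only [wMean, Finset.mul_sum, trajProb_cons, mul_assoc]

theorem trajMean_const {π : JointWeights S H A} (hπ : IsJointPolicy π)
    (P : TransKernel S H A) (s : Fin S) (c : ℝ) : trajMean π P s (fun _ _ => c) = c := by
  induction H generalizing s with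
  | zero =>
    unfold trajMean trajProb
    rw [← (Equiv.funUnique (Fin 1) (Fin S)).symm.sum_comp]
    simp
  | succ H ih =>
    simp only [trajMean_succ, ih hπ.tail, wMean_const (coe_mem_stdSimplex _), wMean_const (hπ 0 s)]

theorem trajMean_add (π : JointWeights S H A) (P : TransKernel S H A) (s : Fin S)
    (F F' : (Fin (H + 1) → Fin S) → (Fin H → JointAction A) → ℝ) :
    trajMean π P s (fun x a => F x a + F' x a) = trajMean π P s F + trajMean π P s F' := by
  simp only [trajMean, ← Finset.sum_add_distrib, mul_add, ← ite_add_zero]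

theorem value_zero (r : Fin 0 → Fin S → JointAction A → ℝ) (π : JointWeights S 0 A)
    (P : TransKernel S 0 A) (s : Fin S) : value r π P s = 0 := by
  simp [value]

theorem value_succ (r : Fin (H + 1) → Fin S → JointAction A → ℝ)
    {π : JointWeights S (H + 1) A} (hπ : IsJointPolicy π) (P : TransKernel S (H + 1) A)
    (s : Fin S) :
    value r π P s = wMean (π 0 s) fun b => r 0 s b + wMean (P 0 s b)
      (value (fun t => r t.succ) (fun t => π t.succ) (fun t => P t.succ)) := by
  rw [value_eq_trajMean, trajMean_succ]
  simp only [Fin.sum_univ_succ, trajMean_add]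
  simp only [Fin.castSucc_zero, Fin.cons_zero, trajMean_const hπ.tail, wMean_add,
    wMean_const (coe_mem_stdSimplex _)]
  rfl

end Trajectories

/-! ### Robust dynamic programming -/

section OneStepOperator

variable {X Y : Type}

/-- Reward plus continuation value under the worst `R`-contamination: with probability `R` the
next state is a minimizer of the value function. -/
def robustTarget (ρ : X → ℝ) (R : ℝ) (V : Y → ℝ) : X × Y → ℝ :=
  fun z => ρ z.1 + (1 - R) * V z.2 + R * ⨅ y, V y

variable [Fintype Y]

/-- The joint law of `(x, y)` when `x` has weights `μ` and `y` has law `P x`; the counterpart for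
weights of `MeasureTheory.Measure.compProd`. -/
def wCompProd (μ : X → ℝ) (P : X → stdSimplex ℝ Y) : X × Y → ℝ :=
  fun z => μ z.1 * P z.1 z.2

theorem wMean_robustTarget (P : stdSimplex ℝ Y) (ρ : X → ℝ) (R : ℝ) (V : Y → ℝ) (x : X) :
    wMean P (fun y => robustTarget ρ R V (x, y)) =
      ρ x + ((1 - R) * wMean P V + R * ⨅ y, V y) := by
  have hP := coe_mem_stdSimplex P
  simp only [robustTarget, wMean_add, wMean_mul_left, wMean_const hP]
  ring

theorem wMean_contaminated {P P₀ P' : Y → ℝ} {R : ℝ}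
    (hP : ∀ y, P y = (1 - R) * P₀ y + R * P' y) (V : Y → ℝ) :
    wMean P V = (1 - R) * wMean P₀ V + R * wMean P' V := by
  simp only [wMean, hP, add_mul, Finset.sum_add_distrib, Finset.mul_sum, mul_assoc]

variable [Fintype X]

theorem wCompProd_mem_stdSimplex {μ : X → ℝ} (hμ : μ ∈ stdSimplex ℝ X) (P : X → stdSimplex ℝ Y) :
    wCompProd μ P ∈ stdSimplex ℝ (X × Y) := by
  refine ⟨fun z => mul_nonneg (hμ.1 _) ((P _).2.1 _), ?_⟩
  simp only [wCompProd, Fintype.sum_prod_type, ← Finset.mul_sum,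
    stdSimplex.sum_eq_one, mul_one, hμ.2]

theorem wMean_wCompProd (μ : X → ℝ) (P : X → stdSimplex ℝ Y) (f : X × Y → ℝ) :
    wMean (wCompProd μ P) f = wMean μ fun x => wMean (P x) fun y => f (x, y) := by
  simp only [wMean, wCompProd, Fintype.sum_prod_type, Finset.mul_sum, mul_assoc]

end OneStepOperator

section DynamicProgramming

variable {m S H : ℕ} {A : Fin m → ℕ} {R : ℝ}

/-- The step after which `n` further steps remain. -/
abbrev stepIdx (n : ℕ) (hn : n + 1 ≤ H) : Fin H :=
  ⟨H - (n + 1), Nat.sub_lt (Nat.lt_of_lt_of_le n.succ_pos hn) n.succ_pos⟩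

/-- Robust value of `π` over the last `n` steps, by backward recursion. -/
def robustDP (R : ℝ) (P₀ : TransKernel S H A) (r : Fin H → Fin S → JointAction A → ℝ)
    (π : JointWeights S H A) : (n : ℕ) → n ≤ H → Fin S → ℝ
  | 0, _ => fun _ => 0
  | n + 1, hn => fun s =>
      wMean (wCompProd (π (stepIdx n hn) s) (P₀ (stepIdx n hn) s))
        (robustTarget (r (stepIdx n hn) s) R (robustDP R P₀ r π n (Nat.le_of_succ_le hn)))

theorem robustDP_congr (R : ℝ) (P₀ : TransKernel S H A)
    (r : Fin H → Fin S → JointAction A → ℝ) {π π' : JointWeights S H A} (n : ℕ) (hn : n ≤ H)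
    (h : ∀ t : Fin H, H - n ≤ t → π t = π' t) :
    robustDP R P₀ r π n hn = robustDP R P₀ r π' n hn := by
  induction n with
  | zero => rfl
  | succ n ih =>
    funext s
    simp only [robustDP]
    rw [ih (Nat.le_of_succ_le hn) fun t ht => h t (by omega), h (stepIdx n hn) le_rfl]

theorem robustDP_tail (R : ℝ) (P₀ : TransKernel S (H + 1) A)
    (r : Fin (H + 1) → Fin S → JointAction A → ℝ) (π : JointWeights S (H + 1) A) (n : ℕ)
    (hn : n ≤ H) :
    robustDP R P₀ r π n (Nat.le_succ_of_le hn) =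
      robustDP R (fun t => P₀ t.succ) (fun t => r t.succ) (fun t => π t.succ) n hn := by
  induction n with
  | zero => rfl
  | succ n ih =>
    funext s
    have hidx : (stepIdx n (Nat.le_succ_of_le hn) : Fin (H + 1)) = (stepIdx n hn).succ :=
      Fin.ext (by simp only [Fin.val_succ]; omega)
    simp only [robustDP]
    rw [ih (Nat.le_of_succ_le hn), hidx]

theorem robustDP_succ_horizon (R : ℝ) (P₀ : TransKernel S (H + 1) A)
    (r : Fin (H + 1) → Fin S → JointAction A → ℝ) (π : JointWeights S (H + 1) A) (s : Fin S) :
    robustDP R P₀ r π (H + 1) le_rfl s = wMean (π 0 s) fun b => r 0 s b +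
      ((1 - R) * wMean (P₀ 0 s b)
          (robustDP R (fun t => P₀ t.succ) (fun t => r t.succ) (fun t => π t.succ) H le_rfl)
        + R * ⨅ s', robustDP R (fun t => P₀ t.succ) (fun t => r t.succ) (fun t => π t.succ)
            H le_rfl s') := by
  have hidx : (stepIdx H le_rfl : Fin (H + 1)) = 0 := Fin.ext (by simp)
  rw [← robustDP_tail]
  simp only [robustDP]
  rw [hidx, wMean_wCompProd]
  simp only [wMean_robustTarget]

theorem robustDP_le_value (hR : 0 ≤ R) {P₀ : TransKernel S H A}
    (r : Fin H → Fin S → JointAction A → ℝ) {π : JointWeights S H A} (hπ : IsJointPolicy π)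
    {P : TransKernel S H A} (hP : P ∈ uncertaintySet R P₀) (s : Fin S) :
    robustDP R P₀ r π H le_rfl s ≤ value r π P s := by
  induction H generalizing s with
  | zero => exact (value_zero r π P s).ge
  | succ H ih =>
    rw [value_succ r hπ, robustDP_succ_horizon]
    refine wMean_mono (hπ 0 s) fun b => add_le_add_right ?_ (r 0 s b)
    have hV := ih (fun t => r t.succ) hπ.tail (P₀ := fun t => P₀ t.succ)
      (P := fun t => P t.succ) fun t s a => hP t.succ s a
    set V := robustDP R (fun t => P₀ t.succ) (fun t => r t.succ) (fun t => π t.succ) H le_rfl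
    obtain ⟨P', hP'⟩ := hP 0 s b
    have hmin : ⨅ s', V s' ≤ wMean P' V :=
      le_wMean P'.2 fun s' => ciInf_le (Set.finite_range V).bddBelow s'
    calc (1 - R) * wMean (P₀ 0 s b) V + R * ⨅ s', V s'
        ≤ (1 - R) * wMean (P₀ 0 s b) V + R * wMean P' V := by gcongr
      _ = wMean (P 0 s b) V := (wMean_contaminated hP' V).symm
      _ ≤ wMean (P 0 s b) _ := wMean_mono (coe_mem_stdSimplex _) hV

theorem exists_value_eq_robustDP [NeZero S] (hR : 0 ≤ R) (hR1 : R ≤ 1)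
    (P₀ : TransKernel S H A) (r : Fin H → Fin S → JointAction A → ℝ) {π : JointWeights S H A}
    (hπ : IsJointPolicy π) :
    ∃ P ∈ uncertaintySet R P₀, ∀ s, value r π P s = robustDP R P₀ r π H le_rfl s := by
  induction H with
  | zero => exact ⟨P₀, fun h => h.elim0, value_zero r π P₀⟩
  | succ H ih =>
    obtain ⟨P, hP, hval⟩ := ih (fun t => P₀ t.succ) (fun t => r t.succ) hπ.tail
    set V := robustDP R (fun t => P₀ t.succ) (fun t => r t.succ) (fun t => π t.succ) H le_rfl
      with hV
    obtain ⟨s₀, hs₀⟩ := exists_eq_ciInf_of_finite (f := V)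
    let worst : stdSimplex ℝ (Fin S) := stdSimplex.vertex s₀
    let Q : Fin S → JointAction A → stdSimplex ℝ (Fin S) := fun s b =>
      ⟨fun s' => (1 - R) * P₀ 0 s b s' + R * worst s',
        convex_stdSimplex ℝ _ (P₀ 0 s b).2 worst.2 (by linarith) hR (by ring)⟩
    have hworst : wMean worst V = ⨅ s', V s' := by simp [wMean, worst, Pi.single_apply, hs₀]
    refine ⟨Fin.cons Q P, Fin.cases (fun s b => ⟨worst, fun s' => rfl⟩) hP, fun s => ?_⟩
    rw [value_succ r hπ, robustDP_succ_horizon]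
    congr 1
    funext b
    simp only [Fin.cons_zero, Fin.cons_succ, funext hval, ← hV]
    rw [wMean_contaminated (P := Q s b) (fun s' => rfl), hworst]

theorem mem_uncertaintySet_self (R : ℝ) (P₀ : TransKernel S H A) : P₀ ∈ uncertaintySet R P₀ :=
  fun h s a => ⟨P₀ h s a, fun s' => by ring⟩

theorem robustValue_eq_robustDP [NeZero S] (G : Game m S H A) (hR : 0 ≤ R) (hR1 : R ≤ 1)
    (i : Fin m) {π : JointWeights S H A} (hπ : IsJointPolicy π) (s : Fin S) :
    robustValue G R i π s = robustDP R G.P0 (G.r i) π H le_rfl s := by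
  have hle : ∀ P : uncertaintySet R G.P0,
      robustDP R G.P0 (G.r i) π H le_rfl s ≤ value (G.r i) π P s :=
    fun P => robustDP_le_value hR (G.r i) hπ P.2 s
  have : Nonempty (uncertaintySet R G.P0) := ⟨⟨_, mem_uncertaintySet_self R G.P0⟩⟩
  refine le_antisymm ?_ (le_ciInf hle)
  obtain ⟨P, hP, hval⟩ := exists_value_eq_robustDP hR hR1 G.P0 (G.r i) hπ
  rw [← hval]
  exact ciInf_le (f := fun P : uncertaintySet R G.P0 => value (G.r i) π P s)
    ⟨_, Set.forall_mem_range.2 hle⟩ ⟨P, hP⟩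

end DynamicProgramming

/-! ### Unilateral deviations -/

section Deviations

variable {ι : Type} [DecidableEq ι] {α : ι → Type}

/-- The involution of `(∀ j, α j) × α i` that exchanges the `i`-th coordinate of a point with a
spare one; summing along it computes marginals. -/
def swapCoord (i : ι) : Equiv.Perm ((∀ j, α j) × α i) where
  toFun z := (Function.update z.1 i z.2, z.1 i)
  invFun z := (Function.update z.1 i z.2, z.1 i)
  left_inv z := by simp
  right_inv z := by simp

/-- The weights of a joint action when player `i` draws from `σ`, independently of the others, who
follow their marginal of `μ`; `deviate` does this at every step and state. -/
def devWeight (i : ι) [Fintype (α i)] (σ : stdSimplex ℝ (α i)) (μ : (∀ j, α j) → ℝ) :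
    (∀ j, α j) → ℝ :=
  fun a => σ (a i) * ∑ b, μ (Function.update a i b)

theorem devWeight_mem_stdSimplex [Fintype ι] [∀ j, Fintype (α j)] (i : ι)
    (σ : stdSimplex ℝ (α i)) {μ : (∀ j, α j) → ℝ} (hμ : μ ∈ stdSimplex ℝ (∀ j, α j)) :
    devWeight i σ μ ∈ stdSimplex ℝ (∀ j, α j) := by
  refine ⟨fun a => mul_nonneg (σ.2.1 _) (Finset.sum_nonneg fun b _ => hμ.1 _), ?_⟩
  calc ∑ a, devWeight i σ μ a
      = ∑ z : (∀ j, α j) × α i, σ (z.1 i) * μ (Function.update z.1 i z.2) := by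
        simp only [devWeight, Finset.mul_sum, Fintype.sum_prod_type]
    _ = ∑ z : (∀ j, α j) × α i, σ z.2 * μ z.1 := by
        rw [← Equiv.sum_comp (swapCoord i)]
        simp only [swapCoord, Equiv.coe_fn_mk, Function.update_self, Function.update_idem,
          Function.update_eq_self]
    _ = 1 := by
        simp only [Fintype.sum_prod_type, ← Finset.sum_mul, stdSimplex.sum_eq_one, one_mul, hμ.2]

end Deviations

/-! ### Mixing weights -/

section MixWeight

theorem mixWeight_succ (α : ℕ → ℝ) {K k : ℕ} (hk : k ≤ K) :
    mixWeight α (K + 1) k = (1 - α (K + 1)) * mixWeight α K k := by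
  rw [mixWeight, mixWeight, Finset.prod_Icc_succ_top (by omega)]
  ring

theorem mixWeight_self (α : ℕ → ℝ) (K : ℕ) : mixWeight α K K = α K := by
  rw [mixWeight, Finset.Icc_eq_empty (by omega), Finset.prod_empty, mul_one]

theorem sum_mixWeight_succ (α g : ℕ → ℝ) (K : ℕ) :
    ∑ k : Fin (K + 1), mixWeight α (K + 1) (k + 1) * g k =
      (1 - α (K + 1)) * (∑ k : Fin K, mixWeight α K (k + 1) * g k) + α (K + 1) * g K := by
  rw [Fin.sum_univ_castSucc, Finset.mul_sum]
  congr 1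
  · refine Finset.sum_congr rfl fun k _ => ?_
    rw [Fin.val_castSucc, mixWeight_succ α k.isLt, mul_assoc]
  · rw [Fin.val_last, mixWeight_self]

theorem le_sum_mixWeight {α u g : ℕ → ℝ} {K : ℕ} (hα : ∀ k, α (k + 1) ≤ 1) (h0 : u 0 ≤ 0)
    (hu : ∀ k < K, u (k + 1) ≤ (1 - α (k + 1)) * u k + α (k + 1) * g k) :
    u K ≤ ∑ k : Fin K, mixWeight α K (k + 1) * g k := by
  induction K with
  | zero => simpa using h0
  | succ K ih =>
    calc u (K + 1) ≤ (1 - α (K + 1)) * u K + α (K + 1) * g K := hu K K.lt_succ_self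
      _ ≤ (1 - α (K + 1)) * (∑ k : Fin K, mixWeight α K (k + 1) * g k) + α (K + 1) * g K := by
        have := sub_nonneg.2 (hα K)
        gcongr
        exact ih fun k hk => hu k (hk.trans K.lt_succ_self)
      _ = _ := (sum_mixWeight_succ α g K).symm

theorem eq_sum_mixWeight {α u g : ℕ → ℝ} {K : ℕ} (h0 : u 0 = 0)
    (hu : ∀ k < K, u (k + 1) = (1 - α (k + 1)) * u k + α (k + 1) * g k) :
    u K = ∑ k : Fin K, mixWeight α K (k + 1) * g k := by
  induction K with
  | zero => simpa using h0
  | succ K ih =>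
    rw [sum_mixWeight_succ, hu K K.lt_succ_self, ih fun k hk => hu k (hk.trans K.lt_succ_self)]

/-- The step sizes `c / (k - 1 + c)`, of which `stepα` is the case `c = c_α log K`. -/
def harmStep (c : ℝ) (k : ℕ) : ℝ := c / ((k : ℝ) - 1 + c)

variable {c : ℝ}

theorem harmStep_succ (c : ℝ) (k : ℕ) : harmStep c (k + 1) = c / (k + c) := by
  simp [harmStep]

theorem harmStep_succ_pos (hc : 0 < c) (k : ℕ) : 0 < harmStep c (k + 1) := by
  rw [harmStep_succ]; positivity

theorem one_sub_harmStep_succ (hc : 0 < c) (k : ℕ) : 1 - harmStep c (k + 1) = k / (k + c) := by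
  rw [harmStep_succ, one_sub_div (by positivity), add_sub_cancel_right]

theorem harmStep_succ_le_one (hc : 0 < c) (k : ℕ) : harmStep c (k + 1) ≤ 1 := by
  rw [← sub_nonneg, one_sub_harmStep_succ hc]; positivity

theorem mixWeight_harmStep_nonneg (hc : 0 < c) (K k : ℕ) :
    0 ≤ mixWeight (harmStep c) K (k + 1) := by
  refine mul_nonneg (harmStep_succ_pos hc k).le (Finset.prod_nonneg fun j hj => ?_)
  obtain ⟨j, rfl⟩ := Nat.exists_eq_add_of_lt (Nat.lt_of_lt_of_le k.succ_pos
    (Nat.le_of_succ_le (Finset.mem_Icc.1 hj).1))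
  rw [zero_add]
  exact sub_nonneg.2 (harmStep_succ_le_one hc j)

theorem mixWeight_harmStep_mem_stdSimplex (hc : 0 < c) {K : ℕ} (hK : K ≠ 0) :
    (fun k : Fin K => mixWeight (harmStep c) K (k + 1)) ∈ stdSimplex ℝ (Fin K) := by
  refine ⟨fun k => mixWeight_harmStep_nonneg hc K k, ?_⟩
  -- `α₁ = 1` forgets the initial value, so the recursion with `g = 1` stays at `1` from then on.
  have hsum := eq_sum_mixWeight (α := harmStep c) (u := fun k => if k = 0 then 0 else 1)
    (g := fun _ => 1) (K := K) rfl fun k _ => by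
      rcases eq_or_ne k 0 with rfl | hk
      · simp [harmStep, hc.ne']
      · simp [hk]
  simpa [hK] using hsum.symm

theorem mixWeight_harmStep_le_div_add (hc : 1 ≤ c) {K k : ℕ} (hk : k < K) :
    mixWeight (harmStep c) K (k + 1) ≤ c / ((K : ℝ) - 1 + c) := by
  have hc0 : 0 < c := by linarith
  induction K with
  | zero => omega
  | succ K ih =>
    rw [Nat.cast_succ, add_sub_cancel_right]
    rcases Nat.lt_succ_iff_lt_or_eq.1 hk with hkK | rfl
    · have hK : (1 : ℝ) ≤ K := by exact_mod_cast Nat.one_le_of_lt hkK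
      rw [mixWeight_succ _ hkK, one_sub_harmStep_succ hc0]
      calc (K : ℝ) / (K + c) * mixWeight (harmStep c) K (k + 1)
          ≤ K / (K + c) * (c / ((K : ℝ) - 1 + c)) := by gcongr; exact ih hkK
        _ = c / (K + c) * (K / ((K : ℝ) - 1 + c)) := by ring
        _ ≤ c / (K + c) :=
          mul_le_of_le_one_right (by positivity) (div_le_one_of_le₀ (by linarith) (by linarith))
    · rw [mixWeight_self, harmStep_succ]

theorem mixWeight_harmStep_le_div (hc : 1 ≤ c) {K k : ℕ} (hk : k < K) :
    mixWeight (harmStep c) K (k + 1) ≤ c / K := by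
  have hK : (0 : ℝ) < K := by exact_mod_cast Nat.zero_lt_of_lt hk
  refine (mixWeight_harmStep_le_div_add hc hk).trans ?_
  gcongr
  linarith

theorem one_sub_harmStep_succ_le_rpow (hc : 1 ≤ c) (k : ℕ) :
    1 - harmStep c (k + 1) ≤ (((k : ℝ) - 1 + c) / (k + c)) ^ c := by
  have hkc : (1 : ℝ) ≤ k + c := by linarith [(Nat.cast_nonneg k : (0 : ℝ) ≤ k)]
  have bernoulli := one_add_mul_self_le_rpow_one_add (s := -(1 / ((k : ℝ) + c)))
    (neg_le_neg (div_le_one_of_le₀ hkc (by linarith))) hc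
  convert bernoulli using 1
  · rw [harmStep_succ]; ring
  · congr 1; field_simp; ring

theorem mixWeight_harmStep_le_rpow (hc : 1 ≤ c) {K k : ℕ} (hk : k < K) :
    mixWeight (harmStep c) K (k + 1) ≤ ((k + c) / ((K : ℝ) - 1 + c)) ^ c := by
  have hc0 : 0 < c := by linarith
  induction K with
  | zero => omega
  | succ K ih =>
    rw [Nat.cast_succ, add_sub_cancel_right]
    rcases Nat.lt_succ_iff_lt_or_eq.1 hk with hkK | rfl
    · have hK : (1 : ℝ) ≤ K := by exact_mod_cast Nat.one_le_of_lt hkK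
      have hKc : 0 < (K : ℝ) - 1 + c := by linarith
      rw [mixWeight_succ _ hkK]
      calc (1 - harmStep c (K + 1)) * mixWeight (harmStep c) K (k + 1)
          ≤ (((K : ℝ) - 1 + c) / (K + c)) ^ c * ((k + c) / ((K : ℝ) - 1 + c)) ^ c :=
            mul_le_mul (one_sub_harmStep_succ_le_rpow hc K) (ih hkK)
              (mixWeight_harmStep_nonneg hc0 _ _) (by positivity)
        _ = ((k + c) / ((K : ℝ) + c)) ^ c := by
            rw [← Real.mul_rpow (by positivity) (by positivity)]
            congr 1
            field_simp
    · rw [mixWeight_self, div_self (by positivity), Real.one_rpow]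
      exact harmStep_succ_le_one hc0 k

end MixWeight

/-! ### Follow the regularized leader -/

section FreeEnergy

open stdSimplex (barycenter)

variable {X : Type} [Fintype X]

theorem log_wMean_exp_le_of_le {p : X → ℝ} (hp : p ∈ stdSimplex ℝ X) {f : X → ℝ} {b : ℝ}
    (h : ∀ a, f a ≤ b) : Real.log (wMean p fun a => Real.exp (f a)) ≤ b := by
  rw [Real.log_le_iff_le_exp (wMean_exp_pos hp f)]
  exact wMean_le hp fun a => Real.exp_le_exp.2 (h a)

variable [Nonempty X]

/-- The normalized free energy of the table `Q` at inverse temperature `η`; it is the potential in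
the regret analysis of the exponential weights `softmax η Q`. -/
def freeEnergy (η : ℝ) (Q : X → ℝ) : ℝ :=
  Real.log (wMean (barycenter : stdSimplex ℝ X) fun a => Real.exp (η * Q a)) / η

theorem freeEnergy_mul {η c : ℝ} (hc : 0 < c) (Q : X → ℝ) :
    freeEnergy η (fun a => c * Q a) = c * freeEnergy (η * c) Q := by
  rw [freeEnergy, freeEnergy]
  simp only [← mul_assoc]
  rw [mul_div_assoc', mul_comm η c, mul_div_mul_left _ _ hc.ne']

theorem freeEnergy_le {η b : ℝ} (hη : 0 < η) {Q : X → ℝ} (h : ∀ a, Q a ≤ b) :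
    freeEnergy η Q ≤ b := by
  rw [freeEnergy, div_le_iff₀' hη]
  exact log_wMean_exp_le_of_le (coe_mem_stdSimplex _) fun a => by gcongr; exact h a

theorem le_freeEnergy {η : ℝ} (hη : 0 < η) (Q : X → ℝ) (a : X) :
    Q a ≤ freeEnergy η Q + Real.log (Fintype.card X) / η := by
  have single_le : (Fintype.card X : ℝ)⁻¹ * Real.exp (η * Q a) ≤
      wMean (barycenter : stdSimplex ℝ X) fun a => Real.exp (η * Q a) :=
    Finset.single_le_sum (f := fun b => (Fintype.card X : ℝ)⁻¹ * Real.exp (η * Q b))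
      (fun b _ => by positivity) (Finset.mem_univ a)
  have log_le := Real.log_le_log (by positivity) single_le
  rw [Real.log_mul (by positivity) (Real.exp_pos _).ne', Real.log_inv, Real.log_exp] at log_le
  rw [freeEnergy, ← add_div, le_div_iff₀ hη]
  linarith

theorem freeEnergy_mono {θ η : ℝ} (hθ : 0 < θ) (h : θ ≤ η) (Q : X → ℝ) :
    freeEnergy θ Q ≤ freeEnergy η Q := by
  have hu := coe_mem_stdSimplex (barycenter : stdSimplex ℝ X)
  have hη : 0 < η := hθ.trans_le h
  have hpos := wMean_exp_pos hu (fun a => θ * Q a)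
  have jensen := Real.rpow_arith_mean_le_arith_mean_rpow Finset.univ
    (barycenter : stdSimplex ℝ X) (fun a => Real.exp (θ * Q a)) (fun a _ => hu.1 a) hu.2
    (fun a _ => (Real.exp_pos _).le) ((one_le_div hθ).2 h)
  have exp_rpow : ∀ a, Real.exp (θ * Q a) ^ (η / θ) = Real.exp (η * Q a) := by
    intro a
    rw [← Real.exp_mul]
    congr 1
    field_simp
  simp only [exp_rpow] at jensen
  have log_le := Real.log_le_log (Real.rpow_pos_of_pos hpos _) jensen
  rw [Real.log_rpow hpos] at log_le
  rw [freeEnergy, freeEnergy, le_div_iff₀ hη, div_mul_comm]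
  exact log_le

theorem wMean_barycenter_exp_add {η t : ℝ} (Q q : X → ℝ) :
    (wMean (barycenter : stdSimplex ℝ X) fun a => Real.exp (η * (Q a + t * q a))) =
      (wMean (barycenter : stdSimplex ℝ X) fun a => Real.exp (η * Q a)) *
        wMean (softmax η Q) fun a => Real.exp (η * t * q a) := by
  have hs : 0 < ∑ b, Real.exp (η * Q b) :=
    Finset.sum_pos (fun b _ => Real.exp_pos _) Finset.univ_nonempty
  have normalize : (wMean (barycenter : stdSimplex ℝ X) fun a => Real.exp (η * Q a)) =
      (Fintype.card X : ℝ)⁻¹ * ∑ b, Real.exp (η * Q b) := (Finset.mul_sum ..).symm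
  rw [normalize, wMean, wMean, Finset.mul_sum]
  refine Finset.sum_congr rfl fun a _ => ?_
  change (Fintype.card X : ℝ)⁻¹ * _ = _ * (Real.exp (η * Q a) / (∑ b, Real.exp (η * Q b)) * _)
  rw [mul_add, Real.exp_add, ← mul_assoc η t]
  field_simp [hs.ne']

theorem freeEnergy_add {η t : ℝ} (Q q : X → ℝ) :
    freeEnergy η (fun a => Q a + t * q a) = freeEnergy η Q +
      Real.log (wMean (softmax η Q) fun a => Real.exp (η * t * q a)) / η := by
  rw [freeEnergy, freeEnergy, wMean_barycenter_exp_add,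
    Real.log_mul (wMean_exp_pos (coe_mem_stdSimplex _) _).ne'
      (wMean_exp_pos (coe_mem_stdSimplex _) _).ne', add_div]

section OneRound

variable {α η η' : ℝ} {Q q : X → ℝ}

theorem freeEnergy_step_le_of_log_le {B : ℝ} (hα : α < 1) (hη : 0 < η) (hη' : 0 < η')
    (hηα : η' * (1 - α) ≤ η)
    (hB : Real.log (wMean (softmax η Q) fun a => Real.exp (η * (α / (1 - α)) * q a)) ≤
      η * (α / (1 - α)) * B) :
    freeEnergy η' (fun a => (1 - α) * Q a + α * q a) ≤ (1 - α) * freeEnergy η Q + α * B := by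
  have hα' : 0 < 1 - α := sub_pos.2 hα
  have factor : (fun a => (1 - α) * Q a + α * q a) =
      fun a => (1 - α) * (Q a + α / (1 - α) * q a) := by
    funext a
    field_simp
  calc freeEnergy η' (fun a => (1 - α) * Q a + α * q a)
      = (1 - α) * freeEnergy (η' * (1 - α)) (fun a => Q a + α / (1 - α) * q a) := by
        rw [factor, freeEnergy_mul hα']
    _ ≤ (1 - α) * freeEnergy η (fun a => Q a + α / (1 - α) * q a) := by
        gcongr
        exact freeEnergy_mono (mul_pos hη' hα') hηα _
    _ ≤ (1 - α) * (freeEnergy η Q + η * (α / (1 - α)) * B / η) := by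
        rw [freeEnergy_add]
        gcongr
    _ = (1 - α) * freeEnergy η Q + α * B := by field_simp

theorem freeEnergy_step_le_of_le {hi : ℝ} (hα0 : 0 ≤ α) (hα : α ≤ 1) (hη : 0 < η)
    (hη' : 0 < η') (hηα : η' * (1 - α) ≤ η) (hq : ∀ a, q a ≤ hi) :
    freeEnergy η' (fun a => (1 - α) * Q a + α * q a) ≤ (1 - α) * freeEnergy η Q + α * hi := by
  rcases hα.lt_or_eq with hα | rfl
  · have := sub_pos.2 hα
    refine freeEnergy_step_le_of_log_le hα hη hη' hηα
      (log_wMean_exp_le_of_le (coe_mem_stdSimplex _) fun a => ?_)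
    gcongr
    exact hq a
  · simpa using freeEnergy_le hη' hq

theorem freeEnergy_step_le_of_small {lo hi : ℝ} (hα0 : 0 ≤ α) (hα : α < 1) (hη : 0 < η)
    (hη' : 0 < η') (hηα : η' * (1 - α) ≤ η) (hlo : ∀ a, lo ≤ q a) (hhi : ∀ a, q a ≤ hi)
    (hsmall : η * (α / (1 - α)) * (hi - lo) ≤ 1) :
    freeEnergy η' (fun a => (1 - α) * Q a + α * q a) ≤ (1 - α) * freeEnergy η Q +
      α * (wMean (softmax η Q) q + η * (α / (1 - α)) * wVar (softmax η Q) q) := by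
  have := sub_pos.2 hα
  refine freeEnergy_step_le_of_log_le hα hη hη' hηα ?_
  refine (log_wMean_exp_le (coe_mem_stdSimplex _) (by positivity) hlo hhi hsmall).trans_eq ?_
  ring

theorem freeEnergy_step_le {b lo hi u : ℝ} (hα0 : 0 ≤ α) (hα1 : α ≤ 1) (hη : 0 < η)
    (hη' : 0 < η') (hηα : η' * (1 - α) ≤ η) (hlo : ∀ a, lo ≤ q a) (hhi : ∀ a, q a ≤ hi)
    (hb : 0 ≤ b) (hbsmall : b * (hi - lo) ≤ 1) (hu0 : 0 ≤ u)
    (hu : (α < 1 ∧ η * (α / (1 - α)) ≤ b) ∨ hi - lo ≤ u) :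
    freeEnergy η' (fun a => (1 - α) * Q a + α * q a) ≤ (1 - α) * freeEnergy η Q +
      α * (wMean (softmax η Q) q + b * wVar (softmax η Q) q + u) := by
  have hvar := wVar_nonneg (coe_mem_stdSimplex (softmax η Q)) q
  rcases hu with ⟨hα, hrate⟩ | hu
  · have hrange : 0 ≤ hi - lo := by
      obtain ⟨a⟩ := ‹Nonempty X›
      exact sub_nonneg.2 ((hlo a).trans (hhi a))
    refine (freeEnergy_step_le_of_small hα0 hα hη hη' hηα hlo hhi
      ((mul_le_mul_of_nonneg_right hrate hrange).trans hbsmall)).trans ?_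
    rw [add_assoc]
    gcongr
    exact (mul_le_mul_of_nonneg_right hrate hvar).trans (le_add_of_nonneg_right hu0)
  · refine (freeEnergy_step_le_of_le hα0 hα1 hη hη' hηα hhi).trans ?_
    have hmean := le_wMean (coe_mem_stdSimplex (softmax η Q)) hlo
    have := mul_nonneg hb hvar
    gcongr
    linarith

end OneRound

theorem le_sum_mixWeight_softmax {α η : ℕ → ℝ} {Q q : ℕ → X → ℝ} {K : ℕ} {b lo hi : ℝ}
    (hα0 : ∀ k, 0 ≤ α (k + 1)) (hα1 : ∀ k, α (k + 1) ≤ 1) (hη : ∀ k, 0 < η (k + 1))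
    (hηα : ∀ k, η (k + 2) * (1 - α (k + 1)) ≤ η (k + 1)) (hQ0 : ∀ a, Q 0 a = 0)
    (hQ : ∀ k < K, ∀ a, Q (k + 1) a = (1 - α (k + 1)) * Q k a + α (k + 1) * q k a)
    (hlo : ∀ k < K, ∀ a, lo ≤ q k a) (hhi : ∀ k < K, ∀ a, q k a ≤ hi)
    (hb : 0 ≤ b) (hbsmall : b * (hi - lo) ≤ 1) {u : ℕ → ℝ} (hu0 : ∀ k, 0 ≤ u k)
    (hu : ∀ k < K, (α (k + 1) < 1 ∧ η (k + 1) * (α (k + 1) / (1 - α (k + 1))) ≤ b) ∨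
      hi - lo ≤ u k) (a : X) :
    Q K a ≤ (∑ k : Fin K, mixWeight α K (k + 1) *
      (wMean (softmax (η (k + 1)) (Q k)) (q k) + b * wVar (softmax (η (k + 1)) (Q k)) (q k) + u k))
      + Real.log (Fintype.card X) / η (K + 1) := by
  refine (le_freeEnergy (hη K) (Q K) a).trans (add_le_add_left ?_ _)
  refine le_sum_mixWeight (u := fun k => freeEnergy (η (k + 1)) (Q k))
    (g := fun k => wMean (softmax (η (k + 1)) (Q k)) (q k)
      + b * wVar (softmax (η (k + 1)) (Q k)) (q k) + u k) hα1
    (freeEnergy_le (hη 0) fun a => (hQ0 a).le) fun k hk => ?_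
  simp only [funext (hQ k hk)]
  exact freeEnergy_step_le (hα0 k) (hα1 k) (hη k) (hη (k + 1)) (hηα k) (hlo k hk) (hhi k hk)
    hb hbsmall (hu0 k) (hu k hk)

end FreeEnergy

/-! ### The parameter regime -/

section LearningRate

variable {cα M : ℝ} {K k : ℕ}

/-- The learning rate `sqrt (log K / (α_k M))` for the step sizes `α_k` of `harmStep`; `stepη` is
the case `M = min {H, 1 / R}`. -/
def learnRate (cα M : ℝ) (K k : ℕ) : ℝ :=
  Real.sqrt (Real.log K / (harmStep (cα * Real.log K) k * M))

theorem learnRate_succ_pos (hcα : 0 < cα) (hM : 0 < M) (hK : 0 < Real.log K) (k : ℕ) :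
    0 < learnRate cα M K (k + 1) := by
  have := harmStep_succ_pos (mul_pos hcα hK) k
  exact Real.sqrt_pos.2 (by positivity)

theorem learnRate_succ_sq (hcα : 0 < cα) (hM : 0 < M) (hK : 0 < Real.log K) (k : ℕ) :
    learnRate cα M K (k + 1) ^ 2 = (k + cα * Real.log K) / (cα * M) := by
  have := harmStep_succ_pos (mul_pos hcα hK) k
  rw [learnRate, Real.sq_sqrt (by positivity), harmStep_succ]
  field_simp

theorem learnRate_succ_mul_le (hcα : 0 < cα) (hM : 0 < M) (hc : 1 ≤ cα * Real.log K) (k : ℕ) :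
    learnRate cα M K (k + 2) * (1 - harmStep (cα * Real.log K) (k + 1)) ≤
      learnRate cα M K (k + 1) := by
  have hK : 0 < Real.log K := pos_of_mul_pos_right (zero_lt_one.trans_le hc) hcα.le
  have hpos := learnRate_succ_pos hcα hM hK
  refine (sq_le_sq₀ (mul_nonneg (hpos _).le (sub_nonneg.2
    (harmStep_succ_le_one (mul_pos hcα hK) k))) (hpos k).le).1 ?_
  rw [mul_pow, learnRate_succ_sq hcα hM hK (k + 1), learnRate_succ_sq hcα hM hK k,
    one_sub_harmStep_succ (mul_pos hcα hK), div_pow, div_mul_eq_mul_div]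
  set c := cα * Real.log K
  gcongr
  rw [mul_div_assoc', div_le_iff₀ (by positivity), Nat.cast_succ]
  have hk : (0 : ℝ) ≤ k := k.cast_nonneg
  have hsq : (k : ℝ) ^ 2 ≤ (k + c) * (2 * k * c) := by
    nlinarith [mul_nonneg (mul_nonneg hk hk) (sub_nonneg.2 hc), mul_nonneg hk hk,
      mul_nonneg hk (mul_self_nonneg c)]
  nlinarith [mul_nonneg (add_nonneg hk (zero_le_one.trans hc)) (mul_self_nonneg c)]

theorem learnRate_mul_div_sq_le (hcα : 0 < cα) (hM : 0 < M) (hK : 0 < Real.log K)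
    (hk : cα * Real.log K ≤ k) :
    (learnRate cα M K (k + 1) * (harmStep (cα * Real.log K) (k + 1) /
      (1 - harmStep (cα * Real.log K) (k + 1)))) ^ 2 ≤
      4 * cα * Real.log K ^ 2 / (M * (k + cα * Real.log K)) := by
  have hc := mul_pos hcα hK
  have hk0 : (0 : ℝ) < k := hc.trans_le hk
  rw [mul_pow, learnRate_succ_sq hcα hM hK, one_sub_harmStep_succ hc, harmStep_succ,
    div_div_div_cancel_right₀ (by positivity)]
  calc (k + cα * Real.log K) / (cα * M) * (cα * Real.log K / k) ^ 2
      = cα * Real.log K ^ 2 / M * ((k + cα * Real.log K) / k ^ 2) := by field_simp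
    _ ≤ cα * Real.log K ^ 2 / M * (4 / (k + cα * Real.log K)) := by
        gcongr ?_ * ?_
        rw [div_le_div_iff₀ (by positivity) (by positivity)]
        nlinarith
    _ = 4 * cα * Real.log K ^ 2 / (M * (k + cα * Real.log K)) := by field_simp

theorem mixWeight_harmStep_le_of_early (hcα : 0 < cα) (hc : 1 ≤ cα * Real.log K) (hk : k < K)
    (hearly : k + cα * Real.log K ≤ Real.exp (-(2 / cα)) * K) :
    mixWeight (harmStep (cα * Real.log K)) K (k + 1) ≤ 1 / (K : ℝ) ^ 2 := by
  have hK : (0 : ℝ) < K := by exact_mod_cast Nat.zero_lt_of_lt hk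
  have hden : 0 < (K : ℝ) - 1 + cα * Real.log K := by linarith
  have hratio : (k + cα * Real.log K) / ((K : ℝ) - 1 + cα * Real.log K) ≤
      Real.exp (-(2 / cα)) := by
    rw [div_le_iff₀ hden]
    exact hearly.trans (by gcongr; linarith)
  have hexponent : -(2 / cα) * (cα * Real.log K) = -(Real.log K + Real.log K) := by
    field_simp
    ring
  calc mixWeight (harmStep (cα * Real.log K)) K (k + 1)
      ≤ ((k + cα * Real.log K) / ((K : ℝ) - 1 + cα * Real.log K)) ^ (cα * Real.log K) :=
        mixWeight_harmStep_le_rpow hc hk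
    _ ≤ Real.exp (-(2 / cα)) ^ (cα * Real.log K) := by gcongr
    _ = 1 / (K : ℝ) ^ 2 := by
        rw [← Real.exp_mul, hexponent, Real.exp_neg, Real.exp_add, Real.exp_log hK, sq, one_div]

end LearningRate

theorem sum_mul_ite_le_div {K : ℕ} (hK : K ≠ 0) (w : Fin K → ℝ) {B : ℝ} (hB : 0 ≤ B) :
    ∑ k, w k * (if w k ≤ 1 / (K : ℝ) ^ 2 then B else 0) ≤ B / K := by
  have term_le : ∀ k, w k * (if w k ≤ 1 / (K : ℝ) ^ 2 then B else 0) ≤ 1 / (K : ℝ) ^ 2 * B := by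
    intro k
    split_ifs with hw
    · gcongr
    · rw [mul_zero]; positivity
  calc ∑ k, w k * (if w k ≤ 1 / (K : ℝ) ^ 2 then B else 0) ≤ ∑ _k : Fin K, 1 / (K : ℝ) ^ 2 * B :=
        Finset.sum_le_sum fun k _ => term_le k
    _ = B / K := by
        rw [Finset.sum_const, Finset.card_univ, Fintype.card_fin, nsmul_eq_mul]
        field_simp

/-- The rate `sqrt (L ^ 3 / (K M))` at which estimates concentrate; the bonus is a multiple of it,
with `L` the logarithmic factor. -/
def rate (M L : ℝ) (K : ℕ) : ℝ := Real.sqrt (L ^ 3 / (K * M))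

/-- The consequences of a large number of rounds on which the analysis rests: `M` stands for
`min {H, 1 / R}` and `L` for the logarithmic factor. -/
structure Regime (cα cb M L : ℝ) (K : ℕ) : Prop where
  cα_pos : 0 < cα
  cb_pos : 0 < cb
  K_large : 32 ≤ K
  one_le_M : 1 ≤ M
  one_le_L : 1 ≤ L
  log_le : Real.log K ≤ L
  one_le_c : 1 ≤ cα * Real.log K
  early_harm : 2 * (cα * Real.log K) ≤ Real.exp (-(2 / cα)) * K
  early_log : 4 * cα / cb ^ 2 ≤ Real.exp (-(2 / cα)) * L
  small : 24 * (cb + 1) * (rate M L K * M) ≤ 1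
  rate_large : 6 ≤ cb * rate M L K * K
  M_le : M ≤ K

namespace Regime

variable {cα cb M L : ℝ} {K : ℕ}

theorem K_pos (h : Regime cα cb M L K) : (0 : ℝ) < K := by
  exact_mod_cast (by norm_num : 0 < 32).trans_le h.K_large

theorem log_pos (h : Regime cα cb M L K) : 0 < Real.log K :=
  Real.log_pos (by exact_mod_cast (by norm_num : 1 < 32).trans_le h.K_large)

theorem M_pos (h : Regime cα cb M L K) : 0 < M := zero_lt_one.trans_le h.one_le_M

theorem L_pos (h : Regime cα cb M L K) : 0 < L := zero_lt_one.trans_le h.one_le_L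

theorem c_pos (h : Regime cα cb M L K) : 0 < cα * Real.log K := mul_pos h.cα_pos h.log_pos

theorem rate_pos (h : Regime cα cb M L K) : 0 < rate M L K := by
  have := h.K_pos
  have := h.M_pos
  have := h.L_pos
  exact Real.sqrt_pos.2 (by positivity)

theorem rate_sq (h : Regime cα cb M L K) : rate M L K ^ 2 = L ^ 3 / (K * M) := by
  have := h.K_pos
  have := h.M_pos
  have := h.L_pos
  exact Real.sq_sqrt (by positivity)

theorem rate_mul_M_small (h : Regime cα cb M L K) : 24 * (rate M L K * M) ≤ 1 := by
  have := mul_nonneg h.cb_pos.le (mul_nonneg h.rate_pos.le h.M_pos.le)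
  linarith [h.small]

theorem cb_rate_mul_M_small (h : Regime cα cb M L K) : 24 * (cb * rate M L K * M) ≤ 1 := by
  have := mul_nonneg h.rate_pos.le h.M_pos.le
  linarith [h.small]

theorem four_mul_cα_le (h : Regime cα cb M L K) : 4 * cα ≤ cb ^ 2 * L := by
  have hcb := h.cb_pos
  have hexp : Real.exp (-(2 / cα)) ≤ 1 :=
    Real.exp_le_one_iff.2 (neg_nonpos.2 (div_pos two_pos h.cα_pos).le)
  have hL : 4 * cα / cb ^ 2 ≤ L := h.early_log.trans (mul_le_of_le_one_left h.L_pos.le hexp)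
  rwa [div_le_iff₀' (by positivity)] at hL

theorem learnRate_mul_div_le (h : Regime cα cb M L K) {k : ℕ} (hk : cα * Real.log K ≤ k)
    (hkL : 4 * cα / cb ^ 2 * K ≤ (k + cα * Real.log K) * L) :
    learnRate cα M K (k + 1) * (harmStep (cα * Real.log K) (k + 1) /
      (1 - harmStep (cα * Real.log K) (k + 1))) ≤ cb * rate M L K := by
  have hlog := h.log_pos
  have hc := h.c_pos
  have hK := h.K_pos
  have hM := h.M_pos
  have hcb := h.cb_pos
  have hkc : 0 < k + cα * Real.log K := by positivity
  refine le_of_sq_le_sq ?_ (mul_pos hcb h.rate_pos).le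
  calc _ ≤ 4 * cα * Real.log K ^ 2 / (M * (k + cα * Real.log K)) :=
        learnRate_mul_div_sq_le h.cα_pos hM hlog hk
    _ ≤ 4 * cα * L ^ 2 / (M * (k + cα * Real.log K)) := by
        have := h.cα_pos
        gcongr
        exact h.log_le
    _ ≤ cb ^ 2 * (L ^ 3 / (K * M)) := by
        rw [div_mul_eq_mul_div, div_le_iff₀ (by positivity)] at hkL
        rw [mul_div_assoc', div_le_div_iff₀ (by positivity) (by positivity)]
        nlinarith [mul_le_mul_of_nonneg_left hkL (by positivity : 0 ≤ L ^ 2 * M)]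
    _ = (cb * rate M L K) ^ 2 := by rw [mul_pow, h.rate_sq]

theorem late_or_early (h : Regime cα cb M L K) {k : ℕ} (hk : k < K) :
    (harmStep (cα * Real.log K) (k + 1) < 1 ∧
      learnRate cα M K (k + 1) * (harmStep (cα * Real.log K) (k + 1) /
        (1 - harmStep (cα * Real.log K) (k + 1))) ≤ cb * rate M L K) ∨
      mixWeight (harmStep (cα * Real.log K)) K (k + 1) ≤ 1 / (K : ℝ) ^ 2 := by
  by_cases hlate : cα * Real.log K ≤ k ∧ 4 * cα / cb ^ 2 * K ≤ (k + cα * Real.log K) * L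
  · refine Or.inl ⟨?_, h.learnRate_mul_div_le hlate.1 hlate.2⟩
    have hk0 : (0 : ℝ) < k := h.c_pos.trans_le hlate.1
    rw [← sub_pos, one_sub_harmStep_succ h.c_pos]
    exact div_pos hk0 (add_pos hk0 h.c_pos)
  · refine Or.inr (mixWeight_harmStep_le_of_early h.cα_pos h.one_le_c hk ?_)
    rw [not_and_or, not_le, not_le] at hlate
    rcases hlate with hkc | hkL
    · exact le_trans (by linarith) h.early_harm
    · refine le_of_mul_le_mul_right ?_ h.L_pos
      linarith [mul_le_mul_of_nonneg_right h.early_log h.K_pos.le]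

theorem div_learnRate_le (h : Regime cα cb M L K) :
    L / learnRate cα M K (K + 1) ≤ cb / 2 * rate M L K * M := by
  have hcα := h.cα_pos
  have hlog := h.log_pos
  have hK := h.K_pos
  have hM := h.M_pos
  have hL := h.L_pos
  have hcb := h.cb_pos
  have hρ := h.rate_pos
  refine le_of_sq_le_sq ?_ (by positivity)
  rw [div_pow, learnRate_succ_sq hcα hM hlog, mul_pow, mul_pow, h.rate_sq]
  calc L ^ 2 / ((K + cα * Real.log K) / (cα * M))
      = L ^ 2 * M * cα / (K + cα * Real.log K) := by field_simp
    _ ≤ L ^ 2 * M * (cb ^ 2 * L / 4) / K := by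
        gcongr
        · linarith [h.four_mul_cα_le]
        · exact le_add_of_nonneg_right (by positivity)
    _ = (cb / 2) ^ 2 * (L ^ 3 / (K * M)) * M ^ 2 := by
        field_simp
        ring

theorem regret_le_bonus (h : Regime cα cb M L K) {X : Type} [Fintype X] [Nonempty X]
    {Q q : ℕ → X → ℝ} {lo hi : ℝ} (hX : Real.log (Fintype.card X) ≤ L) (hQ0 : ∀ a, Q 0 a = 0)
    (hQ : ∀ k < K, ∀ a, Q (k + 1) a = (1 - harmStep (cα * Real.log K) (k + 1)) * Q k a +
      harmStep (cα * Real.log K) (k + 1) * q k a)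
    (hlo : ∀ k < K, ∀ a, lo ≤ q k a) (hhi : ∀ k < K, ∀ a, q k a ≤ hi)
    (hspan : hi - lo ≤ 3 * M) (a : X) {p : ℕ → stdSimplex ℝ X}
    (hp : ∀ k, p k = softmax (learnRate cα M K (k + 1)) (Q k)) :
    Q K a ≤ (∑ k : Fin K, mixWeight (harmStep (cα * Real.log K)) K (k + 1) * wMean (p k) (q k))
      + cb * rate M L K * ∑ k : Fin K, mixWeight (harmStep (cα * Real.log K)) K (k + 1) *
        (wVar (p k) (q k) + M) := by
  have hM := h.M_pos
  have hK0 : K ≠ 0 := by have := h.K_large; omega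
  have hb : 0 < cb * rate M L K := mul_pos h.cb_pos h.rate_pos
  have hbsmall : cb * rate M L K * (hi - lo) ≤ 1 :=
    (mul_le_mul_of_nonneg_left hspan hb.le).trans
      (by linarith [h.cb_rate_mul_M_small, mul_pos hb hM])
  set w : ℕ → ℝ := fun k => mixWeight (harmStep (cα * Real.log K)) K (k + 1)
  set u : ℕ → ℝ := fun k => if w k ≤ 1 / (K : ℝ) ^ 2 then 3 * M else 0 with hu
  have hregret := le_sum_mixWeight_softmax (u := u) (fun k => (harmStep_succ_pos h.c_pos k).le)
    (harmStep_succ_le_one h.c_pos) (learnRate_succ_pos h.cα_pos hM h.log_pos)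
    (learnRate_succ_mul_le h.cα_pos hM h.one_le_c) hQ0 hQ hlo hhi hb.le hbsmall
    (fun k => by positivity)
    (fun k hk => (h.late_or_early hk).imp_right fun hw => by simpa only [hu, w, hw, if_true])
    a
  simp only [← hp] at hregret
  have hearly : ∑ k : Fin K, w k * u k ≤ cb / 2 * rate M L K * M := by
    refine (sum_mul_ite_le_div hK0 _ (by positivity)).trans ?_
    rw [div_le_iff₀ h.K_pos]
    nlinarith [h.rate_large]
  have hentropy : Real.log (Fintype.card X) / learnRate cα M K (K + 1) ≤
      cb / 2 * rate M L K * M :=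
    (div_le_div_of_nonneg_right hX (learnRate_succ_pos h.cα_pos hM h.log_pos K).le).trans
      h.div_learnRate_le
  have hsumM : ∑ k : Fin K, w k * M = M :=
    wMean_const (mixWeight_harmStep_mem_stdSimplex h.c_pos hK0) M
  simp only [mul_add, mul_left_comm _ (cb * rate M L K), Finset.sum_add_distrib,
    ← Finset.mul_sum] at hregret ⊢
  rw [hsumM]
  linarith

end Regime

section OneStep

variable {X Y : Type} {ρ : X → ℝ} {R M : ℝ} {V U f : Y → ℝ}

/-- The deviation of `f` from its minimum, which controls how much a contaminated value function
can oscillate. -/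
def excess (f : Y → ℝ) (y : Y) : ℝ := f y - ⨅ y', f y'

section Bounds

variable [Finite Y]

theorem ciInf_le_apply (V : Y → ℝ) (y : Y) : ⨅ y', V y' ≤ V y :=
  ciInf_le (Set.finite_range V).bddBelow y

theorem excess_nonneg (f : Y → ℝ) (y : Y) : 0 ≤ excess f y := sub_nonneg.2 (ciInf_le_apply f y)

theorem robustTarget_mono (hR : 0 ≤ R) (hR1 : R ≤ 1) (h : ∀ y, V y ≤ U y) (x : X × Y) :
    robustTarget ρ R V x ≤ robustTarget ρ R U x :=
  add_le_add (add_le_add le_rfl (mul_le_mul_of_nonneg_left (h _) (sub_nonneg.2 hR1)))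
    (mul_le_mul_of_nonneg_left (ciInf_mono (Set.finite_range V).bddBelow h) hR)

theorem le_robustTarget (hR1 : R ≤ 1) (hρ : ∀ a, 0 ≤ ρ a) (V : Y → ℝ) (x : X × Y) :
    ⨅ y, V y ≤ robustTarget ρ R V x := by
  have := mul_le_mul_of_nonneg_left (ciInf_le_apply V x.2) (sub_nonneg.2 hR1)
  rw [robustTarget]
  linarith [hρ x.1]

theorem robustTarget_le (hR1 : R ≤ 1) (hρ : ∀ a, ρ a ≤ 1) {B : ℝ}
    (hB : ∀ y y', V y - V y' ≤ B) (x : X × Y) :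
    robustTarget ρ R V x ≤ 1 + (1 - R) * B + ⨅ y, V y := by
  have : Nonempty Y := ⟨x.2⟩
  obtain ⟨y₀, hy₀⟩ := exists_eq_ciInf_of_finite (f := V)
  have := mul_le_mul_of_nonneg_left (hB x.2 y₀) (sub_nonneg.2 hR1)
  rw [robustTarget, ← hy₀]
  linarith [hρ x.1]

theorem robustTarget_sub_le (hR : 0 ≤ R) (hR1 : R ≤ 1) (hρ0 : ∀ a, 0 ≤ ρ a) (hρ1 : ∀ a, ρ a ≤ 1)
    (hM : 1 ≤ M) (hV : ∀ y y', V y - V y' ≤ 2 * M) (x x' : X × Y) :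
    robustTarget ρ R V x - robustTarget ρ R V x' ≤ 3 * M := by
  have hRM := mul_nonneg hR (zero_le_one.trans hM)
  linarith [robustTarget_le hR1 hρ1 hV x, le_robustTarget hR1 hρ0 V x']

theorem osc_add_mul_sq_le {τ d : ℝ} (hM : 0 ≤ M) (hτ : |τ| * M ≤ 1 / 4)
    (hf : ∀ y, excess f y ≤ M) (y z : Y) :
    (f y + τ * excess f y ^ 2 + d) - (f z + τ * excess f z ^ 2 + d) ≤ 2 * M := by
  have hpert (y : Y) : |τ * excess f y ^ 2| ≤ 1 / 4 * M :=
    calc |τ * excess f y ^ 2| = |τ| * excess f y ^ 2 := by rw [abs_mul, abs_sq]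
      _ ≤ |τ| * M ^ 2 := by gcongr; exacts [excess_nonneg f y, hf y]
      _ = |τ| * M * M := by ring
      _ ≤ 1 / 4 * M := by gcongr
  have hosc : f y - f z = excess f y - excess f z := by simp only [excess]; ring
  linarith [hosc, excess_nonneg f z, hf y, (abs_le.1 (hpert y)).2, (abs_le.1 (hpert z)).1]

end Bounds

theorem robustTarget_add_mul_sq (τ d : ℝ) :
    robustTarget ρ R (fun y => f y + τ * excess f y ^ 2 + d) =
      fun x => (robustTarget ρ R f x + τ * (1 - R) * excess f x.2 ^ 2) +
        ((1 - R) * d + R * ((⨅ y, (f y + τ * excess f y ^ 2 + d)) - ⨅ y, f y)) := by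
  funext x
  simp only [robustTarget]
  ring

variable [Fintype X] [Fintype Y] {p : X × Y → ℝ}

theorem wMean_robustTarget_add_mul_sq (hp : p ∈ stdSimplex ℝ (X × Y)) (f : Y → ℝ) (τ d : ℝ) :
    wMean p (robustTarget ρ R fun y => f y + τ * excess f y ^ 2 + d) =
      wMean p (robustTarget ρ R f) + τ * ((1 - R) * wMean p fun x => excess f x.2 ^ 2) +
        ((1 - R) * d + R * ((⨅ y, (f y + τ * excess f y ^ 2 + d)) - ⨅ y, f y)) := by
  rw [robustTarget_add_mul_sq, wMean_add, wMean_add, wMean_mul_left, wMean_const hp]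
  ring

/-- One step of the law of total variance. -/
theorem sq_add_wVar_robustTarget_le (hp : p ∈ stdSimplex ℝ (X × Y)) (hR : 0 ≤ R) (hR1 : R ≤ 1)
    (hρ0 : ∀ a, 0 ≤ ρ a) (hρ1 : ∀ a, ρ a ≤ 1) (hM : 1 ≤ M) (hf : ∀ y, excess f y ≤ M)
    {c : ℝ} (hc0 : 0 ≤ c) (hc : c ≤ wMean p (robustTarget ρ R f) - ⨅ y, f y) :
    c ^ 2 + wVar p (robustTarget ρ R f) ≤
      (1 - R) * wMean p (fun x => excess f x.2 ^ 2) + 3 * M := by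
  have hpoint (x : X × Y) : (robustTarget ρ R f x - ⨅ y, f y) ^ 2 ≤
      (1 - R) * excess f x.2 ^ 2 + 3 * M := by
    have hv0 := excess_nonneg f x.2
    have hRv : (1 - R) * excess f x.2 ≤ M :=
      (mul_le_of_le_one_left hv0 (by linarith)).trans (hf x.2)
    have hsq : ((1 - R) * excess f x.2) ^ 2 ≤ (1 - R) * excess f x.2 ^ 2 := by
      rw [mul_pow]
      gcongr
      exact pow_le_of_le_one (by linarith) (by linarith) two_ne_zero
    have hcross : ρ x.1 * ((1 - R) * excess f x.2) ≤ M :=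
      (mul_le_of_le_one_left (mul_nonneg (by linarith) hv0) (hρ1 x.1)).trans hRv
    have hρsq : ρ x.1 ^ 2 ≤ 1 := pow_le_one₀ (hρ0 x.1) (hρ1 x.1)
    calc (robustTarget ρ R f x - ⨅ y, f y) ^ 2
        = (ρ x.1 + (1 - R) * excess f x.2) ^ 2 := by rw [robustTarget, excess]; ring
      _ ≤ (1 - R) * excess f x.2 ^ 2 + 3 * M := by linarith
  calc c ^ 2 + wVar p (robustTarget ρ R f)
      ≤ (wMean p (robustTarget ρ R f) - ⨅ y, f y) ^ 2 + wVar p (robustTarget ρ R f) := by gcongr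
    _ = wMean p (fun x => (robustTarget ρ R f x - ⨅ y, f y) ^ 2) := by
        rw [wMean_sub_sq hp, add_comm]
    _ ≤ wMean p (fun x => (1 - R) * excess f x.2 ^ 2 + 3 * M) := wMean_mono hp hpoint
    _ = _ := by rw [wMean_add, wMean_mul_left, wMean_const hp]

theorem sq_mul_wVar_excess_le (hp : p ∈ stdSimplex ℝ (X × Y)) (hρ0 : ∀ a, 0 ≤ ρ a)
    (hρ1 : ∀ a, ρ a ≤ 1) (f : Y → ℝ) :
    (1 - R) ^ 2 * wVar p (fun x => excess f x.2) ≤ 2 * wVar p (robustTarget ρ R f) + 2 := by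
  have hsplit : (fun x : X × Y => (1 - R) * excess f x.2) =
      fun x => (robustTarget ρ R f x + -1 * ρ x.1) + -⨅ y, f y := by
    funext x
    simp only [robustTarget, excess]
    ring
  have hρ : wVar p (fun x => ρ x.1) ≤ (1 - 0) ^ 2 :=
    wVar_le_sq hp (fun x => hρ0 x.1) fun x => hρ1 x.1
  rw [← wVar_mul_left, hsplit, wVar_add_const hp]
  refine (wVar_add_le hp _ _).trans ?_
  rw [wVar_mul_left]
  linarith

theorem wVar_robustTarget_add_mul_sq_le (hp : p ∈ stdSimplex ℝ (X × Y)) (hρ0 : ∀ a, 0 ≤ ρ a)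
    (hρ1 : ∀ a, ρ a ≤ 1) (hf : ∀ y, excess f y ≤ M) {τ d : ℝ}
    (hτ : (τ * M) ^ 2 ≤ 1 / 16) :
    wVar p (robustTarget ρ R fun y => f y + τ * excess f y ^ 2 + d) ≤
      3 * wVar p (robustTarget ρ R f) + 1 := by
  set v : X × Y → ℝ := fun x => excess f x.2
  have hv := wVar_nonneg hp v
  have hpert : wVar p (fun x => τ * (1 - R) * v x ^ 2) ≤
      1 / 4 * (2 * wVar p (robustTarget ρ R f) + 2) :=
    calc wVar p (fun x => τ * (1 - R) * v x ^ 2)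
        = (τ * (1 - R)) ^ 2 * wVar p (fun x => v x ^ 2) := wVar_mul_left _ _ _
      _ ≤ (τ * (1 - R)) ^ 2 * (4 * M ^ 2 * wVar p v) := by
          gcongr
          exact wVar_sq_le hp (fun x => excess_nonneg f x.2) fun x => hf x.2
      _ = (τ * M) ^ 2 * (4 * ((1 - R) ^ 2 * wVar p v)) := by ring
      _ ≤ 1 / 16 * (4 * (2 * wVar p (robustTarget ρ R f) + 2)) := by
          gcongr
          exact sq_mul_wVar_excess_le hp hρ0 hρ1 f
      _ = 1 / 4 * (2 * wVar p (robustTarget ρ R f) + 2) := by ring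
  rw [robustTarget_add_mul_sq, wVar_add_const hp]
  refine (wVar_add_le hp _ _).trans ?_
  linarith

variable {c l d : ℝ}

-- The quadratic correction `3 * l * excess f y ^ 2` of the next step pays for the variance
-- and leaves `3 * l * c ^ 2` for the current one, so that the bonuses telescope along the horizon.
theorem wMean_add_mul_wVar_robustTarget_le (hp : p ∈ stdSimplex ℝ (X × Y)) (hR : 0 ≤ R)
    (hR1 : R ≤ 1) (hρ0 : ∀ a, 0 ≤ ρ a) (hρ1 : ∀ a, ρ a ≤ 1) (hM : 1 ≤ M)
    (hf : ∀ y, excess f y ≤ M) (hc0 : 0 ≤ c)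
    (hc : c ≤ wMean p (robustTarget ρ R f) - ⨅ y, f y) (hl0 : 0 ≤ l) (hl : 12 * (l * M) ≤ 1)
    (hV : ∀ y y', V y - V y' ≤ 2 * M)
    (hVf : ∀ y, V y ≤ f y - 3 * l * excess f y ^ 2 + d) :
    wMean p (robustTarget ρ R V) + l * wVar p (robustTarget ρ R V) ≤
      wMean p (robustTarget ρ R f) - 3 * l * c ^ 2 + d + (9 * (l * M) + l) := by
  set U : Y → ℝ := fun y => f y + -(3 * l) * excess f y ^ 2 + d with hU
  have hlM : 0 ≤ l * M := by positivity
  have hUosc : ∀ y y', U y - U y' ≤ 2 * M := by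
    refine osc_add_mul_sq_le (by linarith) ?_ hf
    rw [abs_neg, abs_of_nonneg (by positivity)]
    linarith
  have hVU : wMean p (robustTarget ρ R V) + l * wVar p (robustTarget ρ R V) ≤
      wMean p (robustTarget ρ R U) + l * wVar p (robustTarget ρ R U) := by
    refine wMean_add_mul_wVar_mono hp
      (robustTarget_mono hR hR1 fun y => (hVf y).trans_eq (by rw [hU]; ring))
      (robustTarget_sub_le hR hR1 hρ0 hρ1 hM hV) (robustTarget_sub_le hR hR1 hρ0 hρ1 hM hUosc) ?_
    rw [abs_of_nonneg hl0]
    linarith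
  have hvar : l * wVar p (robustTarget ρ R U) ≤ l * (3 * wVar p (robustTarget ρ R f) + 1) :=
    mul_le_mul_of_nonneg_left
      (wVar_robustTarget_add_mul_sq_le hp hρ0 hρ1 hf (by nlinarith)) hl0
  have hinf : R * ((⨅ y, U y) - ⨅ y, f y) ≤ R * d := by
    have : Nonempty Y := (nonempty_of_mem_stdSimplex hp).map Prod.snd
    obtain ⟨y₀, hy₀⟩ := exists_eq_ciInf_of_finite (f := f)
    have hUy₀ : U y₀ = f y₀ + d := by simp only [hU, excess, hy₀]; ring
    gcongr
    linarith [ciInf_le_apply U y₀]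
  have htotal := mul_le_mul_of_nonneg_left
    (sq_add_wVar_robustTarget_le hp hR hR1 hρ0 hρ1 hM hf hc0 hc) (by positivity : 0 ≤ 3 * l)
  linarith [wMean_robustTarget_add_mul_sq (ρ := ρ) (R := R) hp f (-(3 * l)) d]

theorem le_wMean_sub_mul_wVar_robustTarget (hp : p ∈ stdSimplex ℝ (X × Y)) (hR : 0 ≤ R)
    (hR1 : R ≤ 1) (hρ0 : ∀ a, 0 ≤ ρ a) (hρ1 : ∀ a, ρ a ≤ 1) (hM : 1 ≤ M)
    (hf : ∀ y, excess f y ≤ M) (hc0 : 0 ≤ c)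
    (hc : c ≤ wMean p (robustTarget ρ R f) - ⨅ y, f y) (hl0 : 0 ≤ l) (hl : 12 * (l * M) ≤ 1)
    (hV : ∀ y y', V y - V y' ≤ 2 * M)
    (hfV : ∀ y, f y + 3 * l * excess f y ^ 2 - d ≤ V y) :
    wMean p (robustTarget ρ R f) + 3 * l * c ^ 2 - d - (9 * (l * M) + l) ≤
      wMean p (robustTarget ρ R V) - l * wVar p (robustTarget ρ R V) := by
  set U : Y → ℝ := fun y => f y + 3 * l * excess f y ^ 2 + -d
  have hlM : 0 ≤ l * M := by positivity
  have hUosc : ∀ y y', U y - U y' ≤ 2 * M := by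
    refine osc_add_mul_sq_le (by linarith) ?_ hf
    rw [abs_of_nonneg (by positivity)]
    linarith
  have hUV : wMean p (robustTarget ρ R U) + -l * wVar p (robustTarget ρ R U) ≤
      wMean p (robustTarget ρ R V) + -l * wVar p (robustTarget ρ R V) := by
    refine wMean_add_mul_wVar_mono hp (robustTarget_mono hR hR1 hfV)
      (robustTarget_sub_le hR hR1 hρ0 hρ1 hM hUosc) (robustTarget_sub_le hR hR1 hρ0 hρ1 hM hV) ?_
    rw [abs_neg, abs_of_nonneg hl0]
    linarith
  have hvar : l * wVar p (robustTarget ρ R U) ≤ l * (3 * wVar p (robustTarget ρ R f) + 1) :=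
    mul_le_mul_of_nonneg_left
      (wVar_robustTarget_add_mul_sq_le hp hρ0 hρ1 hf (by nlinarith)) hl0
  have hinf : R * -d ≤ R * ((⨅ y, U y) - ⨅ y, f y) := by
    have : Nonempty Y := (nonempty_of_mem_stdSimplex hp).map Prod.snd
    have hU_ge : (⨅ y, f y) + -d ≤ ⨅ y, U y := le_ciInf fun y => by
      have : 0 ≤ 3 * l * excess f y ^ 2 := by positivity
      linarith [ciInf_le_apply f y]
    gcongr
    linarith
  have htotal := mul_le_mul_of_nonneg_left
    (sq_add_wVar_robustTarget_le hp hR hR1 hρ0 hρ1 hM hf hc0 hc) (by positivity : 0 ≤ 3 * l)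
  linarith [wMean_robustTarget_add_mul_sq (ρ := ρ) (R := R) hp f (3 * l) (-d)]

end OneStep

/-! ### Backward induction -/

section Backward

variable {m S H : ℕ} {A : Fin m → ℕ}

/-- The weights are a joint policy on the last `n` steps. The algorithm fills in its output
backwards, so that the weights of the earlier steps are not yet distributions. -/
def IsPolicyOnLast (n : ℕ) (π : JointWeights S H A) : Prop :=
  ∀ t : Fin H, H - n ≤ t → ∀ s, π t s ∈ stdSimplex ℝ (JointAction A)

theorem IsPolicyOnLast.pred {n : ℕ} {π : JointWeights S H A} (h : IsPolicyOnLast (n + 1) π) :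
    IsPolicyOnLast n π := fun t ht => h t (by omega)

theorem IsPolicyOnLast.deviate {n : ℕ} {π : JointWeights S H A} (h : IsPolicyOnLast n π)
    (i : Fin m) (π' : PlayerPolicy S H A i) : IsPolicyOnLast n (deviate i π' π) :=
  fun t ht s => devWeight_mem_stdSimplex (α := fun j => Fin (A j)) i (π' t s) (h t ht s)

theorem ne_stepIdx_of_le {n : ℕ} (hn : n + 1 ≤ H) {t : Fin H} (ht : H - n ≤ t) :
    t ≠ stepIdx n hn := by
  rintro rfl
  simp only at ht
  omega

theorem IsPolicyOnLast.update {n : ℕ} (hn : n + 1 ≤ H) {π : JointWeights S H A}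
    (h : IsPolicyOnLast n π) {μ : Fin S → JointAction A → ℝ}
    (hμ : ∀ s, μ s ∈ stdSimplex ℝ (JointAction A)) :
    IsPolicyOnLast (n + 1) (Function.update π (stepIdx n hn) μ) := by
  intro t ht s
  rcases eq_or_ne t (stepIdx n hn) with rfl | hne
  · rw [Function.update_self]
    exact hμ s
  · rw [Function.update_of_ne hne]
    have : (t : ℕ) ≠ H - (n + 1) := fun heq => hne (Fin.ext heq)
    exact h t (by omega) s

variable {R M : ℝ} {P₀ : TransKernel S H A} {r : Fin H → Fin S → JointAction A → ℝ}
  {π : JointWeights S H A} {n : ℕ}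

theorem robustDP_le (hR : 0 ≤ R) (hR1 : R ≤ 1) (hr : ∀ h s a, r h s a ≤ 1) (hn : n ≤ H)
    (hπ : IsPolicyOnLast n π) (s : Fin S) : robustDP R P₀ r π n hn s ≤ n := by
  induction n generalizing s with
  | zero => simp [robustDP]
  | succ n ih =>
    refine wMean_le (wCompProd_mem_stdSimplex (hπ _ le_rfl s) _) fun x => ?_
    have hV := ih (Nat.le_of_succ_le hn) hπ.pred
    have hnext := mul_le_mul_of_nonneg_left (hV x.2) (sub_nonneg.2 hR1)
    have hworst := mul_le_mul_of_nonneg_left ((ciInf_le_apply _ x.2).trans (hV x.2)) hR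
    rw [robustTarget]
    push_cast
    linarith [hr (stepIdx n hn) s x.1]

theorem robustDP_update_stepIdx (hn : n + 1 ≤ H)
    (μ : Fin S → JointAction A → ℝ) :
    robustDP R P₀ r (Function.update π (stepIdx n hn) μ) n (Nat.le_of_succ_le hn) =
      robustDP R P₀ r π n (Nat.le_of_succ_le hn) :=
  robustDP_congr R P₀ r n _ fun _ ht => Function.update_of_ne (ne_stepIdx_of_le hn ht) _ _

theorem robustDP_deviate_update_stepIdx (hn : n + 1 ≤ H)
    (μ : Fin S → JointAction A → ℝ) (i : Fin m) (π' : PlayerPolicy S H A i) :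
    robustDP R P₀ r (deviate i π' (Function.update π (stepIdx n hn) μ)) n (Nat.le_of_succ_le hn) =
      robustDP R P₀ r (deviate i π' π) n (Nat.le_of_succ_le hn) :=
  robustDP_congr R P₀ r n _ fun t ht => by
    funext s a
    rw [deviate, deviate, Function.update_of_ne (ne_stepIdx_of_le hn ht)]

variable [NeZero S]

theorem robustDP_nonneg (hR1 : R ≤ 1) (hr : ∀ h s a, 0 ≤ r h s a) (hn : n ≤ H)
    (hπ : IsPolicyOnLast n π) (s : Fin S) : 0 ≤ robustDP R P₀ r π n hn s := by
  induction n generalizing s with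
  | zero => exact le_rfl
  | succ n ih =>
    refine le_wMean (wCompProd_mem_stdSimplex (hπ _ le_rfl s) _) fun x => ?_
    exact (le_ciInf (ih (Nat.le_of_succ_le hn) hπ.pred)).trans (le_robustTarget hR1 (hr _ s) _ x)

theorem ciInf_robustDP_le_succ (hR1 : R ≤ 1) (hr : ∀ h s a, 0 ≤ r h s a) (hn : n + 1 ≤ H)
    (hπ : IsPolicyOnLast (n + 1) π) :
    ⨅ s, robustDP R P₀ r π n (Nat.le_of_succ_le hn) s ≤ ⨅ s, robustDP R P₀ r π (n + 1) hn s :=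
  le_ciInf fun s => le_wMean (wCompProd_mem_stdSimplex (hπ _ le_rfl s) _)
    fun x => le_robustTarget hR1 (hr _ s) _ x

theorem excess_robustDP_succ_le (hR1 : R ≤ 1) (hr : ∀ h s a, 0 ≤ r h s a) (hn : n + 1 ≤ H)
    (hπ : IsPolicyOnLast (n + 1) π) (s : Fin S) :
    excess (robustDP R P₀ r π (n + 1) hn) s ≤
      robustDP R P₀ r π (n + 1) hn s - ⨅ s', robustDP R P₀ r π n (Nat.le_of_succ_le hn) s' :=
  sub_le_sub_left (ciInf_robustDP_le_succ hR1 hr hn hπ) _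

theorem excess_robustDP_le_nat (hR : 0 ≤ R) (hR1 : R ≤ 1) (hr0 : ∀ h s a, 0 ≤ r h s a)
    (hr1 : ∀ h s a, r h s a ≤ 1) (hn : n ≤ H) (hπ : IsPolicyOnLast n π) (s : Fin S) :
    excess (robustDP R P₀ r π n hn) s ≤ n :=
  (sub_le_self _ (le_ciInf (robustDP_nonneg hR1 hr0 hn hπ))).trans
    (robustDP_le hR hR1 hr1 hn hπ s)

-- Contamination shrinks oscillations by `1 - R` at every step, and `1 + (1 - R) / R = 1 / R`.
theorem excess_robustDP_le_of_mul_eq_one (hR1 : R ≤ 1) (hM : 0 ≤ M) (hRM : R * M = 1)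
    (hr0 : ∀ h s a, 0 ≤ r h s a) (hr1 : ∀ h s a, r h s a ≤ 1) (hn : n ≤ H)
    (hπ : IsPolicyOnLast n π) (s : Fin S) : excess (robustDP R P₀ r π n hn) s ≤ M := by
  induction n generalizing s with
  | zero => simpa [excess, robustDP] using hM
  | succ n ih =>
    set V := robustDP R P₀ r π n (Nat.le_of_succ_le hn)
    have hosc (s s' : Fin S) : V s - V s' ≤ M :=
      (sub_le_sub_left (ciInf_le_apply V s') _).trans (ih (Nat.le_of_succ_le hn) hπ.pred s)
    have hle : robustDP R P₀ r π (n + 1) hn s ≤ 1 + (1 - R) * M + ⨅ s', V s' :=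
      wMean_le (wCompProd_mem_stdSimplex (hπ _ le_rfl s) _)
        fun x => robustTarget_le hR1 (hr1 _ s) hosc x
    linarith [excess_robustDP_succ_le (P₀ := P₀) hR1 hr0 hn hπ s]

theorem excess_robustDP_le (hR : 0 ≤ R) (hR1 : R ≤ 1) (hM : 0 ≤ M) (hMR : M = H ∨ R * M = 1)
    (hr0 : ∀ h s a, 0 ≤ r h s a) (hr1 : ∀ h s a, r h s a ≤ 1) (hn : n ≤ H)
    (hπ : IsPolicyOnLast n π) (s : Fin S) : excess (robustDP R P₀ r π n hn) s ≤ M := by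
  rcases hMR with rfl | hRM
  · exact (excess_robustDP_le_nat hR hR1 hr0 hr1 hn hπ s).trans (Nat.cast_le.2 hn)
  · exact excess_robustDP_le_of_mul_eq_one hR1 hM hRM hr0 hr1 hn hπ s

theorem robustDP_add_mul_excess_sq_le (hR : 0 ≤ R) (hR1 : R ≤ 1) (hM : 0 ≤ M)
    (hMR : M = H ∨ R * M = 1) (hr0 : ∀ h s a, 0 ≤ r h s a) (hr1 : ∀ h s a, r h s a ≤ 1)
    (hn : n ≤ H) (hπ : IsPolicyOnLast n π) {l : ℝ} (hl : 0 ≤ l) (s : Fin S) :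
    robustDP R P₀ r π n hn s + l * excess (robustDP R P₀ r π n hn) s ^ 2 ≤ n + n * (l * M) := by
  have hexc := excess_nonneg (robustDP R P₀ r π n hn) s
  have hsq : l * excess (robustDP R P₀ r π n hn) s ^ 2 ≤ n * (l * M) :=
    calc l * excess (robustDP R P₀ r π n hn) s ^ 2
        = l * (excess (robustDP R P₀ r π n hn) s * excess (robustDP R P₀ r π n hn) s) := by ring
      _ ≤ l * (n * M) := by
          gcongr
          exacts [excess_robustDP_le_nat hR hR1 hr0 hr1 hn hπ s,
            excess_robustDP_le hR hR1 hM hMR hr0 hr1 hn hπ s]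
      _ = n * (l * M) := by ring
  linarith [robustDP_le (P₀ := P₀) hR hR1 hr1 hn hπ s]

/-- Range of value estimates for the last `n` steps; the oscillation bound allows the bonus to
double the bound `M` satisfied by the true values. -/
structure ValueRange (M : ℝ) (n : ℕ) (V : Fin m → Fin S → ℝ) : Prop where
  nonneg : ∀ i s, 0 ≤ V i s
  le : ∀ i s, V i s ≤ n
  osc : ∀ i s s', V i s - V i s' ≤ 2 * M

/-- The new value estimates `V'` are, up to the errors `e + x`, within mean-variance bounds of one
step of dynamic programming applied to `V`: for the policy `μ` from above and for all unilateral
deviations from below. The good event of the sampling analysis provides this certificate. -/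
structure StepCert (G : Game m S H A) (R l e : ℝ) (n : ℕ) (hn : n + 1 ≤ H)
    (V V' : Fin m → Fin S → ℝ) (μ : Fin S → JointAction A → ℝ) (x : ℝ) : Prop where
  upper : ∀ i s, V' i s ≤
    wMean (wCompProd (μ s) (G.P0 (stepIdx n hn) s)) (robustTarget (G.r i (stepIdx n hn) s) R (V i))
    + l * wVar (wCompProd (μ s) (G.P0 (stepIdx n hn) s))
      (robustTarget (G.r i (stepIdx n hn) s) R (V i)) + e + x
  lower : ∀ i s (σ : stdSimplex ℝ (Fin (A i))),
    min (wMean (wCompProd (devWeight i σ (μ s)) (G.P0 (stepIdx n hn) s))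
        (robustTarget (G.r i (stepIdx n hn) s) R (V i)) -
      l * wVar (wCompProd (devWeight i σ (μ s)) (G.P0 (stepIdx n hn) s))
        (robustTarget (G.r i (stepIdx n hn) s) R (V i))) (n + 1) - e - x ≤ V' i s

/-- Invariant of the backward recursion after `n` steps, with error `e` per step and accumulated
slack `x`. The quadratic terms in `excess` are what makes the induction close: they absorb the
variances in `StepCert`. -/
structure BackwardInv (G : Game m S H A) (R M l e : ℝ) (n : ℕ) (hn : n ≤ H)
    (V : Fin m → Fin S → ℝ) (π : JointWeights S H A) (x : ℝ) : Prop where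
  policy : IsPolicyOnLast n π
  range : ValueRange M n V
  upper : ∀ i s, V i s ≤ robustDP R G.P0 (G.r i) π n hn s -
    3 * l * excess (robustDP R G.P0 (G.r i) π n hn) s ^ 2 + (n * e + x)
  lower : ∀ i (π' : PlayerPolicy S H A i) s,
    robustDP R G.P0 (G.r i) (deviate i π' π) n hn s +
      3 * l * excess (robustDP R G.P0 (G.r i) (deviate i π' π) n hn) s ^ 2 - (n * e + x) ≤ V i s

section Step

variable {l d : ℝ} {V : Fin S → ℝ}

theorem wMean_add_mul_wVar_le_robustDP_succ (hR : 0 ≤ R) (hR1 : R ≤ 1) (hM : 1 ≤ M)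
    (hMR : M = H ∨ R * M = 1) (hr0 : ∀ h s a, 0 ≤ r h s a) (hr1 : ∀ h s a, r h s a ≤ 1)
    (hn : n + 1 ≤ H) (hπ : IsPolicyOnLast (n + 1) π) (hl0 : 0 ≤ l) (hl : 12 * (l * M) ≤ 1)
    (hV : ∀ s s', V s - V s' ≤ 2 * M)
    (hVle : ∀ s, V s ≤ robustDP R P₀ r π n (Nat.le_of_succ_le hn) s -
      3 * l * excess (robustDP R P₀ r π n (Nat.le_of_succ_le hn)) s ^ 2 + d) (s : Fin S) :
    wMean (wCompProd (π (stepIdx n hn) s) (P₀ (stepIdx n hn) s))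
        (robustTarget (r (stepIdx n hn) s) R V) +
      l * wVar (wCompProd (π (stepIdx n hn) s) (P₀ (stepIdx n hn) s))
        (robustTarget (r (stepIdx n hn) s) R V) ≤
    robustDP R P₀ r π (n + 1) hn s - 3 * l * excess (robustDP R P₀ r π (n + 1) hn) s ^ 2 + d +
      (9 * (l * M) + l) :=
  wMean_add_mul_wVar_robustTarget_le (wCompProd_mem_stdSimplex (hπ _ le_rfl s) _) hR hR1
    (hr0 _ s) (hr1 _ s) hM
    (excess_robustDP_le hR hR1 (by linarith) hMR hr0 hr1 _ hπ.pred)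
    (excess_nonneg _ s) (excess_robustDP_succ_le hR1 hr0 hn hπ s) hl0 hl hV hVle

theorem robustDP_succ_le_wMean_sub_mul_wVar (hR : 0 ≤ R) (hR1 : R ≤ 1) (hM : 1 ≤ M)
    (hMR : M = H ∨ R * M = 1) (hr0 : ∀ h s a, 0 ≤ r h s a) (hr1 : ∀ h s a, r h s a ≤ 1)
    (hn : n + 1 ≤ H) (hπ : IsPolicyOnLast (n + 1) π) (hl0 : 0 ≤ l) (hl : 12 * (l * M) ≤ 1)
    (hV : ∀ s s', V s - V s' ≤ 2 * M)
    (hleV : ∀ s, robustDP R P₀ r π n (Nat.le_of_succ_le hn) s +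
      3 * l * excess (robustDP R P₀ r π n (Nat.le_of_succ_le hn)) s ^ 2 - d ≤ V s) (s : Fin S) :
    robustDP R P₀ r π (n + 1) hn s + 3 * l * excess (robustDP R P₀ r π (n + 1) hn) s ^ 2 - d -
      (9 * (l * M) + l) ≤
    wMean (wCompProd (π (stepIdx n hn) s) (P₀ (stepIdx n hn) s))
        (robustTarget (r (stepIdx n hn) s) R V) -
      l * wVar (wCompProd (π (stepIdx n hn) s) (P₀ (stepIdx n hn) s))
        (robustTarget (r (stepIdx n hn) s) R V) :=
  le_wMean_sub_mul_wVar_robustTarget (wCompProd_mem_stdSimplex (hπ _ le_rfl s) _) hR hR1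
    (hr0 _ s) (hr1 _ s) hM
    (excess_robustDP_le hR hR1 (by linarith) hMR hr0 hr1 _ hπ.pred)
    (excess_nonneg _ s) (excess_robustDP_succ_le hR1 hr0 hn hπ s) hl0 hl hV hleV

end Step

namespace BackwardInv

variable {G : Game m S H A} {l e x y : ℝ}

section Succ

variable {V V' : Fin m → Fin S → ℝ} {μ : Fin S → JointAction A → ℝ}

theorem upper_succ (hR : 0 ≤ R) (hR1 : R ≤ 1) (hM : 1 ≤ M) (hMR : M = H ∨ R * M = 1)
    (hl0 : 0 ≤ l) (hl : 12 * (l * M) ≤ 1) (hn : n + 1 ≤ H)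
    (h : BackwardInv G R M l (9 * (l * M) + l + e) n (Nat.le_of_succ_le hn) V π x)
    (hcert : StepCert G R l e n hn V V' μ y)
    (hπ : IsPolicyOnLast (n + 1) (Function.update π (stepIdx n hn) μ)) (i : Fin m) (s : Fin S) :
    V' i s ≤ robustDP R G.P0 (G.r i) (Function.update π (stepIdx n hn) μ) (n + 1) hn s -
      3 * l * excess (robustDP R G.P0 (G.r i) (Function.update π (stepIdx n hn) μ) (n + 1) hn) s ^ 2
      + ((n + 1 : ℕ) * (9 * (l * M) + l + e) + (x + y)) := by
  have hup := h.upper i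
  rw [← robustDP_update_stepIdx hn μ] at hup
  have hstep := wMean_add_mul_wVar_le_robustDP_succ hR hR1 hM hMR (G.r_nonneg i) (G.r_le_one i)
    hn hπ hl0 hl (h.range.osc i) hup s
  have hV' := hcert.upper i s
  rw [Function.update_self] at hstep
  push_cast
  linarith

theorem lower_succ (hR : 0 ≤ R) (hR1 : R ≤ 1) (hM : 1 ≤ M) (hMR : M = H ∨ R * M = 1)
    (hl0 : 0 ≤ l) (hl : 12 * (l * M) ≤ 1) (he : 0 ≤ e) (hn : n + 1 ≤ H) (hx : 0 ≤ x)
    (h : BackwardInv G R M l (9 * (l * M) + l + e) n (Nat.le_of_succ_le hn) V π x)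
    (hcert : StepCert G R l e n hn V V' μ y)
    (hπ : IsPolicyOnLast (n + 1) (Function.update π (stepIdx n hn) μ)) (i : Fin m)
    (π' : PlayerPolicy S H A i) (s : Fin S) :
    robustDP R G.P0 (G.r i) (deviate i π' (Function.update π (stepIdx n hn) μ)) (n + 1) hn s +
      3 * l * excess (robustDP R G.P0 (G.r i) (deviate i π' (Function.update π (stepIdx n hn) μ))
        (n + 1) hn) s ^ 2 - ((n + 1 : ℕ) * (9 * (l * M) + l + e) + (x + y)) ≤ V' i s := by
  have hlow := h.lower i π'
  rw [← robustDP_deviate_update_stepIdx hn μ i π'] at hlow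
  have hdev := hπ.deviate i π'
  have hstep := robustDP_succ_le_wMean_sub_mul_wVar hR hR1 hM hMR (G.r_nonneg i) (G.r_le_one i)
    hn hdev hl0 hl (h.range.osc i) hlow s
  have htrunc := robustDP_add_mul_excess_sq_le (P₀ := G.P0) hR hR1 (by linarith) hMR
    (G.r_nonneg i) (G.r_le_one i) hn hdev (by positivity : 0 ≤ 3 * l) s
  have hpolicy : deviate i π' (Function.update π (stepIdx n hn) μ) (stepIdx n hn) s =
      devWeight i (π' (stepIdx n hn) s) (μ s) := by
    funext a
    rw [deviate, devWeight, Function.update_self]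
  rw [hpolicy] at hstep
  push_cast at htrunc ⊢
  have hlM : 0 ≤ l * M := by positivity
  have hnlM : 0 ≤ n * (l * M) := by positivity
  have hnl : 0 ≤ n * l := by positivity
  have hne : 0 ≤ n * e := by positivity
  have hmin := le_min (b := (n : ℝ) + 1) hstep (by linarith)
  linarith [hcert.lower i s (π' (stepIdx n hn) s)]

theorem step (hR : 0 ≤ R) (hR1 : R ≤ 1) (hM : 1 ≤ M) (hMR : M = H ∨ R * M = 1)
    (hl0 : 0 ≤ l) (hl : 12 * (l * M) ≤ 1) (he : 0 ≤ e) (hn : n + 1 ≤ H) (hx : 0 ≤ x)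
    (h : BackwardInv G R M l (9 * (l * M) + l + e) n (Nat.le_of_succ_le hn) V π x)
    (hcert : StepCert G R l e n hn V V' μ y) (hV' : ValueRange M (n + 1) V')
    (hμ : ∀ s, μ s ∈ stdSimplex ℝ (JointAction A)) :
    BackwardInv G R M l (9 * (l * M) + l + e) (n + 1) hn V'
      (Function.update π (stepIdx n hn) μ) (x + y) :=
  have hπ := h.policy.update hn hμ
  ⟨hπ, hV', upper_succ hR hR1 hM hMR hl0 hl hn h hcert hπ,
    lower_succ hR hR1 hM hMR hl0 hl he hn hx h hcert hπ⟩

end Succ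

theorem isRobustCCE (hR : 0 ≤ R) (hR1 : R ≤ 1) (hl0 : 0 ≤ l) {V : Fin m → Fin S → ℝ} {ε : ℝ}
    (h : BackwardInv G R M l e H le_rfl V π x) (hε : 2 * (H * e + x) ≤ ε) (hε0 : 0 ≤ ε) :
    IsRobustCCE G R ε π := by
  have hπ : IsJointPolicy π := fun t s => h.policy t (by simp) s
  refine ⟨hπ, Real.iSup_le (fun s => Real.iSup_le (fun i => ?_) hε0) hε0⟩
  have hvalue := robustValue_eq_robustDP G hR hR1 i hπ s
  have hvalue_nonneg : 0 ≤ robustValue G R i π s :=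
    hvalue ▸ robustDP_nonneg hR1 (G.r_nonneg i) le_rfl h.policy s
  rw [sub_le_iff_le_add]
  refine Real.iSup_le (fun π' => ?_) (by linarith)
  have hdev : IsJointPolicy (deviate i π' π) := fun t s => h.policy.deviate i π' t (by simp) s
  rw [robustValue_eq_robustDP G hR hR1 i hdev s, hvalue]
  have hsq : 0 ≤ 3 * l * excess (robustDP R G.P0 (G.r i) π H le_rfl) s ^ 2 := by positivity
  have hsq_dev : 0 ≤ 3 * l * excess (robustDP R G.P0 (G.r i) (deviate i π' π) H le_rfl) s ^ 2 := by
    positivity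
  linarith [h.upper i s, h.lower i π' s]

end BackwardInv

end Backward

/-! ### Expectations under probability mass functions -/

section Expectation

variable {α β : Type*}

/-- The expectation of a function with values in `[0, ∞]`. Written as a sum, it needs no
measurable structure on the sample spaces. -/
def pmfMean (p : PMF α) (g : α → ENNReal) : ENNReal := ∑' a, p a * g a

theorem pmfMean_mono_support (p : PMF α) {g g' : α → ENNReal} (h : ∀ a ∈ p.support, g a ≤ g' a) :
    pmfMean p g ≤ pmfMean p g' := by
  refine ENNReal.tsum_le_tsum fun a => ?_
  by_cases ha : p a = 0
  · simp [ha]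
  · exact mul_le_mul_right (h a ((p.mem_support_iff a).2 ha)) _

theorem pmfMean_mono (p : PMF α) {g g' : α → ENNReal} (h : ∀ a, g a ≤ g' a) :
    pmfMean p g ≤ pmfMean p g' :=
  pmfMean_mono_support p fun a _ => h a

theorem pmfMean_const (p : PMF α) (c : ENNReal) : pmfMean p (fun _ => c) = c := by
  rw [pmfMean, ENNReal.tsum_mul_right, p.tsum_coe, one_mul]

theorem pmfMean_add (p : PMF α) (g g' : α → ENNReal) :
    pmfMean p (fun a => g a + g' a) = pmfMean p g + pmfMean p g' := by
  simp only [pmfMean, mul_add, ENNReal.tsum_add]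

theorem pmfMean_mul_left (p : PMF α) (c : ENNReal) (g : α → ENNReal) :
    pmfMean p (fun a => c * g a) = c * pmfMean p g := by
  simp only [pmfMean, mul_left_comm _ c, ENNReal.tsum_mul_left]

theorem pmfMean_pure (a : α) (g : α → ENNReal) : pmfMean (PMF.pure a) g = g a := by
  rw [pmfMean, tsum_eq_single a fun b hb => by simp [hb]]
  simp

theorem pmfMean_bind (p : PMF α) (q : α → PMF β) (g : β → ENNReal) :
    pmfMean (p.bind q) g = pmfMean p fun a => pmfMean (q a) g := by
  simp only [pmfMean, PMF.bind_apply, ← ENNReal.tsum_mul_right, ← ENNReal.tsum_mul_left, mul_assoc]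
  exact ENNReal.tsum_comm

theorem pmfMean_map (p : PMF α) (f : α → β) (g : β → ENNReal) :
    pmfMean (p.map f) g = pmfMean p fun a => g (f a) := by
  simp only [PMF.map, pmfMean_bind, Function.comp_apply, pmfMean_pure]

theorem toOuterMeasure_eq_pmfMean (p : PMF α) (s : Set α) :
    p.toOuterMeasure s = pmfMean p (s.indicator 1) := by
  rw [PMF.toOuterMeasure_apply, pmfMean]
  refine tsum_congr fun a => ?_
  by_cases h : a ∈ s <;> simp [h]

theorem toOuterMeasure_add_compl (p : PMF α) (s : Set α) :
    p.toOuterMeasure s + p.toOuterMeasure sᶜ = 1 := by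
  rw [toOuterMeasure_eq_pmfMean, toOuterMeasure_eq_pmfMean, ← pmfMean_add, ← pmfMean_const p 1]
  exact congrArg (pmfMean p) (Set.indicator_self_add_compl s (1 : α → ENNReal))

end Expectation

section PmfWeight

variable {α β : Type}

/-- The real weights of a probability mass function, which connect the laws of the samples with
the finite means `wMean` and variances `wVar`. -/
def pmfWeight (p : PMF α) (a : α) : ℝ := (p a).toReal

theorem pmfWeight_mem_stdSimplex [Fintype α] (p : PMF α) : pmfWeight p ∈ stdSimplex ℝ α := by
  refine ⟨fun a => ENNReal.toReal_nonneg, ?_⟩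
  have hsum := p.tsum_coe
  rw [tsum_fintype] at hsum
  simp only [pmfWeight]
  rw [← ENNReal.toReal_sum fun a _ => p.apply_ne_top a, hsum, ENNReal.toReal_one]

theorem pmfMean_ofReal [Fintype α] (p : PMF α) {g : α → ℝ} (hg : ∀ a, 0 ≤ g a) :
    pmfMean p (fun a => ENNReal.ofReal (g a)) = ENNReal.ofReal (wMean (pmfWeight p) g) := by
  have hnonneg : ∀ a, 0 ≤ pmfWeight p a := (pmfWeight_mem_stdSimplex p).1
  rw [pmfMean, tsum_fintype, wMean,
    ENNReal.ofReal_sum_of_nonneg fun a _ => mul_nonneg (hnonneg a) (hg a)]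
  refine Finset.sum_congr rfl fun a _ => ?_
  rw [ENNReal.ofReal_mul (hnonneg a), pmfWeight, ENNReal.ofReal_toReal (p.apply_ne_top a)]

theorem pmfWeight_map [Fintype α] [DecidableEq β] (p : PMF α) (f : α → β) (b : β) :
    pmfWeight (p.map f) b = ∑ a, if b = f a then pmfWeight p a else 0 := by
  classical
  rw [pmfWeight, PMF.map_apply, tsum_fintype, ENNReal.toReal_sum fun a _ => by
    split_ifs <;> simp [p.apply_ne_top]]
  exact Finset.sum_congr rfl fun a _ => by split_ifs <;> rfl

theorem wMean_pmfWeight_map [Fintype α] [Fintype β] (p : PMF α) (f : α → β) (g : β → ℝ) :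
    wMean (pmfWeight (p.map f)) g = wMean (pmfWeight p) fun a => g (f a) := by
  classical
  simp only [wMean, pmfWeight_map, Finset.sum_mul, ite_mul, zero_mul]
  rw [Finset.sum_comm]
  simp only [Finset.sum_ite_eq', Finset.mem_univ, if_true]

theorem pmfWeight_pure [Fintype α] [DecidableEq α] (a : α) :
    pmfWeight (PMF.pure a) = stdSimplex.vertex (S := ℝ) a := by
  funext b
  rw [pmfWeight, PMF.pure_apply, stdSimplex.vertex_coe, Pi.single_apply]
  split_ifs <;> simp

theorem pmfWeight_simplexPMF [Fintype α] (p : stdSimplex ℝ α) : pmfWeight (simplexPMF p) = p :=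
  funext fun a => ENNReal.toReal_ofReal (p.2.1 a)

theorem pmfWeight_bind_map_prodMk (p : PMF α) (q : α → PMF β) (x : α × β) :
    pmfWeight (p.bind fun a => (q a).map (Prod.mk a)) x =
      pmfWeight p x.1 * pmfWeight (q x.1) x.2 := by
  obtain ⟨a, b⟩ := x
  have hne (a' : α) (ha : a' ≠ a) : (q a').map (Prod.mk a') (a, b) = 0 := by
    simp [PMF.map_apply, ha.symm]
  have heq : (q a).map (Prod.mk a) (a, b) = q a b := by
    rw [PMF.map_apply, tsum_eq_single b fun b' hb => by simp [hb.symm]]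
    simp
  rw [pmfWeight, PMF.bind_apply, tsum_eq_single a fun a' ha => by rw [hne a' ha, mul_zero], heq,
    ENNReal.toReal_mul]
  rfl

variable {ι : Type} [Fintype ι] [DecidableEq ι] {γ : ι → Type} [∀ i, Fintype (γ i)]

theorem indepPMF_apply (p : ∀ i, PMF (γ i)) (x : ∀ i, γ i) : indepPMF p x = ∏ i, p i (x i) := rfl

theorem pmfWeight_indepPMF (p : ∀ i, PMF (γ i)) (x : ∀ i, γ i) :
    pmfWeight (indepPMF p) x = ∏ i, pmfWeight (p i) (x i) :=
  ENNReal.toReal_prod Finset.univ _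

theorem indepPMF_map_eval (p : ∀ i, PMF (γ i)) (i : ι) :
    (indepPMF p).map (fun x => x i) = p i := by
  classical
  ext b
  simp only [PMF.map_apply, tsum_fintype, indepPMF_apply, ← Finset.sum_filter]
  set t : ∀ j, Finset (γ j) := Function.update (fun _ => Finset.univ) i {b} with ht
  have hfilter : ({x | b = x i} : Finset (∀ j, γ j)) = Fintype.piFinset t := by
    rw [ht, Fintype.piFinset_update_singleton_eq_filter_piFinset_eq (fun _ => Finset.univ) i
        (Finset.mem_univ b),
      Fintype.piFinset_univ]
    simp only [eq_comm]
  rw [hfilter, ← Finset.prod_univ_sum, Fintype.prod_eq_single i]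
  · rw [ht, Function.update_self, Finset.sum_singleton]
  · intro j hj
    rw [ht, Function.update_of_ne hj, ← tsum_fintype (L := .unconditional _)]
    exact (p j).tsum_coe

end PmfWeight

/-! ### Product weights on joint actions -/

section Mixture

variable {ι κ Y : Type} [DecidableEq ι] {α : ι → Type} [Fintype κ]

theorem devWeight_mixture (i : ι) [Fintype (α i)] (σ : stdSimplex ℝ (α i)) (w : κ → ℝ)
    (μ : κ → (∀ j, α j) → ℝ) :
    devWeight i σ (fun a => ∑ k, w k * μ k a) = fun a => ∑ k, w k * devWeight i σ (μ k) a := by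
  funext a
  simp only [devWeight]
  rw [Finset.sum_comm, Finset.mul_sum]
  refine Finset.sum_congr rfl fun k _ => ?_
  rw [← Finset.mul_sum, mul_left_comm]

theorem wCompProd_mixture {X : Type} [Fintype Y] (w : κ → ℝ) (μ : κ → X → ℝ)
    (P : X → stdSimplex ℝ Y) :
    wCompProd (fun a => ∑ k, w k * μ k a) P = fun x => ∑ k, w k * wCompProd (μ k) P x := by
  funext x
  simp only [wCompProd, Finset.sum_mul, mul_assoc]

end Mixture

section ProductWeights

variable {ι : Type} [Fintype ι] [DecidableEq ι] {α : ι → Type} {Y : Type}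

/-- The weights of a joint action of independent players with laws `p j`. -/
def prodWeight [∀ i, Fintype (α i)] (p : ∀ j, stdSimplex ℝ (α j)) (a : ∀ j, α j) : ℝ :=
  ∏ j, p j (a j)

section

variable [∀ i, Fintype (α i)] (p : ∀ j, stdSimplex ℝ (α j)) (i : ι)

theorem prodWeight_mem_stdSimplex : prodWeight p ∈ stdSimplex ℝ (∀ j, α j) := by
  refine ⟨fun a => Finset.prod_nonneg fun j _ => (p j).2.1 _, ?_⟩
  simp only [prodWeight]
  rw [← Fintype.piFinset_univ, ← Finset.prod_univ_sum]
  exact Finset.prod_eq_one fun j _ => stdSimplex.sum_eq_one _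

theorem prodWeight_update (σ : stdSimplex ℝ (α i)) (a : ∀ j, α j) :
    prodWeight (Function.update p i σ) a = σ (a i) * ∏ j ∈ Finset.univ.erase i, p j (a j) := by
  rw [prodWeight, ← Finset.mul_prod_erase _ _ (Finset.mem_univ i), Function.update_self]
  congr 1
  exact Finset.prod_congr rfl fun j hj => by rw [Function.update_of_ne (Finset.ne_of_mem_erase hj)]

theorem prodWeight_apply_update (a : ∀ j, α j) (b : α i) :
    prodWeight p (Function.update a i b) = p i b * ∏ j ∈ Finset.univ.erase i, p j (a j) := by
  rw [prodWeight, ← Finset.mul_prod_erase _ _ (Finset.mem_univ i), Function.update_self]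
  congr 1
  exact Finset.prod_congr rfl fun j hj => by rw [Function.update_of_ne (Finset.ne_of_mem_erase hj)]

theorem devWeight_prodWeight (σ : stdSimplex ℝ (α i)) :
    devWeight i σ (prodWeight p) = prodWeight (Function.update p i σ) := by
  funext a
  simp only [devWeight, prodWeight_apply_update, ← Finset.sum_mul, stdSimplex.sum_eq_one, one_mul,
    prodWeight_update]

variable [∀ j, DecidableEq (α j)]

theorem prodWeight_update_eq_mixture (σ : stdSimplex ℝ (α i)) :
    prodWeight (Function.update p i σ) =
      fun a => ∑ b, σ b * prodWeight (Function.update p i (stdSimplex.vertex b)) a := by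
  funext a
  simp only [prodWeight_update, stdSimplex.vertex_coe, Pi.single_apply, ite_mul, one_mul, zero_mul,
    mul_ite, mul_zero, Finset.sum_ite_eq, Finset.mem_univ, if_true]

variable [Fintype Y] (P : (∀ j, α j) → stdSimplex ℝ Y)

/-- The law of the joint action and of an outcome with law `P`, when player `i` plays `a` and the
others independently follow `p`. -/
def ownWeight (a : α i) : (∀ j, α j) × Y → ℝ :=
  wCompProd (prodWeight (Function.update p i (stdSimplex.vertex a))) P

theorem ownWeight_mem_stdSimplex (a : α i) :
    ownWeight p i P a ∈ stdSimplex ℝ ((∀ j, α j) × Y) :=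
  wCompProd_mem_stdSimplex (prodWeight_mem_stdSimplex _) _

end

variable [Fintype Y] [∀ i, Fintype (α i)] [∀ j, DecidableEq (α j)]
  (p : ∀ j, stdSimplex ℝ (α j)) (i : ι) (P : (∀ j, α j) → stdSimplex ℝ Y)

theorem wCompProd_update_eq_mixture (σ : stdSimplex ℝ (α i)) :
    wCompProd (prodWeight (Function.update p i σ)) P =
      fun x => ∑ a, σ a * ownWeight p i P a x := by
  rw [prodWeight_update_eq_mixture, wCompProd_mixture]
  rfl

theorem wCompProd_prodWeight_eq_mixture :
    wCompProd (prodWeight p) P = fun x => ∑ a, p i a * ownWeight p i P a x := by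
  rw [← wCompProd_update_eq_mixture, Function.update_eq_self]

end ProductWeights

section Draws

variable {m S H : ℕ} {A : Fin m → ℕ} (G : Game m S H A) (h : Fin H)
  (p : ∀ j, Fin S → stdSimplex ℝ (Fin (A j))) (i : Fin m) (s : Fin S) (b : Fin (A i))

theorem pmfWeight_sampleLaw :
    pmfWeight (sampleLaw G h p i s b) = ownWeight (fun j => p j s) i (G.P0 h s) b := by
  have hlaw (j : Fin m) :
      pmfWeight (Function.update (fun j => simplexPMF (p j s)) i (PMF.pure b) j) =
        Function.update (fun j => p j s) i (stdSimplex.vertex b) j := by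
    rcases eq_or_ne j i with rfl | hj
    · rw [Function.update_self, Function.update_self, pmfWeight_pure]
    · rw [Function.update_of_ne hj, Function.update_of_ne hj, pmfWeight_simplexPMF]
  funext x
  rw [sampleLaw, pmfWeight_bind_map_prodMk, pmfWeight_indepPMF, pmfWeight_simplexPMF]
  simp only [hlaw]
  rfl

theorem drawLaw_map_eval : (drawLaw G h p).map (fun d => d i s b) = sampleLaw G h p i s b := by
  have heval : (fun d : Draw S A => d i s b) =
      (fun z => z b) ∘ (fun y : Fin S → Fin (A i) → JointAction A × Fin S => y s) ∘
        (fun d : Draw S A => d i) := rfl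
  rw [heval, ← PMF.map_comp, ← PMF.map_comp, drawLaw]
  erw [indepPMF_map_eval, indepPMF_map_eval, indepPMF_map_eval]

theorem wMean_drawLaw (g : JointAction A × Fin S → ℝ) :
    wMean (pmfWeight (drawLaw G h p)) (fun d => g (d i s b)) =
      wMean (ownWeight (fun j => p j s) i (G.P0 h s) b) g := by
  rw [← pmfWeight_sampleLaw, ← drawLaw_map_eval, wMean_pmfWeight_map]

end Draws

/-! ### The exponential supermartingale -/

theorem prod_take_snoc {D M : Type*} [CommMonoid M] {K : ℕ} (f : (k : ℕ) → (Fin k → D) → D → M)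
    (x : Fin K → D) (d : D) :
    ∏ k : Fin (K + 1), f k (Fin.take k k.isLt.le (Fin.snoc (α := fun _ => D) x d))
        (Fin.snoc (α := fun _ => D) x d k) =
      (∏ k : Fin K, f k (Fin.take k k.isLt.le x) (x k)) * f K x d := by
  have htake (k : ℕ) (hk : k ≤ K) :
      Fin.take k (hk.trans K.le_succ) (Fin.snoc (α := fun _ => D) x d) = Fin.take k hk x := by
    funext j
    exact Fin.snoc_castSucc (α := fun _ => D) d x (Fin.castLE hk j)
  rw [Fin.prod_univ_castSucc, Fin.snoc_last]
  refine congrArg₂ _ (Finset.prod_congr rfl fun k _ => ?_)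
    (congrArg (f K · d) (htake K le_rfl))
  rw [Fin.snoc_castSucc]
  exact congrArg (f k · (x k)) (htake k k.isLt.le)

theorem pmfMean_roundsLaw_prod_le {m S H : ℕ} {A : Fin m → ℕ} [∀ i, NeZero (A i)]
    (G : Game m S H A) (R : ℝ) (α η : ℕ → ℝ) (h : Fin H) (V : Fin m → Fin S → ℝ)
    (f : (k : ℕ) → (Fin k → Draw S A) → Draw S A → ENNReal) (K : ℕ)
    (hf : ∀ k < K, ∀ D, pmfMean (drawLaw G h (ftrlPolicy G R α η h V k D)) (f k D) ≤ 1) :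
    pmfMean (roundsLaw G R α η h V K)
      (fun D => ∏ k : Fin K, f k (Fin.take k k.isLt.le D) (D k)) ≤ 1 := by
  induction K with
  | zero => simp [roundsLaw, pmfMean_pure]
  | succ K ih =>
    rw [roundsLaw, pmfMean_bind]
    refine le_trans (pmfMean_mono _ fun D => ?_) (ih fun k hk => hf k (hk.trans K.lt_succ_self))
    simp only [pmfMean_map, prod_take_snoc]
    rw [pmfMean_mul_left]
    exact mul_le_of_le_one_right' (hf K K.lt_succ_self D)

/-! ### Exponential moments of one round -/

section OneRound

variable {Ω : Type} [Fintype Ω] {W : Ω → ℝ}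

theorem wMean_exp_sub_const_le_one (hW : W ∈ stdSimplex ℝ Ω) {f : Ω → ℝ} {c : ℝ}
    (hf : ∀ ω, f ω ≤ 1) (hc : wMean W f + wMean W (fun ω => f ω ^ 2) ≤ c) :
    wMean W (fun ω => Real.exp (f ω - c)) ≤ 1 := by
  simp only [sub_eq_neg_add, Real.exp_add]
  rw [wMean_mul_left, Real.exp_neg, inv_mul_le_one₀ (Real.exp_pos _)]
  exact (wMean_exp_le hW hf).trans (Real.exp_le_exp.2 hc)

theorem wMean_exp_centered_le_one (hW : W ∈ stdSimplex ℝ Ω) {q : Ω → ℝ} {t : ℝ}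
    (ht : ∀ ω, t * (wMean W q - q ω) ≤ 1) :
    wMean W (fun ω => Real.exp (t * (wMean W q - q ω) - t ^ 2 * wVar W q)) ≤ 1 := by
  refine wMean_exp_sub_const_le_one hW ht (le_of_eq ?_)
  have hcenter : wMean W (fun ω => t * (wMean W q - q ω)) = 0 := by
    rw [wMean_mul_left, wMean_sub, wMean_const hW, sub_self, mul_zero]
  rw [hcenter, zero_add, wVar_eq_wMean_sub_sq hW, ← wMean_mul_left]
  refine congrArg _ (funext fun ω => ?_)
  ring

/-- The bound `(x + y) ^ 2 ≤ 2 * x ^ 2 + 2 * y ^ 2` decouples `X` and `Y`, and `Y ≤ B ^ 2` turns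
the square of `Y` into a multiple of `Y`. -/
theorem wMean_exp_centered_add_le_one (hW : W ∈ stdSimplex ℝ Ω) {X Y : Ω → ℝ} {B T t c b : ℝ}
    (hX : ∀ ω, X ω - wMean W X ≤ B) (hXT : wVar W X ≤ T)
    (hY0 : ∀ ω, 0 ≤ Y ω) (hYB : ∀ ω, Y ω ≤ B ^ 2) (hYT : wMean W Y ≤ T)
    (ht : 0 ≤ t) (hc : 0 ≤ c) (htc : t * B + t * c * B ^ 2 ≤ 1)
    (hb : c + 2 * t + 2 * t * c ^ 2 * B ^ 2 ≤ b) :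
    wMean W (fun ω => Real.exp (t * (X ω - wMean W X) + t * c * Y ω - t * b * T)) ≤ 1 := by
  refine wMean_exp_sub_const_le_one hW (fun ω => ?_) ?_
  · have hXω : t * (X ω - wMean W X) ≤ t * B := mul_le_mul_of_nonneg_left (hX ω) ht
    have hYω : t * c * Y ω ≤ t * c * B ^ 2 := mul_le_mul_of_nonneg_left (hYB ω) (mul_nonneg ht hc)
    linarith
  have hmean : wMean W (fun ω => t * (X ω - wMean W X) + t * c * Y ω) ≤ t * c * T := by
    rw [wMean_add, wMean_mul_left, wMean_mul_left, wMean_sub, wMean_const hW, sub_self, mul_zero,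
      zero_add]
    exact mul_le_mul_of_nonneg_left hYT (mul_nonneg ht hc)
  have hsq (ω : Ω) : (t * (X ω - wMean W X) + t * c * Y ω) ^ 2 ≤
      2 * t ^ 2 * (X ω - wMean W X) ^ 2 + 2 * (t * c) ^ 2 * B ^ 2 * Y ω := by
    have hYsq : (t * c) ^ 2 * Y ω ^ 2 ≤ (t * c) ^ 2 * (B ^ 2 * Y ω) :=
      mul_le_mul_of_nonneg_left (by nlinarith [hY0 ω, hYB ω]) (sq_nonneg _)
    nlinarith [sq_nonneg (t * (X ω - wMean W X) - t * c * Y ω)]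
  have hmeanSq : wMean W (fun ω => (t * (X ω - wMean W X) + t * c * Y ω) ^ 2) ≤
      2 * t ^ 2 * T + 2 * (t * c) ^ 2 * B ^ 2 * T := by
    refine (wMean_mono hW hsq).trans ?_
    rw [wMean_add, wMean_mul_left, wMean_mul_left, ← wVar_eq_wMean_sub_sq hW]
    gcongr
  have hT : 0 ≤ T := (wVar_nonneg hW X).trans hXT
  have hbT := mul_le_mul_of_nonneg_right hb (mul_nonneg ht hT)
  linarith

theorem wMean_comm {X : Type} [Fintype X] (W : Ω → ℝ) (π : X → ℝ) (q : Ω → X → ℝ) :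
    wMean W (fun ω => wMean π (q ω)) = wMean π (fun a => wMean W fun ω => q ω a) := by
  simp only [wMean, Finset.mul_sum]
  rw [Finset.sum_comm]
  exact Finset.sum_congr rfl fun a _ => Finset.sum_congr rfl fun ω _ => by ring

section RandomTable

variable {X Y : Type} [Fintype X] [Fintype Y] {π : X → ℝ} {q : Ω → X → ℝ} {P : X → Y → ℝ}
  {g : Y → ℝ}

theorem wVar_wMean_le (hW : W ∈ stdSimplex ℝ Ω) (hπ : π ∈ stdSimplex ℝ X) :
    wVar W (fun ω => wMean π (q ω)) ≤ wMean π fun a => wVar W fun ω => q ω a := by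
  have hjensen (ω : Ω) : (wMean π (q ω) - wMean π fun a => wMean W fun ω' => q ω' a) ^ 2 ≤
      wMean π fun a => (q ω a - wMean W fun ω' => q ω' a) ^ 2 := by
    rw [← wMean_sub]
    exact sq_wMean_le hπ _
  rw [wVar_eq_wMean_sub_sq hW, wMean_comm]
  refine (wMean_mono hW hjensen).trans (le_of_eq ?_)
  rw [wMean_comm W π fun ω a => (q ω a - wMean W fun ω' => q ω' a) ^ 2]
  exact congrArg _ (funext fun a => (wVar_eq_wMean_sub_sq hW _).symm)

theorem wMean_wVar_le (hW : W ∈ stdSimplex ℝ Ω)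
    (hq : ∀ a, wMean W (fun ω => q ω a) = wMean (P a) g)
    (hqsq : ∀ a, wMean W (fun ω => q ω a ^ 2) = wMean (P a) fun y => g y ^ 2) :
    wMean W (fun ω => wVar π (q ω)) ≤ wVar (fun y => ∑ a, π a * P a y) g := by
  have hjensen := sq_wMean_le hW fun ω => wMean π (q ω)
  simp only [wMean_comm, hq] at hjensen
  simp only [wVar]
  rw [wMean_sub, wMean_comm W π fun ω a => q ω a ^ 2]
  simp only [hqsq, wMean_mixture]
  linarith

theorem wMean_exp_mean_add_var_le_one (hW : W ∈ stdSimplex ℝ Ω) (hπ : π ∈ stdSimplex ℝ X)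
    (hq : ∀ a, wMean W (fun ω => q ω a) = wMean (P a) g)
    (hqsq : ∀ a, wMean W (fun ω => q ω a ^ 2) = wMean (P a) fun y => g y ^ 2)
    {lo hi B t c b : ℝ} (hlo : ∀ ω a, lo ≤ q ω a) (hhi : ∀ ω a, q ω a ≤ hi) (hB : hi - lo ≤ B)
    (ht : 0 ≤ t) (hc : 0 ≤ c) (htc : t * B + t * c * B ^ 2 ≤ 1)
    (hb : c + 2 * t + 2 * t * c ^ 2 * B ^ 2 ≤ b) :
    wMean W (fun ω => Real.exp (t * (wMean π (q ω) - wMean π (fun a => wMean (P a) g))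
      + t * c * wVar π (q ω) - t * b * wVar (fun y => ∑ a, π a * P a y) g)) ≤ 1 := by
  have hmean : wMean π (fun a => wMean (P a) g) = wMean W fun ω => wMean π (q ω) := by
    simp only [wMean_comm, hq]
  have hcenter (ω : Ω) : wMean π (q ω) - wMean W (fun ω => wMean π (q ω)) ≤ B := by
    have hle : wMean π (q ω) ≤ hi := wMean_le hπ (hhi ω)
    have hge : lo ≤ wMean W fun ω => wMean π (q ω) := le_wMean hW fun ω => le_wMean hπ (hlo ω)
    linarith
  have hvarB (ω : Ω) : wVar π (q ω) ≤ B ^ 2 := by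
    obtain ⟨a⟩ := nonempty_of_mem_stdSimplex hπ
    exact (wVar_le_sq hπ (hlo ω) (hhi ω)).trans
      (pow_le_pow_left₀ (by linarith [hlo ω a, hhi ω a]) hB 2)
  have hvar : wVar W (fun ω => wMean π (q ω)) ≤ wVar (fun y => ∑ a, π a * P a y) g := by
    refine (wVar_wMean_le hW hπ).trans (le_trans (le_of_eq ?_) (wMean_wVar_le_wVar_mixture hπ P g))
    simp only [wVar, hq, hqsq]
  rw [hmean]
  exact wMean_exp_centered_add_le_one hW hcenter hvar (fun ω => wVar_nonneg hπ _) hvarB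
    (wMean_wVar_le hW hq hqsq) ht hc htc hb

end RandomTable

end OneRound

/-! ### One step of the algorithm -/

section Step

variable {m S H : ℕ} {A : Fin m → ℕ}

section Estimate

variable {G : Game m S H A} {R : ℝ} {V : Fin m → Fin S → ℝ} (hR1 : R ≤ 1) (h : Fin H)
  (d : Draw S A) (i : Fin m) (s : Fin S) (a : Fin (A i))
include hR1

theorem le_qEst : ⨅ s', V i s' ≤ qEst G R h V d i s a :=
  le_robustTarget hR1 (G.r_nonneg i h s) (V i) (d i s a)

theorem qEst_le {B : ℝ} (hV : ∀ s s', V i s - V i s' ≤ B) :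
    qEst G R h V d i s a ≤ 1 + (1 - R) * B + ⨅ s', V i s' :=
  robustTarget_le hR1 (G.r_le_one i h s) hV (d i s a)

end Estimate

variable [∀ i, NeZero (A i)]

section MixedPolicy

variable (G : Game m S H A) (R : ℝ) (α η : ℕ → ℝ) (h : Fin H) (V : Fin m → Fin S → ℝ) {K : ℕ}
  (D : Fin K → Draw S A) (s : Fin S)

theorem mixedPolicy_mem_stdSimplex {c : ℝ} (hc : 0 < c) (hK : K ≠ 0) :
    mixedPolicy G R (harmStep c) η h V D s ∈ stdSimplex ℝ (JointAction A) :=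
  mixture_mem_stdSimplex (mixWeight_harmStep_mem_stdSimplex hc hK)
    fun k => prodWeight_mem_stdSimplex fun i => usedPolicy G R (harmStep c) η h V D k i s

theorem wCompProd_mixedPolicy :
    wCompProd (mixedPolicy G R α η h V D s) (G.P0 h s) = fun x => ∑ k : Fin K,
      mixWeight α K (k + 1) *
        wCompProd (prodWeight fun j => usedPolicy G R α η h V D k j s) (G.P0 h s) x :=
  wCompProd_mixture _ _ _

theorem devWeight_mixedPolicy (i : Fin m) (σ : stdSimplex ℝ (Fin (A i))) :
    devWeight i σ (mixedPolicy G R α η h V D s) = fun a => ∑ k : Fin K, mixWeight α K (k + 1) *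
      prodWeight (Function.update (fun j => usedPolicy G R α η h V D k j s) i σ) a := by
  simp only [← devWeight_prodWeight]
  exact devWeight_mixture (α := fun j => Fin (A j)) i σ (fun k : Fin K => mixWeight α K (k + 1)) _

theorem wCompProd_devWeight_mixedPolicy (i : Fin m) (σ : stdSimplex ℝ (Fin (A i))) :
    wCompProd (devWeight i σ (mixedPolicy G R α η h V D s)) (G.P0 h s) = fun x => ∑ k : Fin K,
      mixWeight α K (k + 1) *
        wCompProd (prodWeight (Function.update (fun j => usedPolicy G R α η h V D k j s) i σ))
          (G.P0 h s) x := by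
  rw [devWeight_mixedPolicy, wCompProd_mixture]

end MixedPolicy

/-- The optimistic value estimate before truncation, to which the regret and concentration bounds
apply directly. -/
def rawValue (G : Game m S H A) (R cb δ : ℝ) (α η : ℕ → ℝ) (h : Fin H)
    (V : Fin m → Fin S → ℝ) {K : ℕ} (D : Fin K → Draw S A) (i : Fin m) (s : Fin S) : ℝ :=
  (∑ k : Fin K, mixWeight α K (k + 1) *
      wMean (usedPolicy G R α η h V D k i s) (qEst G R h V (D k) i s))
    + bonus G R cb δ α η h V D i s

section Truncation

variable (G : Game m S H A) (R cb δ : ℝ) (α η : ℕ → ℝ) {n : ℕ} (hn : n + 1 ≤ H)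
  (V : Fin m → Fin S → ℝ) {K : ℕ} (D : Fin K → Draw S A) (i : Fin m) (s : Fin S)

theorem nextValue_stepIdx :
    nextValue G R cb δ α η (stepIdx n hn) V D i s =
      min (rawValue G R cb δ α η (stepIdx n hn) V D i s) (n + 1) := by
  have hsteps : (H : ℝ) - ((stepIdx n hn : Fin H) : ℕ) = n + 1 := by
    rw [Nat.cast_sub hn]
    push_cast
    ring
  rw [nextValue, hsteps]
  rfl

theorem nextValue_le_rawValue :
    nextValue G R cb δ α η (stepIdx n hn) V D i s ≤
      rawValue G R cb δ α η (stepIdx n hn) V D i s :=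
  (nextValue_stepIdx ..).trans_le (min_le_left _ _)

theorem nextValue_le : nextValue G R cb δ α η (stepIdx n hn) V D i s ≤ (n + 1 : ℕ) := by
  rw [nextValue_stepIdx, Nat.cast_succ]
  exact min_le_right _ _

end Truncation

variable {G : Game m S H A} {R cα cb δ : ℝ} {K : ℕ} {V : Fin m → Fin S → ℝ}

theorem Regime.mixWeight_mem_stdSimplex {M L : ℝ} (hreg : Regime cα cb M L K) :
    (fun k : Fin K => mixWeight (stepα cα K) K (k + 1)) ∈ stdSimplex ℝ (Fin K) :=
  mixWeight_harmStep_mem_stdSimplex hreg.c_pos (by have := hreg.K_large; omega)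

theorem rawValue_eq_wMean_add (hreg : Regime cα cb (effHorizon H R) (logTerm S A K δ) K)
    (η : ℕ → ℝ) (h : Fin H) (D : Fin K → Draw S A) (i : Fin m) (s : Fin S) :
    rawValue G R cb δ (stepα cα K) η h V D i s =
      wMean (fun k : Fin K => mixWeight (stepα cα K) K (k + 1)) (fun k =>
        wMean (usedPolicy G R (stepα cα K) η h V D k i s) (qEst G R h V (D k) i s) +
          cb * rate (effHorizon H R) (logTerm S A K δ) K *
            wVar (usedPolicy G R (stepα cα K) η h V D k i s) (qEst G R h V (D k) i s)) +
      cb * rate (effHorizon H R) (logTerm S A K δ) K * effHorizon H R := by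
  have hbonus : bonus G R cb δ (stepα cα K) η h V D i s =
      cb * rate (effHorizon H R) (logTerm S A K δ) K *
        wMean (fun k : Fin K => mixWeight (stepα cα K) K (k + 1)) (fun k =>
          wVar (usedPolicy G R (stepα cα K) η h V D k i s) (qEst G R h V (D k) i s) +
            effHorizon H R) := rfl
  rw [rawValue, hbonus, wMean_add, wMean_const hreg.mixWeight_mem_stdSimplex, wMean_add,
    wMean_mul_left, mul_add, add_assoc]
  rfl

theorem ciInf_le_rawValue (hR1 : R ≤ 1)
    (hreg : Regime cα cb (effHorizon H R) (logTerm S A K δ) K) (η : ℕ → ℝ) (h : Fin H)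
    (D : Fin K → Draw S A) (i : Fin m) (s : Fin S) :
    ⨅ s', V i s' ≤ rawValue G R cb δ (stepα cα K) η h V D i s := by
  have hb : 0 ≤ cb * rate (effHorizon H R) (logTerm S A K δ) K :=
    mul_nonneg hreg.cb_pos.le hreg.rate_pos.le
  rw [rawValue_eq_wMean_add hreg]
  refine le_add_of_le_of_nonneg (le_wMean hreg.mixWeight_mem_stdSimplex fun k => ?_)
    (mul_nonneg hb hreg.M_pos.le)
  have hp := coe_mem_stdSimplex (usedPolicy G R (stepα cα K) η h V D k i s)
  exact le_add_of_le_of_nonneg (le_wMean hp (le_qEst hR1 h (D k) i s))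
    (mul_nonneg hb (wVar_nonneg hp _))

theorem rawValue_le (hR : 0 ≤ R) (hR1 : R ≤ 1)
    (hreg : Regime cα cb (effHorizon H R) (logTerm S A K δ) K) (η : ℕ → ℝ)
    (h : Fin H) (D : Fin K → Draw S A) (i : Fin m)
    (hV : ∀ s s', V i s - V i s' ≤ 2 * effHorizon H R) (s : Fin S) :
    rawValue G R cb δ (stepα cα K) η h V D i s ≤
      2 + (1 - R) * (2 * effHorizon H R) + ⨅ s', V i s' := by
  have hb : 0 ≤ cb * rate (effHorizon H R) (logTerm S A K δ) K :=
    mul_nonneg hreg.cb_pos.le hreg.rate_pos.le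
  have hsmall := hreg.cb_rate_mul_M_small
  have hspan : 1 + (1 - R) * (2 * effHorizon H R) + (⨅ s', V i s') - ⨅ s', V i s' ≤
      3 * effHorizon H R := by nlinarith [hreg.one_le_M]
  have hround (k : Fin K) :
      wMean (usedPolicy G R (stepα cα K) η h V D k i s) (qEst G R h V (D k) i s) +
          cb * rate (effHorizon H R) (logTerm S A K δ) K *
            wVar (usedPolicy G R (stepα cα K) η h V D k i s) (qEst G R h V (D k) i s) ≤
        1 + (1 - R) * (2 * effHorizon H R) + ⨅ s', V i s' :=
    wMean_add_mul_wVar_le (coe_mem_stdSimplex _) (le_qEst hR1 h (D k) i s)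
      (fun a => qEst_le hR1 h (D k) i s a hV) hb
      ((mul_le_mul_of_nonneg_left hspan hb).trans (by linarith))
  rw [rawValue_eq_wMean_add hreg]
  linarith [wMean_le hreg.mixWeight_mem_stdSimplex hround]

theorem ciInf_le_nextValue (hR1 : R ≤ 1)
    (hreg : Regime cα cb (effHorizon H R) (logTerm S A K δ) K) (η : ℕ → ℝ) {n : ℕ}
    (hn : n + 1 ≤ H) (D : Fin K → Draw S A) (i : Fin m) (hV : ∀ s, V i s ≤ n) (s : Fin S) :
    ⨅ s', V i s' ≤ nextValue G R cb δ (stepα cα K) η (stepIdx n hn) V D i s := by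
  rw [nextValue_stepIdx]
  exact le_min (ciInf_le_rawValue hR1 hreg η _ D i s)
    (by linarith [ciInf_le_apply (V i) s, hV s])

theorem valueRange_nextValue (hR : 0 ≤ R) (hR1 : R ≤ 1)
    (hMR : effHorizon H R = H ∨ R * effHorizon H R = 1)
    (hreg : Regime cα cb (effHorizon H R) (logTerm S A K δ) K) (η : ℕ → ℝ) {n : ℕ}
    (hn : n + 1 ≤ H) (hV : ValueRange (effHorizon H R) n V) (D : Fin K → Draw S A) :
    ValueRange (effHorizon H R) (n + 1)
      (nextValue G R cb δ (stepα cα K) η (stepIdx n hn) V D) := by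
  have hlow (i : Fin m) (s : Fin S) := ciInf_le_nextValue (G := G) hR1 hreg η hn D i (hV.le i) s
  have hnonneg (i : Fin m) (s : Fin S) :
      0 ≤ nextValue G R cb δ (stepα cα K) η (stepIdx n hn) V D i s :=
    (Real.iInf_nonneg (hV.nonneg i)).trans (hlow i s)
  refine ⟨hnonneg, nextValue_le G R cb δ (stepα cα K) η hn V D, fun i s s' => ?_⟩
  rcases hMR with hMR | hMR
  · have hle := nextValue_le G R cb δ (stepα cα K) η hn V D i s
    have hnH : ((n + 1 : ℕ) : ℝ) ≤ H := by exact_mod_cast hn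
    linarith [hnonneg i s', hreg.M_pos]
  · -- Contamination contracts the oscillation: `2 + (1 - R) * (2 * M) = 2 * M` when `R * M = 1`.
    linarith [hlow i s', nextValue_le_rawValue G R cb δ (stepα cα K) η hn V D i s,
      rawValue_le (G := G) hR hR1 hreg η (stepIdx n hn) D i (hV.osc i) s]

theorem stepCert_of_large_slack (hR : 0 ≤ R) (hR1 : R ≤ 1)
    (hreg : Regime cα cb (effHorizon H R) (logTerm S A K δ) K) (η : ℕ → ℝ) {n : ℕ}
    (hn : n + 1 ≤ H) (hV : ValueRange (effHorizon H R) n V) (D : Fin K → Draw S A) {l e : ℝ}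
    (hl : 0 ≤ l) (he : 0 ≤ e) :
    StepCert G R l e n hn V (nextValue G R cb δ (stepα cα K) η (stepIdx n hn) V D)
      (mixedPolicy G R (stepα cα K) η (stepIdx n hn) V D) (4 * effHorizon H R) := by
  have hM := hreg.one_le_M
  have hμ (s : Fin S) : mixedPolicy G R (stepα cα K) η (stepIdx n hn) V D s ∈
      stdSimplex ℝ (JointAction A) :=
    mixedPolicy_mem_stdSimplex G R η _ V D s hreg.c_pos (by have := hreg.K_large; omega)
  refine ⟨fun i s => ?_, fun i s σ => ?_⟩
  · have hp := wCompProd_mem_stdSimplex (hμ s) (G.P0 (stepIdx n hn) s)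
    have hmean := le_wMean hp (le_robustTarget hR1 (G.r_nonneg i (stepIdx n hn) s) (V i))
    have hvar := mul_nonneg hl
      (wVar_nonneg hp (robustTarget (G.r i (stepIdx n hn) s) R (V i)))
    have hraw := rawValue_le (G := G) hR hR1 hreg η (stepIdx n hn) D i (hV.osc i) s
    have hnext := nextValue_le_rawValue G R cb δ (stepα cα K) η hn V D i s
    nlinarith
  · have hp := wCompProd_mem_stdSimplex
      (devWeight_mem_stdSimplex (α := fun j => Fin (A j)) i σ (hμ s)) (G.P0 (stepIdx n hn) s)
    have hmean := wMean_le hp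
      (robustTarget_le hR1 (G.r_le_one i (stepIdx n hn) s) (hV.osc i))
    have hvar := mul_nonneg hl
      (wVar_nonneg hp (robustTarget (G.r i (stepIdx n hn) s) R (V i)))
    have hlow := ciInf_le_nextValue (G := G) hR1 hreg η hn D i (hV.le i) s
    refine le_trans (sub_le_sub_right (sub_le_sub_right (min_le_left _ _) _) _) ?_
    nlinarith

end Step

section Concentration

variable {m S H : ℕ} {A : Fin m → ℕ}

/-- The exponent of the supermartingale which controls the samples of one own action, for a round
of weight `t`. -/
def ownExponent (G : Game m S H A) (R : ℝ) (h : Fin H) (V : Fin m → Fin S → ℝ)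
    (i : Fin m) (s : Fin S) (a : Fin (A i)) (t : ℝ) (p : ∀ j, stdSimplex ℝ (Fin (A j)))
    (d : Draw S A) : ℝ :=
  t * (wMean (ownWeight p i (G.P0 h s) a) (robustTarget (G.r i h s) R (V i)) -
      qEst G R h V d i s a) -
    t ^ 2 * wVar (ownWeight p i (G.P0 h s) a) (robustTarget (G.r i h s) R (V i))

/-- The exponent of the supermartingale which controls the sampled mean and variance under the
policy, for a round of weight `t`. -/
def jointExponent (G : Game m S H A) (R c b : ℝ) (h : Fin H) (V : Fin m → Fin S → ℝ)
    (i : Fin m) (s : Fin S) (t : ℝ) (p : ∀ j, stdSimplex ℝ (Fin (A j))) (d : Draw S A) : ℝ :=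
  t * (wMean (p i) (qEst G R h V d i s) - wMean (p i) (fun a =>
      wMean (ownWeight p i (G.P0 h s) a) (robustTarget (G.r i h s) R (V i)))) +
    t * c * wVar (p i) (qEst G R h V d i s) -
    t * b * wVar (wCompProd (prodWeight p) (G.P0 h s)) (robustTarget (G.r i h s) R (V i))

variable {G : Game m S H A} {R : ℝ} {V : Fin m → Fin S → ℝ}

theorem wMean_drawLaw_qEst (h : Fin H) (p : ∀ j, Fin S → stdSimplex ℝ (Fin (A j))) (i : Fin m)
    (s : Fin S) (a : Fin (A i)) (g : ℝ → ℝ) :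
    wMean (pmfWeight (drawLaw G h p)) (fun d => g (qEst G R h V d i s a)) =
      wMean (ownWeight (fun j => p j s) i (G.P0 h s) a)
        (fun x => g (robustTarget (G.r i h s) R (V i) x)) :=
  wMean_drawLaw G h p i s a fun x => g (robustTarget (G.r i h s) R (V i) x)

variable {B : ℝ}

theorem pmfMean_exp_ownExponent_le_one (hR1 : R ≤ 1) {i : Fin m}
    (hV : ∀ s s', V i s - V i s' ≤ B) {t : ℝ} (ht : 0 ≤ t) (htB : t * (1 + (1 - R) * B) ≤ 1)
    (h : Fin H) (p : ∀ j, Fin S → stdSimplex ℝ (Fin (A j))) (s : Fin S) (a : Fin (A i)) :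
    pmfMean (drawLaw G h p) (fun d => ENNReal.ofReal
      (Real.exp (ownExponent G R h V i s a t (fun j => p j s) d))) ≤ 1 := by
  rw [pmfMean_ofReal _ fun d => (Real.exp_pos _).le, ENNReal.ofReal_le_one]
  have hW := pmfWeight_mem_stdSimplex (drawLaw G h p)
  have hmean := wMean_drawLaw_qEst (G := G) (R := R) (V := V) h p i s a fun x => x
  have hsq := wMean_drawLaw_qEst (G := G) (R := R) (V := V) h p i s a fun x => x ^ 2
  have hvar : wVar (pmfWeight (drawLaw G h p)) (fun d => qEst G R h V d i s a) =
      wVar (ownWeight (fun j => p j s) i (G.P0 h s) a) (robustTarget (G.r i h s) R (V i)) := by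
    rw [wVar, wVar, hsq, hmean]
  have hexp := wMean_exp_centered_le_one hW (q := fun d => qEst G R h V d i s a) (t := t)
    fun d => (mul_le_mul_of_nonneg_left (by
      linarith [wMean_le hW fun d => qEst_le (G := G) hR1 h d i s a hV,
        le_qEst (G := G) (V := V) hR1 h d i s a]) ht).trans htB
  rwa [hvar, hmean] at hexp

theorem pmfMean_exp_jointExponent_le_one (hR1 : R ≤ 1) {i : Fin m}
    (hV : ∀ s s', V i s - V i s' ≤ B) {t c b B' : ℝ} (hB' : 1 + (1 - R) * B ≤ B') (ht : 0 ≤ t)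
    (hc : 0 ≤ c) (htc : t * B' + t * c * B' ^ 2 ≤ 1)
    (hb : c + 2 * t + 2 * t * c ^ 2 * B' ^ 2 ≤ b) (h : Fin H)
    (p : ∀ j, Fin S → stdSimplex ℝ (Fin (A j))) (s : Fin S) :
    pmfMean (drawLaw G h p) (fun d => ENNReal.ofReal
      (Real.exp (jointExponent G R c b h V i s t (fun j => p j s) d))) ≤ 1 := by
  rw [pmfMean_ofReal _ fun d => (Real.exp_pos _).le, ENNReal.ofReal_le_one]
  have hexp := wMean_exp_mean_add_var_le_one (pmfWeight_mem_stdSimplex (drawLaw G h p))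
    (coe_mem_stdSimplex (p i s)) (q := fun d => qEst G R h V d i s)
    (P := ownWeight (fun j => p j s) i (G.P0 h s)) (g := robustTarget (G.r i h s) R (V i))
    (fun a => wMean_drawLaw_qEst (G := G) (R := R) (V := V) h p i s a fun x => x)
    (fun a => wMean_drawLaw_qEst (G := G) (R := R) (V := V) h p i s a fun x => x ^ 2)
    (fun d a => le_qEst hR1 h d i s a) (fun d a => qEst_le hR1 h d i s a hV)
    (by linarith : _ ≤ B') ht hc htc hb
  rwa [← wCompProd_prodWeight_eq_mixture (fun j => p j s) i] at hexp

end Concentration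

section Tail

variable {m S H : ℕ} {A : Fin m → ℕ} [∀ i, NeZero (A i)] {G : Game m S H A} {R : ℝ} {α η : ℕ → ℝ}
  {h : Fin H} {V : Fin m → Fin S → ℝ} {K : ℕ}

theorem pmfMean_exp_sum_sub_le (s : Fin S)
    (F : ℕ → (∀ j, stdSimplex ℝ (Fin (A j))) → Draw S A → ℝ)
    (hF : ∀ k < K, ∀ p : ∀ j, Fin S → stdSimplex ℝ (Fin (A j)), pmfMean (drawLaw G h p)
      (fun d => ENNReal.ofReal (Real.exp (F k (fun j => p j s) d))) ≤ 1) (x : ℝ) :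
    pmfMean (roundsLaw G R α η h V K) (fun D => ENNReal.ofReal (Real.exp
      ((∑ k : Fin K, F k (fun j => usedPolicy G R α η h V D k j s) (D k)) - x))) ≤
      ENNReal.ofReal (Real.exp (-x)) := by
  have hprod := pmfMean_roundsLaw_prod_le G R α η h V
    (fun k D d => ENNReal.ofReal (Real.exp (F k (fun j => ftrlPolicy G R α η h V k D j s) d))) K
    fun k hk D => hF k hk _
  have hexp (D : Fin K → Draw S A) : ENNReal.ofReal (Real.exp
      ((∑ k : Fin K, F k (fun j => usedPolicy G R α η h V D k j s) (D k)) - x)) =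
      ENNReal.ofReal (Real.exp (-x)) * ∏ k : Fin K, ENNReal.ofReal
        (Real.exp (F k (fun j => usedPolicy G R α η h V D k j s) (D k))) := by
    rw [← ENNReal.ofReal_prod_of_nonneg fun k _ => (Real.exp_pos _).le, ← Real.exp_sum,
      ← ENNReal.ofReal_mul (Real.exp_pos _).le, ← Real.exp_add, sub_eq_neg_add]
  simp only [hexp, pmfMean_mul_left]
  exact mul_le_of_le_one_right' hprod

theorem toOuterMeasure_lt_le_pmfMean_exp {Ω : Type} (p : PMF Ω) (F : Ω → ℝ) (x : ℝ) :
    p.toOuterMeasure {ω | x < F ω} ≤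
      pmfMean p fun ω => ENNReal.ofReal (Real.exp (F ω - x)) := by
  rw [toOuterMeasure_eq_pmfMean]
  refine pmfMean_mono p (Set.indicator_le fun ω hω => ?_)
  rw [Pi.one_apply, ENNReal.one_le_ofReal]
  exact Real.one_le_exp (sub_nonneg.2 (le_of_lt hω))

theorem toOuterMeasure_lt_sum_le (s : Fin S)
    (F : ℕ → (∀ j, stdSimplex ℝ (Fin (A j))) → Draw S A → ℝ)
    (hF : ∀ k < K, ∀ p : ∀ j, Fin S → stdSimplex ℝ (Fin (A j)), pmfMean (drawLaw G h p)
      (fun d => ENNReal.ofReal (Real.exp (F k (fun j => p j s) d))) ≤ 1) (x : ℝ) :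
    (roundsLaw G R α η h V K).toOuterMeasure
      {D | x < ∑ k : Fin K, F k (fun j => usedPolicy G R α η h V D k j s) (D k)} ≤
      ENNReal.ofReal (Real.exp (-x)) :=
  (toOuterMeasure_lt_le_pmfMean_exp _ _ x).trans (pmfMean_exp_sum_sub_le s F hF x)

end Tail

section GoodEvent

variable {m S H : ℕ} {A : Fin m → ℕ} [∀ i, NeZero (A i)]

/-- The event on which every exponential supermartingale of step `h`, run with weights
`θ * α_k^K`, stays below `exp x` after the last round. -/
structure GoodEvent (G : Game m S H A) (R : ℝ) (α η : ℕ → ℝ) (h : Fin H)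
    (V : Fin m → Fin S → ℝ) (θ c b x : ℝ) {K : ℕ} (D : Fin K → Draw S A) : Prop where
  own : ∀ i s a, ∑ k : Fin K, ownExponent G R h V i s a (θ * mixWeight α K (k + 1))
    (fun j => usedPolicy G R α η h V D k j s) (D k) ≤ x
  joint : ∀ i s, ∑ k : Fin K, jointExponent G R c b h V i s (θ * mixWeight α K (k + 1))
    (fun j => usedPolicy G R α η h V D k j s) (D k) ≤ x

variable {G : Game m S H A} {R : ℝ} {V : Fin m → Fin S → ℝ} {α η : ℕ → ℝ} {h : Fin H}
  {θ c b x : ℝ} {K : ℕ}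

theorem setOf_not_goodEvent_subset :
    {D : Fin K → Draw S A | ¬ GoodEvent G R α η h V θ c b x D} ⊆ ⋃ i, ⋃ s,
      (⋃ a, {D | x < ∑ k : Fin K, ownExponent G R h V i s a (θ * mixWeight α K (k + 1))
        (fun j => usedPolicy G R α η h V D k j s) (D k)}) ∪
      {D | x < ∑ k : Fin K, jointExponent G R c b h V i s (θ * mixWeight α K (k + 1))
        (fun j => usedPolicy G R α η h V D k j s) (D k)} := by
  intro D hD
  contrapose! hD
  simp only [Set.mem_iUnion, Set.mem_union, Set.mem_ofPred_eq, not_exists, not_or, not_lt,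
    not_not] at hD ⊢
  exact ⟨fun i s => (hD i s).1, fun i s => (hD i s).2⟩

variable {M ρ : ℝ} (hR : 0 ≤ R) (hR1 : R ≤ 1) (hM : 1 ≤ M)
  (hV : ∀ i s s', V i s - V i s' ≤ 2 * M) (hw0 : ∀ k < K, 0 ≤ θ * mixWeight α K (k + 1))
  (hw : ∀ k < K, θ * mixWeight α K (k + 1) ≤ ρ)
include hR hR1 hM hV hw0 hw

theorem toOuterMeasure_lt_sum_ownExponent_le (hρM : ρ * (3 * M) ≤ 1) (i : Fin m) (s : Fin S)
    (a : Fin (A i)) :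
    (roundsLaw G R α η h V K).toOuterMeasure
      {D | x < ∑ k : Fin K, ownExponent G R h V i s a (θ * mixWeight α K (k + 1))
        (fun j => usedPolicy G R α η h V D k j s) (D k)} ≤ ENNReal.ofReal (Real.exp (-x)) := by
  refine toOuterMeasure_lt_sum_le s
    (fun k => ownExponent G R h V i s a (θ * mixWeight α K (k + 1))) (fun k hk p => ?_) x
  refine pmfMean_exp_ownExponent_le_one hR1 (hV i) (hw0 k hk) ?_ h p s a
  have hspan : 1 + (1 - R) * (2 * M) ≤ 3 * M := by nlinarith
  exact (mul_le_mul (hw k hk) hspan (by nlinarith) ((hw0 k hk).trans (hw k hk))).trans hρM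

theorem toOuterMeasure_lt_sum_jointExponent_le (hc : 0 ≤ c)
    (hρ : ρ * (3 * M) + ρ * c * (3 * M) ^ 2 ≤ 1)
    (hb : c + 2 * ρ + 2 * ρ * c ^ 2 * (3 * M) ^ 2 ≤ b) (i : Fin m) (s : Fin S) :
    (roundsLaw G R α η h V K).toOuterMeasure
      {D | x < ∑ k : Fin K, jointExponent G R c b h V i s (θ * mixWeight α K (k + 1))
        (fun j => usedPolicy G R α η h V D k j s) (D k)} ≤ ENNReal.ofReal (Real.exp (-x)) := by
  refine toOuterMeasure_lt_sum_le s
    (fun k => jointExponent G R c b h V i s (θ * mixWeight α K (k + 1))) (fun k hk p => ?_) x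
  have hwρ := hw k hk
  exact pmfMean_exp_jointExponent_le_one hR1 (hV i) (by nlinarith : _ ≤ 3 * M) (hw0 k hk) hc
    (le_trans (by gcongr) hρ) (le_trans (by gcongr) hb) h p s

theorem toOuterMeasure_not_goodEvent_le (hc : 0 ≤ c) (hρ : 0 ≤ ρ)
    (hρM : ρ * (3 * M) + ρ * c * (3 * M) ^ 2 ≤ 1)
    (hb : c + 2 * ρ + 2 * ρ * c ^ 2 * (3 * M) ^ 2 ≤ b) :
    (roundsLaw G R α η h V K).toOuterMeasure {D | ¬ GoodEvent G R α η h V θ c b x D} ≤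
      ENNReal.ofReal (2 * (S * ∑ i, (A i : ℝ)) * Real.exp (-x)) := by
  have hρM' : ρ * (3 * M) ≤ 1 := le_trans (le_add_of_nonneg_right (by positivity)) hρM
  have hcount (i : Fin m) : (A i : ENNReal) + 1 ≤ 2 * A i := by
    rw [two_mul]
    gcongr
    exact_mod_cast NeZero.one_le
  calc _ ≤ ∑ i : Fin m, ∑ _s : Fin S, (∑ _a : Fin (A i), ENNReal.ofReal (Real.exp (-x)) +
        ENNReal.ofReal (Real.exp (-x))) := by
        refine (MeasureTheory.measure_mono setOf_not_goodEvent_subset).trans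
          ((MeasureTheory.measure_iUnion_fintype_le _ _).trans (Finset.sum_le_sum fun i _ =>
            (MeasureTheory.measure_iUnion_fintype_le _ _).trans (Finset.sum_le_sum fun s _ =>
            (MeasureTheory.measure_union_le _ _).trans (add_le_add
              ((MeasureTheory.measure_iUnion_fintype_le _ _).trans
                (Finset.sum_le_sum fun a _ => ?_)) ?_))))
        · exact toOuterMeasure_lt_sum_ownExponent_le hR hR1 hM hV hw0 hw hρM' i s a
        · exact toOuterMeasure_lt_sum_jointExponent_le hR hR1 hM hV hw0 hw hc hρM hb i s
    _ = (S * ∑ i : Fin m, ((A i : ENNReal) + 1)) * ENNReal.ofReal (Real.exp (-x)) := by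
        simp only [Finset.sum_const, Finset.card_univ, Fintype.card_fin, nsmul_eq_mul,
          Finset.mul_sum, Finset.sum_mul]
        exact Finset.sum_congr rfl fun i _ => by ring
    _ ≤ (S * ∑ i : Fin m, 2 * (A i : ENNReal)) * ENNReal.ofReal (Real.exp (-x)) := by
        gcongr with i
        exact hcount i
    _ = ENNReal.ofReal (2 * (S * ∑ i, (A i : ℝ)) * Real.exp (-x)) := by
        rw [ENNReal.ofReal_mul (by positivity), ENNReal.ofReal_mul zero_le_two,
          ENNReal.ofReal_mul (Nat.cast_nonneg _), ENNReal.ofReal_sum_of_nonneg (by simp),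
          ← Finset.mul_sum, mul_left_comm (S : ENNReal)]
        simp only [ENNReal.ofReal_natCast, ENNReal.ofReal_ofNat]

end GoodEvent

section Certificate

variable {m S H : ℕ} {A : Fin m → ℕ} [∀ i, NeZero (A i)] {G : Game m S H A} {R : ℝ}
  {V : Fin m → Fin S → ℝ}

section GoodEventBounds

variable {α η : ℕ → ℝ} {h : Fin H} {θ c b x : ℝ} {K : ℕ} {D : Fin K → Draw S A} {i : Fin m}
  {s : Fin S} (hw : (fun k : Fin K => mixWeight α K (k + 1)) ∈ stdSimplex ℝ (Fin K))
include hw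

theorem wMean_devWeight_mixedPolicy_le (hb : 0 ≤ b) (σ : stdSimplex ℝ (Fin (A i)))
    {X : JointAction A × Fin S → ℝ} {B : ℝ}
    (hX : ∀ a, wMean (fun k : Fin K => mixWeight α K (k + 1)) (fun k => wMean
        (ownWeight (fun j => usedPolicy G R α η h V D k j s) i (G.P0 h s) a) X -
      b * wVar (ownWeight (fun j => usedPolicy G R α η h V D k j s) i (G.P0 h s) a) X) ≤ B) :
    wMean (wCompProd (devWeight i σ (mixedPolicy G R α η h V D s)) (G.P0 h s)) X -
      b * wVar (wCompProd (devWeight i σ (mixedPolicy G R α η h V D s)) (G.P0 h s)) X ≤ B := by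
  set w : Fin K → ℝ := fun k => mixWeight α K (k + 1)
  set P : Fin K → Fin (A i) → JointAction A × Fin S → ℝ :=
    fun k => ownWeight (fun j => usedPolicy G R α η h V D k j s) i (G.P0 h s) with hP
  have hlaw : wCompProd (devWeight i σ (mixedPolicy G R α η h V D s)) (G.P0 h s) =
      fun y => ∑ k, w k * ∑ a, σ a * P k a y := by
    simp only [wCompProd_devWeight_mixedPolicy, wCompProd_update_eq_mixture, hP, w]
  have hvar : wMean w (fun k => wMean σ fun a => wVar (P k a) X) ≤
      wVar (fun y => ∑ k, w k * ∑ a, σ a * P k a y) X :=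
    (wMean_mono hw fun k => wMean_wVar_le_wVar_mixture (coe_mem_stdSimplex σ) (P k) X).trans
      (wMean_wVar_le_wVar_mixture hw _ X)
  rw [hlaw]
  calc _ ≤ wMean w (fun k => wMean σ fun a => wMean (P k a) X) -
        b * wMean w (fun k => wMean σ fun a => wVar (P k a) X) := by
        simp only [wMean_mixture]
        gcongr
    _ = wMean σ (fun a => wMean w fun k => wMean (P k a) X - b * wVar (P k a) X) := by
        simp only [← wMean_mul_left, ← wMean_sub]
        exact wMean_comm _ _ _
    _ ≤ B := wMean_le (coe_mem_stdSimplex σ) hX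

theorem GoodEvent.wMean_ownWeight_sub_le (hD : GoodEvent G R α η h V θ c b x D) (hθ : 0 < θ)
    (hwb : ∀ k < K, θ * mixWeight α K (k + 1) ≤ b) (a : Fin (A i)) :
    wMean (fun k : Fin K => mixWeight α K (k + 1)) (fun k =>
      wMean (ownWeight (fun j => usedPolicy G R α η h V D k j s) i (G.P0 h s) a)
          (robustTarget (G.r i h s) R (V i)) -
        b * wVar (ownWeight (fun j => usedPolicy G R α η h V D k j s) i (G.P0 h s) a)
          (robustTarget (G.r i h s) R (V i))) ≤
      ∑ k : Fin K, mixWeight α K (k + 1) * qEst G R h V (D k) i s a + x / θ := by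
  have hterm (k : Fin K) := mul_le_mul_of_nonneg_right (hwb k k.2) (mul_nonneg
    (mul_nonneg hθ.le (hw.1 k)) (wVar_nonneg (ownWeight_mem_stdSimplex
      (fun j => usedPolicy G R α η h V D k j s) i (G.P0 h s) a)
      (robustTarget (G.r i h s) R (V i))))
  rw [← sub_le_iff_le_add', le_div_iff₀' hθ]
  refine le_trans ?_ (hD.own i s a)
  rw [wMean, ← Finset.sum_sub_distrib, Finset.mul_sum]
  refine Finset.sum_le_sum fun k _ => ?_
  rw [ownExponent]
  linarith [hterm k]

theorem GoodEvent.wMean_qEst_le (hD : GoodEvent G R α η h V θ c b x D) (hθ : 0 < θ)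
    (hb : 0 ≤ b) (i : Fin m) (s : Fin S) :
    wMean (fun k : Fin K => mixWeight α K (k + 1)) (fun k =>
        wMean (usedPolicy G R α η h V D k i s) (qEst G R h V (D k) i s) +
          c * wVar (usedPolicy G R α η h V D k i s) (qEst G R h V (D k) i s)) ≤
      wMean (wCompProd (mixedPolicy G R α η h V D s) (G.P0 h s))
          (robustTarget (G.r i h s) R (V i)) +
        b * wVar (wCompProd (mixedPolicy G R α η h V D s) (G.P0 h s))
          (robustTarget (G.r i h s) R (V i)) + x / θ := by
  set X := robustTarget (G.r i h s) R (V i)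
  set w : Fin K → ℝ := fun k => mixWeight α K (k + 1)
  set P : Fin K → JointAction A × Fin S → ℝ :=
    fun k => wCompProd (prodWeight fun j => usedPolicy G R α η h V D k j s) (G.P0 h s)
  have hvar := mul_le_mul_of_nonneg_left (wMean_wVar_le_wVar_mixture hw P X) hb
  have hmean (k : Fin K) : wMean (usedPolicy G R α η h V D k i s) (fun a => wMean
      (ownWeight (fun j => usedPolicy G R α η h V D k j s) i (G.P0 h s) a) X) =
      wMean (P k) X := by
    simp only [P, wCompProd_prodWeight_eq_mixture _ i, wMean_mixture]
  have hjoint : wMean w (fun k =>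
        wMean (usedPolicy G R α η h V D k i s) (qEst G R h V (D k) i s) +
          c * wVar (usedPolicy G R α η h V D k i s) (qEst G R h V (D k) i s)) -
      (wMean w (fun k => wMean (P k) X) + b * wMean w (fun k => wVar (P k) X)) ≤ x / θ := by
    rw [le_div_iff₀' hθ, ← wMean_mul_left, ← wMean_add, ← wMean_sub, ← wMean_mul_left]
    refine le_trans (Finset.sum_congr rfl fun k _ => ?_).le (hD.joint i s)
    rw [jointExponent, hmean]
    ring
  rw [wCompProd_mixedPolicy, wMean_mixture]
  linarith

end GoodEventBounds

variable {cα cb δ : ℝ} {K : ℕ}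

theorem sum_qEst_le_rawValue (hR : 0 ≤ R) (hR1 : R ≤ 1)
    (hreg : Regime cα cb (effHorizon H R) (logTerm S A K δ) K) {i : Fin m}
    (hV : ∀ s s', V i s - V i s' ≤ 2 * effHorizon H R) (h : Fin H) (D : Fin K → Draw S A)
    (hA : Real.log (A i) ≤ logTerm S A K δ) (s : Fin S) (a : Fin (A i)) :
    ∑ k : Fin K, mixWeight (stepα cα K) K (k + 1) * qEst G R h V (D k) i s a ≤
      rawValue G R cb δ (stepα cα K) (stepη cα H R K) h V D i s := by
  set Q : ℕ → Fin (A i) → ℝ := fun k a =>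
    if hk : k ≤ K then qTable G R (stepα cα K) h V k (Fin.take k hk D) i s a else 0 with hQ
  set q : ℕ → Fin (A i) → ℝ := fun k a =>
    if hk : k < K then qEst G R h V (D ⟨k, hk⟩) i s a else 0 with hq
  have hQ_zero (a) : Q 0 a = 0 := by simp [hQ, qTable]
  have hQ_succ : ∀ k < K, ∀ a,
      Q (k + 1) a = (1 - stepα cα K (k + 1)) * Q k a + stepα cα K (k + 1) * q k a := by
    intro k hk a
    simp only [hQ, hq, dif_pos hk, dif_pos hk.le, dif_pos (Nat.succ_le_of_lt hk), qTable]
    rfl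
  have hq_eq (k : Fin K) : q k = qEst G R h V (D k) i s := by
    funext a
    simp only [hq, dif_pos k.2]
  have hsoftmax (k : Fin K) : usedPolicy G R (stepα cα K) (stepη cα H R K) h V D k i s =
      softmax (stepη cα H R K (k + 1)) (Q k) := by
    simp only [hQ, dif_pos k.isLt.le]
    rfl
  have hregret := hreg.regret_le_bonus (lo := ⨅ s', V i s')
    (hi := 1 + (1 - R) * (2 * effHorizon H R) + ⨅ s', V i s')
    (by simpa only [Fintype.card_fin] using hA) hQ_zero hQ_succ
    (fun k hk a => by simpa only [hq, dif_pos hk] using le_qEst hR1 h _ i s a)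
    (fun k hk a => by simpa only [hq, dif_pos hk] using qEst_le hR1 h _ i s a hV)
    (by nlinarith [hreg.one_le_M]) a (p := fun k => softmax (stepη cα H R K (k + 1)) (Q k))
    fun k => rfl
  have htable : Q K a = ∑ k : Fin K, mixWeight (stepα cα K) K (k + 1) * q k a :=
    eq_sum_mixWeight (u := fun k => Q k a) (g := fun k => q k a) (hQ_zero a)
      fun k hk => hQ_succ k hk a
  rw [htable] at hregret
  simp only [hq_eq, ← hsoftmax] at hregret
  exact hregret

theorem stepCert_of_goodEvent (hR : 0 ≤ R) (hR1 : R ≤ 1)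
    (hreg : Regime cα cb (effHorizon H R) (logTerm S A K δ) K)
    (hA : ∀ i, Real.log (A i) ≤ logTerm S A K δ) {n : ℕ} (hn : n + 1 ≤ H)
    (hV : ∀ i s s', V i s - V i s' ≤ 2 * effHorizon H R) {D : Fin K → Draw S A}
    {θ x b e : ℝ} (hθ : 0 < θ) (hx : 0 ≤ x) (hb : 0 ≤ b)
    (hwb : ∀ k < K, θ * mixWeight (stepα cα K) K (k + 1) ≤ b)
    (he : x / θ + cb * rate (effHorizon H R) (logTerm S A K δ) K * effHorizon H R ≤ e)
    (hD : GoodEvent G R (stepα cα K) (stepη cα H R K) (stepIdx n hn) V θ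
      (cb * rate (effHorizon H R) (logTerm S A K δ) K) b x D) :
    StepCert G R b e n hn V
      (nextValue G R cb δ (stepα cα K) (stepη cα H R K) (stepIdx n hn) V D)
      (mixedPolicy G R (stepα cα K) (stepη cα H R K) (stepIdx n hn) V D) 0 := by
  have hw := hreg.mixWeight_mem_stdSimplex
  refine ⟨fun i s => ?_, fun i s σ => ?_⟩
  · have hnext := nextValue_le_rawValue G R cb δ (stepα cα K) (stepη cα H R K) hn V D i s
    rw [rawValue_eq_wMean_add hreg] at hnext
    linarith [hD.wMean_qEst_le hw hθ hb i s]
  · have hdev := wMean_devWeight_mixedPolicy_le hw hb σ fun a =>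
      (hD.wMean_ownWeight_sub_le hw hθ hwb a).trans (add_le_add_left
        (sum_qEst_le_rawValue hR hR1 hreg (hV i) (stepIdx n hn) D (hA i) s a) _)
    have hbonus := mul_nonneg (mul_pos hreg.cb_pos hreg.rate_pos).le hreg.M_pos.le
    have hslack : 0 ≤ x / θ := div_nonneg hx hθ.le
    rw [sub_zero, sub_le_iff_le_add, nextValue_stepIdx, ← min_add_add_right]
    exact min_le_min (by linarith) (by linarith)

end Certificate

/-! ### The law of the output -/

section OutputLaw

variable {m S H : ℕ} {A : Fin m → ℕ} [∀ i, NeZero (A i)]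

/-- The value estimates and the policy after one more step of the backward recursion, computed
from those before it and from the samples `D` of the step. -/
def backwardStep (G : Game m S H A) (R cb δ : ℝ) (α η : ℕ → ℝ) {n : ℕ} (hn : n + 1 ≤ H) {K : ℕ}
    (z : (Fin m → Fin S → ℝ) × JointWeights S H A) (D : Fin K → Draw S A) :
    (Fin m → Fin S → ℝ) × JointWeights S H A :=
  (nextValue G R cb δ α η (stepIdx n hn) z.1 D,
    Function.update z.2 (stepIdx n hn) (mixedPolicy G R α η (stepIdx n hn) z.1 D))

theorem backwardLaw_succ (G : Game m S H A) (R cb δ : ℝ) (K : ℕ) (α η : ℕ → ℝ) {n : ℕ}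
    (hn : n + 1 ≤ H) :
    backwardLaw G R cb δ K α η (n + 1) hn =
      (backwardLaw G R cb δ K α η n (Nat.le_of_succ_le hn)).bind fun z =>
        (roundsLaw G R α η (stepIdx n hn) z.1 K).map (backwardStep G R cb δ α η hn z) :=
  rfl

theorem isPolicyOnLast_of_mem_support_backwardLaw (G : Game m S H A) (R cb δ : ℝ) {K : ℕ}
    (hK : K ≠ 0) {c : ℝ} (hc : 0 < c) (η : ℕ → ℝ) (n : ℕ) (hn : n ≤ H) :
    ∀ z ∈ (backwardLaw G R cb δ K (harmStep c) η n hn).support, IsPolicyOnLast n z.2 := by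
  induction n with
  | zero => exact fun z _ t ht => absurd t.2 (by omega)
  | succ n ih =>
    intro z hz
    simp only [backwardLaw_succ, PMF.mem_support_bind_iff, PMF.support_map, Set.mem_image] at hz
    obtain ⟨y, hy, D, _, rfl⟩ := hz
    exact (ih (Nat.le_of_succ_le hn) y hy).update hn fun s =>
      mixedPolicy_mem_stdSimplex G R η _ _ D s hc hK

open Classical in
/-- The indicator of the failure of a step, a natural number so that failures can be counted. -/
def stepFailure (G : Game m S H A) (R cb δ : ℝ) (α η : ℕ → ℝ) (l e : ℝ) {n : ℕ} (hn : n + 1 ≤ H)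
    {K : ℕ} (V : Fin m → Fin S → ℝ) (D : Fin K → Draw S A) : ℕ :=
  if StepCert G R l e n hn V (nextValue G R cb δ α η (stepIdx n hn) V D)
    (mixedPolicy G R α η (stepIdx n hn) V D) 0 then 0 else 1

/-- The law of the backward recursion together with the number of failed steps. The sample size
need not grow with `log H`, so the probability of any failure at all cannot be controlled by a
union bound over the steps; instead the expected number of failures is, and a few failures are
affordable. -/
def countedLaw (G : Game m S H A) (R cb δ : ℝ) (K : ℕ) (α η : ℕ → ℝ) (l e : ℝ) :
    (n : ℕ) → n ≤ H → PMF (((Fin m → Fin S → ℝ) × JointWeights S H A) × ℕ)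
  | 0, _ => PMF.pure ((fun _ _ => 0, fun _ _ _ => 0), 0)
  | n + 1, hn => (countedLaw G R cb δ K α η l e n (Nat.le_of_succ_le hn)).bind fun z =>
      (roundsLaw G R α η (stepIdx n hn) z.1.1 K).map fun D =>
        (backwardStep G R cb δ α η hn z.1 D, z.2 + stepFailure G R cb δ α η l e hn z.1.1 D)

theorem map_fst_countedLaw (G : Game m S H A) (R cb δ : ℝ) (K : ℕ) (α η : ℕ → ℝ) (l e : ℝ)
    (n : ℕ) (hn : n ≤ H) :
    (countedLaw G R cb δ K α η l e n hn).map Prod.fst = backwardLaw G R cb δ K α η n hn := by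
  induction n with
  | zero => exact PMF.pure_map _ _
  | succ n ih =>
    simp only [countedLaw, backwardLaw_succ, PMF.map_bind, PMF.map_comp,
      ← ih (Nat.le_of_succ_le hn), PMF.bind_map]
    rfl

theorem cast_stepFailure (G : Game m S H A) (R cb δ : ℝ) (α η : ℕ → ℝ) (l e : ℝ) {n : ℕ}
    (hn : n + 1 ≤ H) {K : ℕ} (V : Fin m → Fin S → ℝ) (D : Fin K → Draw S A) :
    (stepFailure G R cb δ α η l e hn V D : ENNReal) =
      {D | ¬ StepCert G R l e n hn V (nextValue G R cb δ α η (stepIdx n hn) V D)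
        (mixedPolicy G R α η (stepIdx n hn) V D) 0}.indicator 1 D := by
  rw [stepFailure]
  split_ifs with hcert <;> simp [hcert]

variable [NeZero S] {G : Game m S H A} {R cα cb δ : ℝ} {K : ℕ} (hR : 0 ≤ R) (hR1 : R ≤ 1)
  (hMR : effHorizon H R = H ∨ R * effHorizon H R = 1)
  (hreg : Regime cα cb (effHorizon H R) (logTerm S A K δ) K) {η : ℕ → ℝ} {l e : ℝ}
  (hl0 : 0 ≤ l) (hl : 12 * (l * effHorizon H R) ≤ 1) (he : 0 ≤ e)
include hR hR1 hMR hreg hl0 hl he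

theorem BackwardInv.backwardStep {n : ℕ} (hn : n + 1 ≤ H) {V : Fin m → Fin S → ℝ}
    {π : JointWeights S H A} {k : ℕ}
    (h : BackwardInv G R (effHorizon H R) l (9 * (l * effHorizon H R) + l + e) n
      (Nat.le_of_succ_le hn) V π (4 * effHorizon H R * k)) (D : Fin K → Draw S A) :
    BackwardInv G R (effHorizon H R) l (9 * (l * effHorizon H R) + l + e) (n + 1) hn
      (backwardStep G R cb δ (stepα cα K) η hn (V, π) D).1
      (backwardStep G R cb δ (stepα cα K) η hn (V, π) D).2
      (4 * effHorizon H R * (k + stepFailure G R cb δ (stepα cα K) η l e hn V D : ℕ)) := by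
  have hrange := valueRange_nextValue (G := G) hR hR1 hMR hreg η hn h.range D
  have hμ (s : Fin S) := mixedPolicy_mem_stdSimplex G R η (stepIdx n hn) V D s hreg.c_pos
    (by have := hreg.K_large; omega)
  have hx : 0 ≤ 4 * effHorizon H R * (k : ℝ) := by have := hreg.M_pos; positivity
  rw [stepFailure]
  split_ifs with hcert
  · simpa only [RobustMG.backwardStep, Nat.add_zero, add_zero] using
      h.step hR hR1 hreg.one_le_M hMR hl0 hl he hn hx hcert hrange hμ
  · simpa only [RobustMG.backwardStep, Nat.cast_succ, mul_add, mul_one] using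
      h.step hR hR1 hreg.one_le_M hMR hl0 hl he hn hx
        (stepCert_of_large_slack hR hR1 hreg η hn h.range D hl0 he) hrange hμ

theorem backwardInv_of_mem_support_countedLaw (n : ℕ) (hn : n ≤ H) :
    ∀ z ∈ (countedLaw G R cb δ K (stepα cα K) η l e n hn).support,
      BackwardInv G R (effHorizon H R) l (9 * (l * effHorizon H R) + l + e) n hn z.1.1 z.1.2
        (4 * effHorizon H R * z.2) := by
  induction n with
  | zero =>
    intro z hz
    rw [countedLaw, PMF.support_pure, Set.mem_singleton_iff] at hz
    subst hz
    have hM := hreg.M_pos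
    refine ⟨fun t ht => absurd t.2 (by omega), ⟨fun _ _ => le_rfl, fun _ _ => by simp,
      fun i s s' => by simpa using hM.le⟩, fun i s => ?_, fun i π' s => ?_⟩ <;>
    simp [robustDP, excess]
  | succ n ih =>
    intro z hz
    simp only [countedLaw, PMF.mem_support_bind_iff, PMF.support_map, Set.mem_image] at hz
    obtain ⟨y, hy, D, _, rfl⟩ := hz
    exact (ih (Nat.le_of_succ_le hn) y hy).backwardStep hR hR1 hMR hreg hl0 hl he hn D

theorem pmfMean_countedLaw_le {P : ENNReal}
    (hP : ∀ (n : ℕ) (hn : n + 1 ≤ H) (V : Fin m → Fin S → ℝ), ValueRange (effHorizon H R) n V →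
      (roundsLaw G R (stepα cα K) η (stepIdx n hn) V K).toOuterMeasure
        {D | ¬ StepCert G R l e n hn V (nextValue G R cb δ (stepα cα K) η (stepIdx n hn) V D)
          (mixedPolicy G R (stepα cα K) η (stepIdx n hn) V D) 0} ≤ P) (n : ℕ) (hn : n ≤ H) :
    pmfMean (countedLaw G R cb δ K (stepα cα K) η l e n hn) (fun z => (z.2 : ENNReal)) ≤
      n * P := by
  induction n with
  | zero => simp [countedLaw, pmfMean_pure]
  | succ n ih =>
    have hsupp := backwardInv_of_mem_support_countedLaw (G := G) (η := η) hR hR1 hMR hreg hl0 hl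
      he n (Nat.le_of_succ_le hn)
    set ζ := countedLaw G R cb δ K (stepα cα K) η l e n (Nat.le_of_succ_le hn) with hζ
    rw [countedLaw, ← hζ, pmfMean_bind]
    calc _ ≤ pmfMean ζ (fun z => (z.2 : ENNReal) + P) := pmfMean_mono_support ζ fun z hz => by
          simp only [pmfMean_map, Nat.cast_add, pmfMean_add, pmfMean_const, cast_stepFailure,
            ← toOuterMeasure_eq_pmfMean]
          gcongr
          exact hP n hn z.1.1 (hsupp z hz).range
      _ = pmfMean ζ (fun z => (z.2 : ENNReal)) + P := by rw [pmfMean_add, pmfMean_const]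
      _ ≤ n * P + P := by gcongr; exact ih (Nat.le_of_succ_le hn)
      _ = (n + 1 : ℕ) * P := by rw [Nat.cast_succ, add_one_mul]

variable {ε P : ℝ} (hε : 0 < ε) (hεe : 4 * (H * (9 * (l * effHorizon H R) + l + e)) ≤ ε)
include hε hεe

theorem indicator_not_isRobustCCE_le {z : ((Fin m → Fin S → ℝ) × JointWeights S H A) × ℕ}
    (hz : z ∈ (countedLaw G R cb δ K (stepα cα K) η l e H le_rfl).support) :
    ({π | IsRobustCCE G R ε π}ᶜ : Set (JointWeights S H A)).indicator
        (1 : JointWeights S H A → ENNReal) z.1.2 ≤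
      ENNReal.ofReal (16 * effHorizon H R / ε) * (z.2 : ENNReal) := by
  refine Set.indicator_apply_le' (fun hcce => ?_) fun _ => zero_le
  have hM := hreg.M_pos
  have hfail : ε < 16 * effHorizon H R * z.2 := by
    contrapose! hcce
    have hinv := backwardInv_of_mem_support_countedLaw hR hR1 hMR hreg hl0 hl he H le_rfl z hz
    exact Set.notMem_compl_iff.2 (hinv.isRobustCCE hR hR1 hl0 (by linarith) hε.le)
  rw [Pi.one_apply, ← ENNReal.ofReal_natCast, ← ENNReal.ofReal_mul (by positivity),
    ENNReal.one_le_ofReal, div_mul_eq_mul_div, one_le_div hε]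
  exact hfail.le

theorem toOuterMeasure_isRobustCCE_ge
    (hP : ∀ (n : ℕ) (hn : n + 1 ≤ H) (V : Fin m → Fin S → ℝ), ValueRange (effHorizon H R) n V →
      (roundsLaw G R (stepα cα K) η (stepIdx n hn) V K).toOuterMeasure
        {D | ¬ StepCert G R l e n hn V (nextValue G R cb δ (stepα cα K) η (stepIdx n hn) V D)
          (mixedPolicy G R (stepα cα K) η (stepIdx n hn) V D) 0} ≤ ENNReal.ofReal P)
    (hδP : 16 * effHorizon H R / ε * (H * P) ≤ δ) (hδ0 : 0 ≤ δ) :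
    ENNReal.ofReal (1 - δ) ≤ (robustQFTRL G R cb δ K (stepα cα K) η).toOuterMeasure
      {π | IsRobustCCE G R ε π} := by
  have hM := hreg.M_pos
  have hbad : (robustQFTRL G R cb δ K (stepα cα K) η).toOuterMeasure
      {π | IsRobustCCE G R ε π}ᶜ ≤ ENNReal.ofReal δ := by
    rw [toOuterMeasure_eq_pmfMean, robustQFTRL, pmfMean_map,
      ← map_fst_countedLaw G R cb δ K _ η l e, pmfMean_map]
    calc _ ≤ pmfMean (countedLaw G R cb δ K (stepα cα K) η l e H le_rfl)
          (fun z => ENNReal.ofReal (16 * effHorizon H R / ε) * (z.2 : ENNReal)) :=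
          pmfMean_mono_support _ fun z hz =>
            indicator_not_isRobustCCE_le hR hR1 hMR hreg hl0 hl he hε hεe hz
      _ ≤ ENNReal.ofReal (16 * effHorizon H R / ε) * (H * ENNReal.ofReal P) := by
          rw [pmfMean_mul_left]
          gcongr
          exact pmfMean_countedLaw_le hR hR1 hMR hreg hl0 hl he hP H le_rfl
      _ = ENNReal.ofReal (16 * effHorizon H R / ε * (H * P)) := by
          rw [ENNReal.ofReal_mul (by positivity), ENNReal.ofReal_mul (by positivity),
            ENNReal.ofReal_natCast]
      _ ≤ ENNReal.ofReal δ := ENNReal.ofReal_le_ofReal hδP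
  rw [ENNReal.ofReal_sub _ hδ0, ENNReal.ofReal_one, tsub_le_iff_right,
    ← toOuterMeasure_add_compl (robustQFTRL G R cb δ K (stepα cα K) η) {π | IsRobustCCE G R ε π}]
  gcongr

end OutputLaw

/-! ### Constants -/

section EffHorizon

theorem one_le_effHorizon {H : ℕ} (hH : 1 ≤ H) {R : ℝ} (hR : 0 ≤ R) (hR1 : R ≤ 1) :
    1 ≤ effHorizon H R := by
  have hH' : (1 : ℝ) ≤ H := by exact_mod_cast hH
  rw [effHorizon]
  split_ifs with hR0
  · exact hH'
  · exact le_min hH' ((one_le_div (hR.lt_of_ne' hR0)).2 hR1)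

theorem effHorizon_eq_or (H : ℕ) (R : ℝ) : effHorizon H R = H ∨ R * effHorizon H R = 1 := by
  rw [effHorizon]
  split_ifs with hR0
  · exact Or.inl rfl
  · exact (min_choice (H : ℝ) (1 / R)).imp_right fun h => by rw [h, mul_one_div_cancel hR0]

end EffHorizon

section LogTerm

variable {m S K : ℕ} {A : Fin m → ℕ} {δ : ℝ}

theorem log_le_logTerm {x : ℝ} (hx : 0 < x) (hxN : x ≤ K * S * ∑ i, (A i : ℝ)) (hδ : 0 < δ)
    (hδ1 : δ ≤ 1) : Real.log x ≤ logTerm S A K δ :=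
  Real.log_le_log hx (hxN.trans (le_div_self (hx.le.trans hxN) hδ hδ1))

theorem exp_neg_logTerm (hN : 0 < K * S * ∑ i, (A i : ℝ)) (hδ : 0 < δ) :
    Real.exp (-logTerm S A K δ) = δ / (K * S * ∑ i, (A i : ℝ)) := by
  rw [logTerm, Real.exp_neg, Real.exp_log (div_pos hN hδ), inv_div]

end LogTerm

/-- The lower bound on `log K` on which `K_large`, `one_le_c` and `early_log` in `Regime` rest. -/
def logThreshold (cα cb : ℝ) : ℝ :=
  max 4 (max (1 / cα) (4 * cα / cb ^ 2 * Real.exp (2 / cα)))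

/-- The error of the values per step of the backward recursion, in units of `rate M L K * M`. -/
def errConst (cα cb : ℝ) : ℝ := 10 * (2 * cb + 2) + (3 * cα + cb)

/-- The constant of the sample complexity: the first four entries yield `Regime`, the fifth bounds
the accumulated error by the accuracy. -/
def sampleConst (cα cb : ℝ) : ℝ :=
  max (4 * Real.exp (logThreshold cα cb)) (max (2 * cα * Real.exp (2 / cα))
    (max ((24 * (cb + 1)) ^ 2) (max ((6 / cb) ^ 2) (max ((4 * errConst cα cb) ^ 2) 1))))

theorem one_le_sampleConst (cα cb : ℝ) : 1 ≤ sampleConst cα cb := by simp [sampleConst]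

theorem thirty_two_le_of_four_le_log {x : ℝ} (hx : 0 < x) (h : 4 ≤ Real.log x) : 32 ≤ x :=
  calc (32 : ℝ) ≤ 2.7 ^ 4 := by norm_num
    _ ≤ Real.exp 1 ^ 4 := by gcongr; linarith [Real.exp_one_gt_d9]
    _ = Real.exp 4 := by rw [← Real.exp_nat_mul]; norm_num
    _ ≤ x := (Real.le_log_iff_exp_le hx).1 h

section Regime

variable {cα cb M L : ℝ} {K : ℕ}

theorem mul_rate_mul_le {a b : ℝ} (hM : 0 < M) (hL : 0 ≤ L) (hK : 0 < K) (hb : 0 ≤ b)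
    (h : a ^ 2 * (M * L ^ 3) ≤ K * b ^ 2) : a * (rate M L K * M) ≤ b := by
  have hK' : (0 : ℝ) < K := by exact_mod_cast hK
  refine le_of_abs_le (abs_le_of_sq_le_sq ?_ hb)
  calc (a * (rate M L K * M)) ^ 2 = a ^ 2 * (M * L ^ 3) / K := by
        rw [mul_pow, mul_pow, rate, Real.sq_sqrt (by positivity)]
        field_simp
    _ ≤ b ^ 2 := by rwa [div_le_iff₀' hK']

theorem le_mul_rate_mul (hcb : 0 < cb) (hM : 0 < M) (hL : 1 ≤ L) (hMK : (6 / cb) ^ 2 * M ≤ K) :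
    6 ≤ cb * rate M L K * K := by
  have hK : (0 : ℝ) < K := lt_of_lt_of_le (by positivity) hMK
  have hρ : (rate M L K * K) ^ 2 = K * L ^ 3 / M := by
    rw [mul_pow, rate, Real.sq_sqrt (by positivity)]
    field_simp
  have hsq : (6 / cb) ^ 2 ≤ (rate M L K * K) ^ 2 := by
    rw [hρ, le_div_iff₀ hM]
    exact hMK.trans (le_mul_of_one_le_right hK.le (one_le_pow₀ hL))
  have := (pow_le_pow_iff_left₀ (by positivity)
    (mul_nonneg (Real.sqrt_nonneg _) hK.le) two_ne_zero).1 hsq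
  rwa [div_le_iff₀' hcb, ← mul_assoc] at this

theorem logThreshold_le_log (hM : 1 ≤ M) (hK : 2 ≤ K) (hlog : Real.log K ≤ L)
    (hC : sampleConst cα cb * (M * L ^ 3) ≤ K) : logThreshold cα cb ≤ Real.log K := by
  have hK2 : (2 : ℝ) ≤ K := by exact_mod_cast hK
  have hL : 0.69 ≤ L :=
    (by linarith [Real.log_two_gt_d9, Real.log_le_log two_pos hK2] : 0.69 ≤ Real.log K).trans hlog
  rw [Real.le_log_iff_exp_le (two_pos.trans_le hK2)]
  have hC0 := zero_le_one.trans (one_le_sampleConst cα cb)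
  calc Real.exp (logThreshold cα cb) ≤ 4 * Real.exp (logThreshold cα cb) * (1 * 0.69 ^ 3) := by
        linarith [Real.exp_pos (logThreshold cα cb)]
    _ ≤ sampleConst cα cb * (M * L ^ 3) := by
        gcongr
        exact le_max_left _ _
    _ ≤ K := hC

theorem Regime.of_large (hcα : 0 < cα) (hcb : 0 < cb) (hM : 1 ≤ M) (hK : 2 ≤ K)
    (hlog : Real.log K ≤ L) (hC : sampleConst cα cb * (M * L ^ 3) ≤ K) :
    Regime cα cb M L K := by
  have hK0 : 0 < K := two_pos.trans_le hK
  have hM0 : 0 < M := zero_lt_one.trans_le hM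
  obtain ⟨hfour, hc, hcb_log⟩ : 4 ≤ Real.log K ∧ 1 / cα ≤ Real.log K ∧
      4 * cα / cb ^ 2 * Real.exp (2 / cα) ≤ Real.log K := by
    simpa only [logThreshold, max_le_iff] using logThreshold_le_log hM hK hlog hC
  have hL : 1 ≤ L := by linarith
  have hC_of_le {a : ℝ} (ha : a ≤ sampleConst cα cb) : a * (M * L ^ 3) ≤ K :=
    (mul_le_mul_of_nonneg_right ha (by positivity)).trans hC
  have hM_le : M ≤ M * L ^ 3 := le_mul_of_one_le_right hM0.le (one_le_pow₀ hL)
  have hL_le : L ≤ M * L ^ 3 := (le_self_pow₀ hL three_ne_zero).trans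
    (le_mul_of_one_le_left (by positivity) hM)
  refine ⟨hcα, hcb, ?_, hM, hL, hlog, ?_, ?_, ?_, ?_, ?_, ?_⟩
  · exact_mod_cast thirty_two_le_of_four_le_log (by exact_mod_cast hK0) hfour
  · exact (div_le_iff₀' hcα).1 hc
  · rw [Real.exp_neg, inv_mul_eq_div, le_div_iff₀ (Real.exp_pos _)]
    calc 2 * (cα * Real.log K) * Real.exp (2 / cα)
        = 2 * cα * Real.exp (2 / cα) * Real.log K := by ring
      _ ≤ 2 * cα * Real.exp (2 / cα) * (M * L ^ 3) := by gcongr; exact hlog.trans hL_le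
      _ ≤ K := hC_of_le (by simp [sampleConst])
  · rw [Real.exp_neg, inv_mul_eq_div, le_div_iff₀ (Real.exp_pos _)]
    exact hcb_log.trans hlog
  · refine mul_rate_mul_le hM0 (by positivity) hK0 zero_le_one ?_
    rw [one_pow, mul_one]
    exact hC_of_le (by simp [sampleConst])
  · refine le_mul_rate_mul hcb hM0 hL (le_trans (by gcongr) (hC_of_le (a := (6 / cb) ^ 2) ?_))
    simp [sampleConst]
  · exact hM_le.trans ((one_mul _).symm.trans_le (hC_of_le (one_le_sampleConst cα cb)))

namespace Regime

variable (h : Regime cα cb M L K)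
include h

theorem four_mul_errConst_le {H ε : ℝ} (hε : 0 ≤ ε)
    (hC : sampleConst cα cb * (M * L ^ 3) * H ^ 2 ≤ K * ε ^ 2) :
    4 * (H * (errConst cα cb * (rate M L K * M))) ≤ ε := by
  have hM := h.M_pos
  have hL := h.L_pos
  have hK : 0 < K := by exact_mod_cast h.K_pos
  refine le_trans (by ring_nf; rfl) (mul_rate_mul_le (a := 4 * errConst cα cb * H)
    hM hL.le hK hε (le_trans ?_ hC))
  rw [mul_pow, mul_right_comm]
  gcongr
  simp [sampleConst]

theorem failure_le {H ε δ N : ℝ} (hε : 0 < ε) (hεH : ε ≤ H)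
    (hC : sampleConst cα cb * (M * L ^ 3) * H ^ 2 ≤ K * ε ^ 2) (hδ : 0 ≤ δ) (hδ1 : δ ≤ 1)
    (hN : 1 ≤ N) : 16 * M / ε * (H * (2 * N * (δ / (K * N)) ^ 3)) ≤ δ := by
  have hK := h.K_pos
  have := h.M_pos
  have hHε : H / ε ≤ K := by
    have hsq : (H / ε) ^ 2 ≤ K := by
      rw [div_pow, div_le_iff₀ (by positivity)]
      exact (le_mul_of_one_le_left (sq_nonneg H)
        (one_le_mul_of_one_le_of_one_le (one_le_sampleConst cα cb)
          (one_le_mul_of_one_le_of_one_le h.one_le_M (one_le_pow₀ h.one_le_L)))).trans hC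
    exact (le_self_pow₀ ((one_le_div hε).2 hεH) two_ne_zero).trans hsq
  have hKN : 32 ≤ K * N ^ 2 := by
    have hK32 : (32 : ℝ) ≤ K := by exact_mod_cast h.K_large
    exact hK32.trans (le_mul_of_one_le_right hK.le (one_le_pow₀ hN))
  have hHε0 : 0 ≤ H / ε := div_nonneg (hε.le.trans hεH) hε.le
  calc 16 * M / ε * (H * (2 * N * (δ / (K * N)) ^ 3))
      = 32 * M * (H / ε) * (N * (δ / (K * N)) ^ 3) := by ring
    _ ≤ 32 * K * K * (N * (δ / (K * N)) ^ 3) := by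
        gcongr
        exact h.M_le
    _ = 32 * δ ^ 3 / (K * N ^ 2) := by field_simp
    _ ≤ K * N ^ 2 * δ / (K * N ^ 2) := by
        gcongr
        exact pow_le_of_le_one hδ hδ1 three_ne_zero
    _ = δ := mul_div_cancel_left₀ δ (by positivity)

theorem three_mul_div_le :
    3 * L / (rate M L K * K / (cα * L)) ≤ 3 * cα * (rate M L K * M) := by
  have hρ := h.rate_pos
  have hM := h.M_pos
  have hK := h.K_pos
  have hL := h.L_pos
  have hcα := h.cα_pos
  calc 3 * L / (rate M L K * K / (cα * L)) = 3 * cα * (L ^ 2 / (rate M L K * K)) := by field_simp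
    _ ≤ 3 * cα * (rate M L K * M) := by
        gcongr
        rw [div_le_iff₀ (by positivity)]
        calc L ^ 2 ≤ L ^ 3 := pow_le_pow_right₀ h.one_le_L (by norm_num)
          _ = rate M L K ^ 2 * (K * M) := by rw [h.rate_sq]; field_simp
          _ = rate M L K * M * (rate M L K * K) := by ring

theorem mul_mixWeight_le_rate {k : ℕ} (hk : k < K) :
    rate M L K * K / (cα * L) * mixWeight (stepα cα K) K (k + 1) ≤ rate M L K := by
  have hρ := h.rate_pos
  have hK := h.K_pos
  have hL := h.L_pos
  have hcα := h.cα_pos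
  calc _ ≤ rate M L K * K / (cα * L) * (cα * L / K) := by
        gcongr
        exact (mixWeight_harmStep_le_div h.one_le_c hk).trans (by gcongr; exact h.log_le)
    _ = rate M L K := by field_simp

theorem cb_rate_mul_M_mul_rate_mul_M_le : 18 * ((cb * rate M L K * M) * (rate M L K * M)) ≤ 1 := by
  have hM := h.M_pos
  have hprod : 24 * (cb * rate M L K * M) * (24 * (rate M L K * M)) ≤ 1 :=
    mul_le_one₀ h.cb_rate_mul_M_small (mul_nonneg (by norm_num) (mul_pos h.rate_pos hM).le)
      h.rate_mul_M_small
  have := mul_pos (mul_pos (mul_pos h.cb_pos h.rate_pos) hM) (mul_pos h.rate_pos hM)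
  linarith

theorem rate_mul_add_le_one :
    rate M L K * (3 * M) + rate M L K * (cb * rate M L K) * (3 * M) ^ 2 ≤ 1 := by
  linarith [h.rate_mul_M_small, h.cb_rate_mul_M_mul_rate_mul_M_le]

theorem bonus_add_le :
    cb * rate M L K + 2 * rate M L K + 2 * rate M L K * (cb * rate M L K) ^ 2 * (3 * M) ^ 2 ≤
      (2 * cb + 2) * rate M L K := by
  linarith [mul_le_mul_of_nonneg_left h.cb_rate_mul_M_mul_rate_mul_M_le
    (mul_pos h.cb_pos h.rate_pos).le]

end Regime

end Regime

/-! ### Sample complexity -/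

section SampleComplexity

variable {m S H : ℕ} {A : Fin m → ℕ} [∀ i, NeZero (A i)]

theorem robustQFTRL_isRobustCCE_of_eq_zero (hm : m = 0) (G : Game m S H A) {R cα cb δ ε : ℝ}
    {K : ℕ} (hcα : 0 < cα) (hε : 0 ≤ ε) (hδ : 0 ≤ δ) (hK : 2 ≤ K) (η : ℕ → ℝ) :
    ENNReal.ofReal (1 - δ) ≤ (robustQFTRL G R cb δ K (stepα cα K) η).toOuterMeasure
      {π | IsRobustCCE G R ε π} := by
  subst hm
  have hlog : 0 < Real.log K := Real.log_pos (by exact_mod_cast hK)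
  have hsupp : (robustQFTRL G R cb δ K (stepα cα K) η).support ⊆ {π | IsRobustCCE G R ε π} := by
    intro π hπ
    rw [robustQFTRL, PMF.support_map] at hπ
    obtain ⟨z, hz, rfl⟩ := hπ
    exact ⟨fun t s => isPolicyOnLast_of_mem_support_backwardLaw G R cb δ (by omega)
      (mul_pos hcα hlog) η H le_rfl z hz t (by simp) s,
      Real.iSup_le (fun s => Real.iSup_le (fun i => i.elim0) hε) hε⟩
  rw [(PMF.toOuterMeasure_apply_eq_one_iff _ _).2 hsupp, ← ENNReal.ofReal_one]
  exact ENNReal.ofReal_le_ofReal (sub_le_self 1 hδ)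

theorem toOuterMeasure_not_stepCert_le {G : Game m S H A} {R cα cb δ : ℝ} {K : ℕ}
    (hR : 0 ≤ R) (hR1 : R ≤ 1) (hreg : Regime cα cb (effHorizon H R) (logTerm S A K δ) K)
    (hA : ∀ i, Real.log (A i) ≤ logTerm S A K δ) {n : ℕ} (hn : n + 1 ≤ H)
    {V : Fin m → Fin S → ℝ} (hV : ∀ i s s', V i s - V i s' ≤ 2 * effHorizon H R) :
    (roundsLaw G R (stepα cα K) (stepη cα H R K) (stepIdx n hn) V K).toOuterMeasure
      {D | ¬ StepCert G R ((2 * cb + 2) * rate (effHorizon H R) (logTerm S A K δ) K)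
        ((3 * cα + cb) * (rate (effHorizon H R) (logTerm S A K δ) K * effHorizon H R)) n hn V
        (nextValue G R cb δ (stepα cα K) (stepη cα H R K) (stepIdx n hn) V D)
        (mixedPolicy G R (stepα cα K) (stepη cα H R K) (stepIdx n hn) V D) 0} ≤
      ENNReal.ofReal (2 * (S * ∑ i, (A i : ℝ)) * Real.exp (-(3 * logTerm S A K δ))) := by
  have hρ := hreg.rate_pos
  have hρθ := hreg.three_mul_div_le
  have hw {k : ℕ} (hk : k < K) := hreg.mul_mixWeight_le_rate hk
  have hρM := hreg.rate_mul_add_le_one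
  have hb := hreg.bonus_add_le
  set L := logTerm S A K δ
  set ρ := rate (effHorizon H R) L K
  set θ := ρ * K / (cα * L)
  have hθ : 0 < θ := div_pos (mul_pos hρ hreg.K_pos) (mul_pos hreg.cα_pos hreg.L_pos)
  have hcb := hreg.cb_pos
  have hslope : ρ ≤ (2 * cb + 2) * ρ := le_mul_of_one_le_left hρ.le (by linarith)
  have hprob := toOuterMeasure_not_goodEvent_le (G := G) (α := stepα cα K) (η := stepη cα H R K)
    (h := stepIdx n hn) (x := 3 * L) hR hR1 hreg.one_le_M hV
    (fun k _ => mul_nonneg hθ.le (mixWeight_harmStep_nonneg hreg.c_pos K k)) (fun k => hw)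
    (mul_pos hcb hρ).le hρ.le hρM hb
  refine le_trans (MeasureTheory.measure_mono ?_) hprob
  exact fun D hD hgood => hD <|
    stepCert_of_goodEvent hR hR1 hreg hA hn hV hθ (mul_pos three_pos hreg.L_pos).le
      (hρ.le.trans hslope) (fun k hk => (hw hk).trans hslope) (by linarith) hgood

theorem robustQFTRL_isRobustCCE_of_regime [NeZero S] {G : Game m S H A} {R cα cb δ ε : ℝ} {K : ℕ}
    (hR : 0 ≤ R) (hR1 : R ≤ 1) (hreg : Regime cα cb (effHorizon H R) (logTerm S A K δ) K)
    (hε : 0 < ε) (hεH : ε ≤ H) (hδ : 0 < δ) (hδ1 : δ ≤ 1) (hN : 1 ≤ S * ∑ i, (A i : ℝ))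
    (hA : ∀ i, Real.log (A i) ≤ logTerm S A K δ)
    (hC : sampleConst cα cb * (effHorizon H R * logTerm S A K δ ^ 3) * H ^ 2 ≤ K * ε ^ 2) :
    ENNReal.ofReal (1 - δ) ≤
      (robustQFTRL G R cb δ K (stepα cα K) (stepη cα H R K)).toOuterMeasure
        {π | IsRobustCCE G R ε π} := by
  have hexp : Real.exp (-(3 * logTerm S A K δ)) = (δ / (K * (S * ∑ i, (A i : ℝ)))) ^ 3 := by
    have hKN := mul_pos hreg.K_pos (zero_lt_one.trans_le hN)
    rw [← mul_assoc] at hKN ⊢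
    rw [← exp_neg_logTerm hKN hδ, ← Real.exp_nat_mul, Nat.cast_ofNat, mul_neg]
  have hprob := hreg.failure_le hε hεH hC hδ.le hδ1 hN
  have herror := hreg.four_mul_errConst_le hε.le hC
  have hsmall := hreg.small
  have hρ := hreg.rate_pos
  have hM := hreg.one_le_M
  have hcα := hreg.cα_pos
  have hcb := hreg.cb_pos
  rw [← hexp] at hprob
  refine toOuterMeasure_isRobustCCE_ge hR hR1 (effHorizon_eq_or H R) hreg
    (by positivity) (by linarith) (by positivity) hε (le_trans ?_ herror)
    (fun n hn V hV => toOuterMeasure_not_stepCert_le hR hR1 hreg hA hn hV.osc) hprob hδ.le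
  set ρ := rate (effHorizon H R) (logTerm S A K δ) K
  have hρM : (2 * cb + 2) * ρ ≤ (2 * cb + 2) * ρ * effHorizon H R :=
    le_mul_of_one_le_right (by positivity) hM
  rw [errConst]
  gcongr
  linarith

theorem robustQFTRL_isRobustCCE [NeZero S] {G : Game m S H A} {R cα cb δ ε : ℝ} {K : ℕ}
    (hm : m ≠ 0) (hcα : 0 < cα) (hcb : 0 < cb) (hR : 0 ≤ R) (hR1 : R ≤ 1) (hε : 0 < ε)
    (hεH : ε ≤ H) (hδ : 0 < δ) (hδ1 : δ ≤ 1) (hK : 2 ≤ K)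
    (hC : sampleConst cα cb * (H : ℝ) ^ 3 * S * (∑ i, (A i : ℝ)) / ε ^ 2 * effHorizon H R
        * logTerm S A K δ ^ 3 ≤ (K : ℝ) * H * S * ∑ i, (A i : ℝ)) :
    ENNReal.ofReal (1 - δ) ≤
      (robustQFTRL G R cb δ K (stepα cα K) (stepη cα H R K)).toOuterMeasure
        {π | IsRobustCCE G R ε π} := by
  have hH : (0 : ℝ) < H := hε.trans_le hεH
  have hS : (1 : ℝ) ≤ S := by exact_mod_cast NeZero.one_le
  have hA (i : Fin m) : (1 : ℝ) ≤ A i := by exact_mod_cast NeZero.one_le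
  have hA_le (i : Fin m) : (A i : ℝ) ≤ ∑ j, (A j : ℝ) :=
    Finset.single_le_sum (f := fun j => (A j : ℝ)) (fun j _ => Nat.cast_nonneg _)
      (Finset.mem_univ i)
  have hT : 1 ≤ ∑ j, (A j : ℝ) := (hA ⟨0, Nat.pos_of_ne_zero hm⟩).trans (hA_le _)
  have hN : 1 ≤ S * ∑ j, (A j : ℝ) := one_le_mul_of_one_le_of_one_le hS hT
  have hK1 : (1 : ℝ) ≤ K := by exact_mod_cast one_le_two.trans hK
  have hlogK : Real.log K ≤ logTerm S A K δ := by
    refine log_le_logTerm (by linarith) ?_ hδ hδ1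
    rw [mul_assoc]
    exact le_mul_of_one_le_right (by linarith) hN
  have hlogA (i : Fin m) : Real.log (A i) ≤ logTerm S A K δ :=
    log_le_logTerm (by linarith [hA i]) ((hA_le i).trans (le_mul_of_one_le_left (by linarith)
      (one_le_mul_of_one_le_of_one_le hK1 hS))) hδ hδ1
  have hC' : sampleConst cα cb * (effHorizon H R * logTerm S A K δ ^ 3) * H ^ 2 ≤ K * ε ^ 2 := by
    refine le_of_mul_le_mul_right (a := H * S * ∑ i, (A i : ℝ)) ?_ (by positivity)
    calc _ = sampleConst cα cb * (H : ℝ) ^ 3 * S * (∑ i, (A i : ℝ)) / ε ^ 2 * effHorizon H R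
          * logTerm S A K δ ^ 3 * ε ^ 2 := by field_simp
      _ ≤ K * H * S * (∑ i, (A i : ℝ)) * ε ^ 2 := by gcongr
      _ = _ := by ring
  have hCK : sampleConst cα cb * (effHorizon H R * logTerm S A K δ ^ 3) ≤ K :=
    le_of_mul_le_mul_right (hC'.trans (by gcongr)) (by positivity : (0 : ℝ) < H ^ 2)
  have hreg := Regime.of_large hcα hcb
    (one_le_effHorizon (by exact_mod_cast hH) hR hR1) hK hlogK hCK
  exact robustQFTRL_isRobustCCE_of_regime hR hR1 hreg hε hεH hδ hδ1 hN hlogA hC'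

end SampleComplexity

end RobustMG

end

theorem theorem1 :
    ∀ cα cb : ℝ, 0 < cα → 0 < cb →
      ∃ C : ℝ, 0 < C ∧
        ∀ (m S H : ℕ) [NeZero S] (A : Fin m → ℕ) [∀ i, NeZero (A i)]
          (G : RobustMG.Game m S H A) (R ε δ : ℝ) (K : ℕ),
          0 ≤ R → R < 1 → 0 < ε → ε ≤ H → 0 < δ → δ < 1 → 2 ≤ K →
          C * (H : ℝ) ^ 3 * S * (∑ i, (A i : ℝ)) / ε ^ 2 * RobustMG.effHorizon H R
              * RobustMG.logTerm S A K δ ^ 3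
            ≤ (K : ℝ) * H * S * ∑ i, (A i : ℝ) →
          ENNReal.ofReal (1 - δ) ≤
            (RobustMG.robustQFTRL G R cb δ K (RobustMG.stepα cα K)
              (RobustMG.stepη cα H R K)).toOuterMeasure
              {π | RobustMG.IsRobustCCE G R ε π} := by
  intro cα cb hcα hcb
  refine ⟨RobustMG.sampleConst cα cb,
    zero_lt_one.trans_le (RobustMG.one_le_sampleConst cα cb), ?_⟩
  intro m S H _ A _ G R ε δ K hR hR1 hε hεH hδ hδ1 hK hC
  rcases eq_or_ne m 0 with hm | hm
  · exact RobustMG.robustQFTRL_isRobustCCE_of_eq_zero hm G hcα hε.le hδ.le hK _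
  · exact RobustMG.robustQFTRL_isRobustCCE hm hcα hcb hR hR1.le hε hεH hδ hδ1.le hK hC
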